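/- Let $p,q\in\mathbb N$ with $2\le p\le 2^{q-1}-3$, and put $e_{\min}=-2^{q-1}+2$, $e_{\max}=2^{q-1}-1$. Let $\mathbb F$ be the set of finite floating-point numbers $\pm(1.m_1\cdots m_p)_2\times 2^{e}$ with $e_{\min}\le e\le e_{\max}$ and $\pm(0.m_1\cdots m_p)_2\times 2^{e_{\min}}$, where $m_i\in\{0,1\}$, let $\Omega=(2-2^{-p})2^{e_{\max}}$ be the largest of them, and let $\overline{\mathbb F}=\mathbb F\cup\{\infty,-\infty,\mathrm{NaN}\}$. Rounding. For real $x$, $\lceil x\rfloor$ is $\infty$ if $x\ge\Omega+2^{e_{\max}-p-1}$, is $-\infty$ if $x\le-\Omega-2^{e_{\max}-p-1}$, and otherwise is the element of $\mathbb F$ nearest to $x$ (in a tie, the one with $m_p=0$); also $\lceil\pm\infty\rfloor=\pm\infty$ and $\lceil\mathrm{NaN}\rfloor=\mathrm{NaN}$. Put $x\oplus y=\lceil x+y\rfloor$ and $x\otimes y=\lceil xy\rfloor$ on $\overline{\mathbb F}$, where $\infty+(-\infty)$, $0\cdot(\pm\infty)$ and every operation on $\mathrm{NaN}$ give $\mathrm{NaN}$.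 For $\rho:\mathbb R\to\mathbb R$, its correctly rounded version $\lceil\rho\rfloor:\overline{\mathbb F}\to\overline{\mathbb F}$ sends $x\in\mathbb F$ to $\lceil\rho(x)\rfloor$, sends $\pm\infty$ to $\lceil\lim_{t\to\pm\infty}\rho(t)\rfloor$ if this limit exists in $[-\infty,\infty]$ and to $\mathrm{NaN}$ otherwise, and sends $\mathrm{NaN}$ to $\mathrm{NaN}$. Reduction orders. An order of summation for one number is trivial. An order of summation for $n\ge2$ numbers consists of a pair $1\le i<j\le n$ and an order of summation for $n-1$ numbers; the sum of $(x_1,\dots,x_n)$ in this order is the sum, in the latter order, of the $(n-1)$-tuple whose first entry is $x_i\oplus x_j$ and whose further entries are the $x_k$ with $k\ne i,j$ in their original order. A reduction order $S=(o_n)_{n\ge1}$ consists of one order of summation $o_n$ for each $n\ge1$; write $\Sigma(x_1,\dots,x_n;o_n)$ for the resulting sum. Networks. An affine transformation under $S$ is a map $\overline{\mathbb F}^{m}\to\overline{\mathbb F}^{k}$ ($m,k\ge1$) with coordinates $x\mapsto\Sigma(w_{i,1}\otimes x_1,\dots,w_{i,m}\otimes x_m;o_m)\oplus b_i$, where $w_{i,j},b_i\in\mathbb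 F$. For $\sigma:\overline{\mathbb F}\to\overline{\mathbb F}$, a $\sigma$ network under $S$ is a composition $A_L\circ\sigma\circ A_{L-1}\circ\cdots\circ\sigma\circ A_1$, $L\ge1$, of affine transformations $A_\ell$ under $S$, with $\sigma$ applied coordinatewise. Let $\sigma=\lceil\rho\rfloor$, where $\rho$ is one of the following functions: - $\mathrm{Identity}(x)=x$; - $\mathrm{ReLU}(x)=\max(0,x)$; - $\mathrm{ELU}(x)=x$ for $x\ge0$ and $e^x-1$ for $x<0$; - $\mathrm{SeLU}(x)=\lambda x$ for $x>0$ and $\lambda\alpha(e^x-1)$ for $x\le0$, where $\alpha,\lambda$ are any real constants with $|\alpha-1.6732|\le10^{-4}$ and $|\lambda-1.0507|\le10^{-4}$; - $\mathrm{GELU}(x)=\frac x2\bigl(1+\frac2{\sqrt\pi}\int_0^{x/\sqrt2}e^{-t^2}\,dt\bigr)$; - $\mathrm{Swish}(x)=x/(1+e^{-x})$; - $\mathrm{Mish}(x)=x\tanh(\log(1+e^x))$; - $\sin x$. Then for every reduction order $S$ and every integer $d\ge1$, $\sigma$ networks under $S$ can represent all functions from $(-2^{e_{\max}-1},2^{e_{\max}-1})_{\mathbb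 F}^d$ to $\mathbb F\cup\{-\infty,\infty\}$. That is, for every $f:\{x\in\mathbb F:|x|<2^{e_{\max}-1}\}^d\to\mathbb F\cup\{-\infty,\infty\}$ there is a $\sigma$ network $g$ under $S$ such that $g(x)=f(x)$ for all $x$ in the domain of $f$. -/

import Mathlib

noncomputable section

namespace FPNN

/-! ### Floating-point numbers with `p` mantissa bits and `q` exponent bits -/

/-- Smallest exponent. -/
def emin (q : ℕ) : ℤ := -2 ^ (q - 1) + 2

/-- Largest exponent. -/
def emax (q : ℕ) : ℤ := 2 ^ (q - 1) - 1

/-- `x` is `± 1.m₁…mₚ × 2 ^ e` with `emin ≤ e ≤ emax`, or `± 0.m₁…mₚ × 2 ^ emin`. The string of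
mantissa bits is given as the natural number `m = (m₁…mₚ)₂ < 2 ^ p`, so that `0.m₁…mₚ = m / 2 ^ p`
and the last bit `mₚ` is the parity of `m`. -/
def HasMantissa (p q m : ℕ) (x : ℝ) : Prop :=
  m < 2 ^ p ∧ ∃ s : ℝ, (s = 1 ∨ s = -1) ∧
    ((∃ e : ℤ, emin q ≤ e ∧ e ≤ emax q ∧ x = s * (1 + (m : ℝ) / 2 ^ p) * (2 : ℝ) ^ e) ∨
      x = s * ((m : ℝ) / 2 ^ p) * (2 : ℝ) ^ emin q)

/-- The finite floating-point numbers. -/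
def FinFloat (p q : ℕ) : Set ℝ := {x | ∃ m : ℕ, HasMantissa p q m x}

/-- The last mantissa bit of the finite float `x` is zero. -/
def LastBitZero (p q : ℕ) (x : ℝ) : Prop := ∃ m : ℕ, Even m ∧ HasMantissa p q m x

/-- The largest finite float `(2 - 2 ^ (-p)) × 2 ^ emax`. -/
def maxFloat (p q : ℕ) : ℝ := (2 - (2 : ℝ) ^ (-(p : ℤ))) * (2 : ℝ) ^ emax q

/-- All floating-point numbers: the finite ones, the two infinities and not-a-number. -/
inductive ExtFloat (p q : ℕ) : Type
  | finite (x : FinFloat p q) : ExtFloat p q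
  | posInf : ExtFloat p q
  | negInf : ExtFloat p q
  | nan : ExtFloat p q

/-! ### Rounding -/

/-- `y` is a finite float nearest to `x`; if there is another one, the last mantissa bit of `y`
is zero. -/
def IsNearest (p q : ℕ) (x y : ℝ) : Prop :=
  y ∈ FinFloat p q ∧ (∀ z ∈ FinFloat p q, |x - y| ≤ |x - z|) ∧
    ∀ z ∈ FinFloat p q, z ≠ y → |x - z| = |x - y| → LastBitZero p q y

theorem zero_mem_finFloat (p q : ℕ) : (0 : ℝ) ∈ FinFloat p q :=
  ⟨0, by positivity, 1, Or.inl rfl, Or.inr (by simp)⟩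

theorem finite_finFloat (p q : ℕ) : (FinFloat p q).Finite := by
  have h1 : (Set.image (fun t : ℕ × ℝ × ℤ =>
      t.2.1 * (1 + (t.1 : ℝ) / 2 ^ p) * (2 : ℝ) ^ t.2.2)
      (Set.Iio (2 ^ p) ×ˢ (({1, -1} : Set ℝ) ×ˢ Set.Icc (emin q) (emax q)))).Finite :=
    Set.Finite.image _ ((Set.finite_Iio _).prod
      ((Set.toFinite _).prod (Set.finite_Icc _ _)))
  have h2 : (Set.image (fun t : ℕ × ℝ => t.2 * ((t.1 : ℝ) / 2 ^ p) * (2 : ℝ) ^ emin q)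
      (Set.Iio (2 ^ p) ×ˢ ({1, -1} : Set ℝ))).Finite :=
    Set.Finite.image _ ((Set.finite_Iio _).prod (Set.toFinite _))
  refine (h1.union h2).subset ?_
  rintro x ⟨m, hm, s, hs, ⟨e, he1, he2, rfl⟩ | rfl⟩
  · exact Or.inl ⟨(m, s, e), ⟨hm, hs, he1, he2⟩, rfl⟩
  · exact Or.inr ⟨(m, s), ⟨hm, hs⟩, rfl⟩

/-- Two positive finite floats whose last mantissa bits are one are not adjacent. -/
theorem exists_between_pos {p q : ℕ} {x y : ℝ} (hx : x ∈ FinFloat p q) (hy : y ∈ FinFloat p q)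
    (hx0 : 0 < x) (hxy : x < y) (hxo : ¬ LastBitZero p q x) (hyo : ¬ LastBitZero p q y) :
    ∃ z ∈ FinFloat p q, x < z ∧ z < y := by
  have hP : (0 : ℝ) < 2 ^ p := by positivity
  have key : ∀ v ∈ FinFloat p q, 0 < v → ¬ LastBitZero p q v → ∃ m : ℕ, m < 2 ^ p ∧ Odd m ∧
      ((∃ e : ℤ, emin q ≤ e ∧ e ≤ emax q ∧ v = (1 + (m : ℝ) / 2 ^ p) * (2 : ℝ) ^ e) ∨
        v = ((m : ℝ) / 2 ^ p) * (2 : ℝ) ^ emin q) := by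
    rintro v ⟨m, hm⟩ hv hvo
    have hodd : Odd m := by
      by_contra h
      exact hvo ⟨m, Nat.not_odd_iff_even.mp h, hm⟩
    obtain ⟨hm, s, hs, h⟩ := hm
    refine ⟨m, hm, hodd, ?_⟩
    rcases hs with rfl | rfl
    · simpa using h
    · exfalso
      rcases h with ⟨e, _, _, h⟩ | h
      · have : 0 < (1 + (m : ℝ) / 2 ^ p) * (2 : ℝ) ^ e := by positivity
        linarith
      · have : 0 ≤ ((m : ℝ) / 2 ^ p) * (2 : ℝ) ^ emin q := by positivity
        linarith
  have pow_mem : ∀ e : ℤ, emin q ≤ e → e ≤ emax q → (2 : ℝ) ^ e ∈ FinFloat p q :=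
    fun e h1 h2 => ⟨0, by positivity, 1, Or.inl rfl, Or.inl ⟨e, h1, h2, by simp⟩⟩
  have frac : ∀ m : ℕ, m < 2 ^ p → (m : ℝ) / 2 ^ p < 1 := fun m hm => by
    rw [div_lt_one hP]
    exact_mod_cast hm
  have gap : ∀ a b : ℕ, a < 2 ^ p → b < 2 ^ p → Odd a → Odd b → (a : ℝ) / 2 ^ p < b / 2 ^ p →
      a + 1 < 2 ^ p ∧ (a : ℝ) / 2 ^ p < ((a + 1 : ℕ) : ℝ) / 2 ^ p ∧
        ((a + 1 : ℕ) : ℝ) / 2 ^ p < b / 2 ^ p := by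
    intro a b ha hb hao hbo hab
    rw [div_lt_div_iff_of_pos_right hP, Nat.cast_lt] at hab
    have h2 : a + 1 < b := by
      obtain ⟨i, rfl⟩ := hao
      obtain ⟨j, rfl⟩ := hbo
      omega
    refine ⟨by omega, ?_, ?_⟩
    · exact div_lt_div_of_pos_right (by exact_mod_cast Nat.lt_succ_self a) hP
    · exact div_lt_div_of_pos_right (by exact_mod_cast h2) hP
  have oddpos : ∀ m : ℕ, Odd m → 0 < (m : ℝ) / 2 ^ p := fun m hm =>
    div_pos (by exact_mod_cast hm.pos) hP
  -- powers of two separate different binades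
  have sep : ∀ e : ℤ, emin q ≤ e → e ≤ emax q → ∀ m : ℕ, Odd m →
      y = (1 + (m : ℝ) / 2 ^ p) * (2 : ℝ) ^ e → x < (2 : ℝ) ^ e →
      ∃ z ∈ FinFloat p q, x < z ∧ z < y := by
    intro e h1 h2 m hm h hx
    refine ⟨_, pow_mem e h1 h2, hx, ?_⟩
    have := mul_pos (oddpos m hm) (zpow_pos (two_pos : (0 : ℝ) < 2) e)
    rw [h]
    linarith
  obtain ⟨a, ha, hao, hxa⟩ := key x hx hx0 hxo
  obtain ⟨b, hb, hbo, hyb⟩ := key y hy (hx0.trans hxy) hyo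
  have hE : (0 : ℝ) < 2 ^ emin q := zpow_pos two_pos _
  have mono : ∀ {e f : ℤ}, e ≤ f → (2 : ℝ) ^ e ≤ 2 ^ f := fun h =>
    zpow_le_zpow_right₀ one_le_two h
  have up : ∀ (m : ℕ) (e : ℤ), m < 2 ^ p → (1 + (m : ℝ) / 2 ^ p) * (2 : ℝ) ^ e < 2 ^ (e + 1) := by
    intro m e hm
    rw [zpow_add_one₀ two_ne_zero, mul_comm]
    exact mul_lt_mul_of_pos_left (by linarith [frac m hm]) (zpow_pos two_pos _)
  rcases hxa with ⟨e, he1, he2, hxe⟩ | hxe <;> rcases hyb with ⟨f, hf1, hf2, hyf⟩ | hyf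
  · rcases lt_trichotomy e f with h | h | h
    · exact sep f hf1 hf2 b hbo hyf
        (hxe ▸ (up a e ha).trans_le (mono (by omega)))
    · subst h
      have hF : (0 : ℝ) < 2 ^ e := zpow_pos two_pos _
      have hab : (a : ℝ) / 2 ^ p < b / 2 ^ p := by
        rw [hxe, hyf, mul_lt_mul_iff_left₀ hF] at hxy
        linarith
      obtain ⟨h1, h2, h3⟩ := gap a b ha hb hao hbo hab
      refine ⟨(1 + ((a + 1 : ℕ) : ℝ) / 2 ^ p) * (2 : ℝ) ^ e,
        ⟨a + 1, h1, 1, Or.inl rfl, Or.inl ⟨e, he1, he2, by ring⟩⟩, ?_, ?_⟩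
      · rw [hxe]
        exact mul_lt_mul_of_pos_right (by linarith) hF
      · rw [hyf]
        exact mul_lt_mul_of_pos_right (by linarith) hF
    · exfalso
      have h1 := up b f hb
      have h2 : (2 : ℝ) ^ (f + 1) ≤ 2 ^ e := mono (by omega)
      have h3 := mul_pos (oddpos a hao) (zpow_pos (two_pos : (0 : ℝ) < 2) e)
      rw [hxe, hyf] at hxy
      linarith
  · exfalso
    have h1 : (b : ℝ) / 2 ^ p * (2 : ℝ) ^ emin q < 1 * 2 ^ emin q :=
      mul_lt_mul_of_pos_right (frac b hb) hE
    have h2 : (2 : ℝ) ^ emin q ≤ 2 ^ e := mono he1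
    have h3 := mul_pos (oddpos a hao) (zpow_pos (two_pos : (0 : ℝ) < 2) e)
    rw [hxe, hyf] at hxy
    linarith
  · refine sep f hf1 hf2 b hbo hyf ?_
    have h1 : (a : ℝ) / 2 ^ p * (2 : ℝ) ^ emin q < 1 * 2 ^ emin q :=
      mul_lt_mul_of_pos_right (frac a ha) hE
    have h2 : (2 : ℝ) ^ emin q ≤ 2 ^ f := mono hf1
    rw [hxe]
    linarith
  · have hab : (a : ℝ) / 2 ^ p < b / 2 ^ p := by
      rwa [hxe, hyf, mul_lt_mul_iff_left₀ hE] at hxy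
    obtain ⟨h1, h2, h3⟩ := gap a b ha hb hao hbo hab
    refine ⟨((a + 1 : ℕ) : ℝ) / 2 ^ p * (2 : ℝ) ^ emin q,
      ⟨a + 1, h1, 1, Or.inl rfl, Or.inr (by ring)⟩, ?_, ?_⟩
    · rw [hxe]
      exact mul_lt_mul_of_pos_right h2 hE
    · rw [hyf]
      exact mul_lt_mul_of_pos_right h3 hE

theorem HasMantissa.neg {p q m : ℕ} {x : ℝ} (h : HasMantissa p q m x) :
    HasMantissa p q m (-x) := by
  obtain ⟨hm, s, hs, h⟩ := h
  refine ⟨hm, -s, by rcases hs with rfl | rfl <;> simp, ?_⟩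
  rcases h with ⟨e, h1, h2, rfl⟩ | rfl
  · exact Or.inl ⟨e, h1, h2, by ring⟩
  · exact Or.inr (by ring)

theorem exists_between {p q : ℕ} {x y : ℝ} (hx : x ∈ FinFloat p q) (hy : y ∈ FinFloat p q)
    (hxy : x < y) (hxo : ¬ LastBitZero p q x) (hyo : ¬ LastBitZero p q y) :
    ∃ z ∈ FinFloat p q, x < z ∧ z < y := by
  have nz : LastBitZero p q 0 :=
    ⟨0, Even.zero, by positivity, 1, Or.inl rfl, Or.inr (by simp)⟩
  have hx0 : x ≠ 0 := fun h => hxo (h ▸ nz)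
  have hy0 : y ≠ 0 := fun h => hyo (h ▸ nz)
  have ng : ∀ {v : ℝ}, ¬ LastBitZero p q v → ¬ LastBitZero p q (-v) := by
    rintro v hv ⟨m, hm, h⟩
    exact hv ⟨m, hm, by simpa using h.neg⟩
  rcases lt_or_gt_of_ne hx0 with h | h
  · rcases lt_or_gt_of_ne hy0 with h' | h'
    · obtain ⟨m, hm⟩ := hx
      obtain ⟨n, hn⟩ := hy
      obtain ⟨z, ⟨k, hz⟩, h1, h2⟩ := exists_between_pos (x := -y) (y := -x) ⟨n, hn.neg⟩
        ⟨m, hm.neg⟩ (by linarith) (by linarith) (ng hyo) (ng hxo)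
      exact ⟨-z, ⟨k, hz.neg⟩, by linarith, by linarith⟩
    · exact ⟨0, zero_mem_finFloat p q, h, h'⟩
  · exact exists_between_pos hx hy h hxy hxo hyo

theorem exists_isNearest (p q : ℕ) (x : ℝ) : ∃ y, IsNearest p q x y := by
  obtain ⟨y, hy, hmin⟩ := Set.exists_min_image (FinFloat p q) (fun z => |x - z|)
    (finite_finFloat p q) ⟨0, zero_mem_finFloat p q⟩
  by_cases hyo : LastBitZero p q y
  · exact ⟨y, hy, hmin, fun _ _ _ _ => hyo⟩
  by_cases hz : ∃ z ∈ FinFloat p q, z ≠ y ∧ |x - z| = |x - y|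
  · obtain ⟨z, hz, hne, heq⟩ := hz
    refine ⟨z, hz, fun w hw => heq ▸ hmin w hw, fun _ _ _ _ => ?_⟩
    by_contra hzo
    have strict : ∀ a b c : ℝ, |x - a| = |x - b| → a < c → c < b → |x - c| < |x - a| := by
      intro a b c h h1 h2
      rcases abs_eq_abs.mp h with h | h
      · linarith
      · rw [show x - a = (b - a) / 2 by linarith, abs_of_pos (by linarith : 0 < (b - a) / 2),
          abs_lt]
        constructor <;> linarith
    rcases lt_or_gt_of_ne hne with h | h
    · obtain ⟨c, hc, h1, h2⟩ := exists_between hz hy h hzo hyo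
      have := strict z y c heq h1 h2
      have := hmin c hc
      linarith
    · obtain ⟨c, hc, h1, h2⟩ := exists_between hy hz h hyo hzo
      have := strict y z c heq.symm h1 h2
      have := hmin c hc
      linarith
  · push Not at hz
    exact ⟨y, hy, hmin, fun z h1 h2 h3 => absurd h3 (hz z h1 h2)⟩

/-- The finite float nearest to `x`, ties to even. -/
def nearest (p q : ℕ) (x : ℝ) : FinFloat p q :=
  ⟨(exists_isNearest p q x).choose, (exists_isNearest p q x).choose_spec.1⟩

/-- Rounding of a real number, with overflow to the infinities. -/
def roundReal (p q : ℕ) (x : ℝ) : ExtFloat p q :=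
  if maxFloat p q + (2 : ℝ) ^ (emax q - p - 1) ≤ x then .posInf
  else if x ≤ -maxFloat p q - (2 : ℝ) ^ (emax q - p - 1) then .negInf
  else .finite (nearest p q x)

open Classical in
/-- Rounding of an extended real number. -/
def roundEReal (p q : ℕ) (x : EReal) : ExtFloat p q :=
  if x = ⊤ then .posInf else if x = ⊥ then .negInf else roundReal p q x.toReal

/-! ### Floating-point operations -/

/-- Floating-point addition: the exact sum, rounded; `∞ + (-∞)` is not a number. -/
def ExtFloat.add {p q : ℕ} : ExtFloat p q → ExtFloat p q → ExtFloat p q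
  | .nan, _ => .nan
  | _, .nan => .nan
  | .finite x, .finite y => roundReal p q ((x : ℝ) + (y : ℝ))
  | .posInf, .negInf => .nan
  | .negInf, .posInf => .nan
  | .posInf, _ => .posInf
  | _, .posInf => .posInf
  | .negInf, _ => .negInf
  | _, .negInf => .negInf

/-- The product of an infinity of sign `s = ± 1` and of `x`; `∞ × 0` is not a number. -/
def infMul {p q : ℕ} (s x : ℝ) : ExtFloat p q :=
  if 0 < s * x then .posInf else if s * x < 0 then .negInf else .nan

/-- Floating-point multiplication: the exact product, rounded. -/
def ExtFloat.mul {p q : ℕ} : ExtFloat p q → ExtFloat p q → ExtFloat p q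
  | .nan, _ => .nan
  | _, .nan => .nan
  | .finite x, .finite y => roundReal p q ((x : ℝ) * (y : ℝ))
  | .finite x, .posInf => infMul 1 x
  | .finite x, .negInf => infMul (-1) x
  | .posInf, .finite y => infMul 1 y
  | .negInf, .finite y => infMul (-1) y
  | .posInf, .posInf => .posInf
  | .negInf, .negInf => .posInf
  | .posInf, .negInf => .negInf
  | .negInf, .posInf => .negInf

open Classical in
/-- The correctly rounded version of a real function. At the infinities it is the rounded limit
in the extended reals if that limit exists, and not a number otherwise. -/
def correctlyRounded (p q : ℕ) (ρ : ℝ → ℝ) : ExtFloat p q → ExtFloat p q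
  | .finite x => roundReal p q (ρ x)
  | .negInf =>
      if h : ∃ l : EReal, Filter.Tendsto (fun t : ℝ => (ρ t : EReal)) Filter.atBot (nhds l)
      then roundEReal p q h.choose else .nan
  | .posInf =>
      if h : ∃ l : EReal, Filter.Tendsto (fun t : ℝ => (ρ t : EReal)) Filter.atTop (nhds l)
      then roundEReal p q h.choose else .nan
  | .nan => .nan

/-! ### Reduction orders -/

/-- The possible orders of reducing `n` summands: choose entries `i < j`, replace them by their
sum, and go on with the remaining `n - 1` entries until only one is left. -/
inductive SumOrder : ℕ → Type
  | single : SumOrder 1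
  | step {n : ℕ} (i j : Fin (n + 2)) (hij : i < j) (o : SumOrder (n + 1)) : SumOrder (n + 2)

/-- `(xᵢ ⊕ xⱼ, x₁, …, xₙ)` where the entries `xᵢ` and `xⱼ` are omitted after the first place. -/
def reducePair {p q n : ℕ} (x : Fin (n + 2) → ExtFloat p q) (i j : Fin (n + 2)) (hij : i < j) :
    Fin (n + 1) → ExtFloat p q :=
  Fin.cons ((x i).add (x j))
    (fun k : Fin n => x (j.succAbove ((i.castPred (Fin.ne_last_of_lt hij)).succAbove k)))

/-- The floating-point sum in a given order. -/
def SumOrder.sum {p q : ℕ} : {n : ℕ} → SumOrder n → (Fin n → ExtFloat p q) → ExtFloat p q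
  | _, .single, x => x 0
  | _, .step i j hij o, x => o.sum (reducePair x i j hij)

/-- A reduction order fixes, for each number `n ≥ 1` of summands, an order of summation. -/
def ReductionOrder : Type := (n : ℕ) → 0 < n → SumOrder n

/-! ### Networks -/

/-- Finite weights and biases of an affine transformation. -/
structure AffineParams (p q din dout : ℕ) : Type where
  weight : Fin dout → Fin din → FinFloat p q
  bias : Fin dout → FinFloat p q

/-- The floating-point affine transformation; the bias is added last. -/
def AffineParams.eval {p q din dout : ℕ} (I : AffineParams p q din dout) (S : ReductionOrder)
    (hd : 0 < din) (x : Fin din → ExtFloat p q) : Fin dout → ExtFloat p q :=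
  fun i => ((S din hd).sum (fun j => (ExtFloat.finite (I.weight i j)).mul (x j))).add
    (.finite (I.bias i))

/-- The parameters of a network with any number `L ≥ 1` of layers, of any positive widths. -/
inductive Network (p q : ℕ) : ℕ → ℕ → Type
  | last {din dout : ℕ} (hd : 0 < din) (I : AffineParams p q din dout) : Network p q din dout
  | layer {din dmid dout : ℕ} (hd : 0 < din) (I : AffineParams p q din dmid)
      (N : Network p q dmid dout) : Network p q din dout

/-- The network `aff_L ∘ σ ∘ ⋯ ∘ σ ∘ aff_1` under the reduction order `S`. -/
def Network.eval {p q : ℕ} (S : ReductionOrder) (σ : ExtFloat p q → ExtFloat p q) :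
    {din dout : ℕ} → Network p q din dout → (Fin din → ExtFloat p q) → Fin dout → ExtFloat p q
  | _, _, .last hd I, x => I.eval S hd x
  | _, _, .layer hd I N, x => N.eval S σ (fun i => σ (I.eval S hd x i))

/-- The points of `(-2 ^ (emax - 1), 2 ^ (emax - 1)) ^ d` with float coordinates. -/
def Box (p q d : ℕ) : Set (Fin d → FinFloat p q) :=
  {x | ∀ i, |(x i : ℝ)| < (2 : ℝ) ^ (emax q - 1)}

/-! ### Activation functions -/

def relu (x : ℝ) : ℝ := max 0 x

def elu (x : ℝ) : ℝ := if 0 ≤ x then x else Real.exp x - 1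

def selu (α lam x : ℝ) : ℝ := lam * if 0 < x then x else α * (Real.exp x - 1)

def gelu (x : ℝ) : ℝ :=
  x / 2 * (1 + 2 / √Real.pi * ∫ t in (0 : ℝ)..(x / √2), Real.exp (-t ^ 2))

def swish (x : ℝ) : ℝ := x / (1 + Real.exp (-x))

def softplus (x : ℝ) : ℝ := Real.log (1 + Real.exp x)

def mish (x : ℝ) : ℝ := x * Real.tanh (softplus x)

end FPNN

end

/-! The function `f` is a sum, over the points `z` of the finite domain, of functions that vanish
off `z`, so it suffices to compute the delta functions of points exactly and to combine them in
the output layer. Since rounded addition is not associative, all neurons are arranged so that at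
most two of the summands that they receive are nonzero. The result of such a sum does not depend
on the order of summation (`Admissible.sum_pair`), because adding zero is exact; so the reduction
order plays no role, and the functions computed by single neurons can be described by a recursion,
`Reach`. In the output layer the delta function at `z`, with value `2 ^ e`, is multiplied by two
weights. One of them yields a given finite float exactly, if `e` is chosen according to its size,
and two overflowing ones yield an infinity (`Admissible.exists_network_of_reach_delta`).

The delta functions come from Boolean circuits: the first layers compare a coordinate with a
constant, and nor-gates, which suffice for everything else (`exists_forall_ne_mem`), need two
inputs only. What remains is to encode truth values by floats such that comparisons and nor-gates
are exact. There are two kinds of activation functions.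

*Rectifier-like functions* (`ReluLike`: all but the identity and the sine). They are comparable to
`t` for `t > 0`, and on the other half-line bounded, nonpositive and convergent at `-∞`. Rounding
makes the latter useful: a product that overflows to `-∞` is sent by the activation function to
the rounded limit `κ`, whatever the other summand is, as long as it is not `∞`. Hence a comparison
is amplified by a few layers until one alternative overflows; then one truth value is `κ`, and the
other one is a constant `≥ 8`, and a nor-gate works by overflow (`Admissible.reluLike_nor`). In
the last step two neurons with the common value `κ` off `z` are subtracted, so that they cancel
there, and at `z` the activation function is applied to a float that it sends to a power of two
after rounding (`HitsPow`). Such floats exist near `1` for the piecewise ones, where the function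
is linear. The other ones are of the form `t * g t` with a gate `g` (`Gate`), which is close to
`1` near `2 ^ (emax - 1)` and close to its value `g 0` for tiny arguments.

*Odd functions* (`SineLike`: the identity and the sine). Here the truth values are the least
positive float `τ` and zero. The difference of a coordinate and a constant vanishes at just one
value of the coordinate. Multiplication by `5 / 8`, even with rounding, strictly decreases the
absolute values of all floats but zero and `± τ`, so after many layers only the sign of this
difference is left, as one of `-τ, 0, τ` (`Admissible.sineLike_sign`). On small multiples of `τ` a
weight in `ℤ / 8` acts by rounding to the nearest multiple, which is not linear, and this gives
nor-gates. Multiplication by `2 ^ emax` and by a suitable float finally turns `τ` into `1`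
(`Admissible.sineLike_delta`). -/

namespace FPNN

variable {p q : ℕ}

/-! ### The set of finite floats -/

/-- The standing assumptions on the two formats: `p ≥ 2` mantissa bits and enough exponents. -/
structure Admissible (p q : ℕ) : Prop where
  two_le : 2 ≤ p
  add_three_le : p + 3 ≤ 2 ^ (q - 1)

theorem emin_eq (q : ℕ) : emin q = 1 - emax q := by
  unfold emin emax
  ring

theorem Admissible.add_two_le_emax (H : Admissible p q) : (p : ℤ) + 2 ≤ emax q := by
  have := H.add_three_le
  have h : ((p + 3 : ℕ) : ℤ) ≤ ((2 ^ (q - 1) : ℕ) : ℤ) := by exact_mod_cast this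
  push_cast at h
  unfold emax
  linarith

theorem Admissible.seven_le_emax (H : Admissible p q) : 7 ≤ emax q := by
  have h1 := H.add_three_le
  have h2 := H.two_le
  have h3 : 3 ≤ q - 1 := by
    by_contra h
    have : 2 ^ (q - 1) ≤ 2 ^ 2 := Nat.pow_le_pow_right (by norm_num) (by omega)
    omega
  have h4 : (2 : ℤ) ^ 3 ≤ 2 ^ (q - 1) := pow_le_pow_right₀ (by norm_num) h3
  unfold emax
  linarith

theorem natCast_mul_zpow_mem (n : ℕ) (k : ℤ) (hn : n < 2 ^ (p + 1)) (hk : emin q - p ≤ k)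
    (hk' : k + p ≤ emax q) : (n : ℝ) * 2 ^ k ∈ FinFloat p q := by
  rcases Nat.eq_zero_or_pos n with rfl | hpos
  · simpa using zero_mem_finFloat p q
  set a := Nat.log 2 n with ha
  have h1 : 2 ^ a ≤ n := Nat.pow_log_le_self 2 hpos.ne'
  have h2 : n < 2 ^ (a + 1) := Nat.lt_pow_succ_log_self (by norm_num) n
  have hap : a ≤ p := by
    have : 2 ^ a < 2 ^ (p + 1) := h1.trans_lt hn
    have := (Nat.pow_lt_pow_iff_right (a := 2) (by norm_num)).mp this
    omega
  have hP : (2 : ℝ) ^ p ≠ 0 := by positivity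
  by_cases he : emin q ≤ k + a
  · -- normalized: shift the mantissa until its leading bit is in place
    have h3 : 2 ^ p ≤ n * 2 ^ (p - a) := by
      calc 2 ^ p = 2 ^ a * 2 ^ (p - a) := by rw [← pow_add]; congr 1; omega
        _ ≤ _ := Nat.mul_le_mul_right _ h1
    have h4 : n * 2 ^ (p - a) < 2 ^ p * 2 := by
      calc n * 2 ^ (p - a) < 2 ^ (a + 1) * 2 ^ (p - a) :=
            Nat.mul_lt_mul_of_pos_right h2 (by positivity)
        _ = 2 ^ p * 2 := by rw [← pow_add, ← pow_succ]; congr 1; omega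
    refine ⟨n * 2 ^ (p - a) - 2 ^ p, by omega, 1, Or.inl rfl,
      Or.inl ⟨k + a, he, by omega, ?_⟩⟩
    rw [Nat.cast_sub h3, zpow_add₀ two_ne_zero, zpow_natCast]
    push_cast
    have : (2 : ℝ) ^ p = 2 ^ (p - a) * 2 ^ a := by rw [← pow_add]; congr 1; omega
    field_simp
    rw [this]
    ring
  · obtain ⟨j, hj⟩ : ∃ j : ℕ, k = emin q - p + j := ⟨(k - (emin q - p)).toNat, by omega⟩
    refine ⟨n * 2 ^ j, ?_, 1, Or.inl rfl, Or.inr ?_⟩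
    · calc n * 2 ^ j < 2 ^ (a + 1) * 2 ^ j := Nat.mul_lt_mul_of_pos_right h2 (by positivity)
        _ = 2 ^ (a + 1 + j) := by rw [← pow_add]
        _ ≤ 2 ^ p := Nat.pow_le_pow_right (by norm_num) (by omega)
    · rw [hj, zpow_add₀ two_ne_zero, zpow_sub₀ two_ne_zero, zpow_natCast, zpow_natCast]
      push_cast
      field_simp

theorem neg_mem_finFloat {x : ℝ} (h : x ∈ FinFloat p q) : -x ∈ FinFloat p q := by
  obtain ⟨m, h⟩ := h
  exact ⟨m, h.neg⟩

theorem intCast_mul_zpow_mem (n k : ℤ) (hn : |n| < 2 ^ (p + 1)) (hk : emin q - p ≤ k)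
    (hk' : k + p ≤ emax q) : (n : ℝ) * 2 ^ k ∈ FinFloat p q := by
  have h1 : n.natAbs < 2 ^ (p + 1) := by zify; simpa using hn
  have h2 := natCast_mul_zpow_mem n.natAbs k h1 hk hk'
  rcases abs_choice n with h | h
  · have : (n : ℝ) = (n.natAbs : ℝ) := by
      rw [Nat.cast_natAbs, h]
    rwa [this]
  · have : (n : ℝ) = -(n.natAbs : ℝ) := by
      rw [Nat.cast_natAbs, h]; simp
    rw [this, neg_mul]
    exact neg_mem_finFloat h2

/-- Every finite float is an integer `n` with at most `p + 1` binary digits times a power of two;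
the representation is unique up to the sign of zero, and the parity of `n` is the last bit. -/
theorem HasMantissa.exists_int {m : ℕ} {x : ℝ} (hp : 1 ≤ p) (h : HasMantissa p q m x)
    (hq : emin q ≤ emax q) :
    ∃ n k : ℤ, |n| < 2 ^ (p + 1) ∧ emin q - p ≤ k ∧ k + p ≤ emax q ∧ x = n * 2 ^ k ∧
      (2 ^ p ≤ |n| ∨ k = emin q - p) ∧ (Even m → Even n) := by
  obtain ⟨hm, s, hs, h⟩ := h
  have hmz : (m : ℤ) < 2 ^ p := by exact_mod_cast hm
  have hm0 : (0 : ℤ) ≤ m := by positivity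
  have hP : (2 : ℝ) ^ p ≠ 0 := by positivity
  obtain ⟨t, ht, hst⟩ : ∃ t : ℤ, (t = 1 ∨ t = -1) ∧ s = t := by
    rcases hs with rfl | rfl
    · exact ⟨1, Or.inl rfl, by simp⟩
    · exact ⟨-1, Or.inr rfl, by simp⟩
  have habs : ∀ z : ℤ, |t * z| = |z| := by
    intro z
    rcases ht with rfl | rfl <;> simp
  have hev : Even ((2 : ℤ) ^ p) := (Int.even_pow.mpr ⟨even_two, by omega⟩)
  rcases h with ⟨e, h1, h2, rfl⟩ | rfl
  · refine ⟨t * (2 ^ p + m), e - p, ?_, by omega, by omega, ?_, Or.inl ?_, fun hme => ?_⟩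
    · rw [habs, abs_of_nonneg (by positivity), pow_succ]
      omega
    · rw [hst, zpow_sub₀ two_ne_zero, zpow_natCast]
      push_cast
      field_simp
    · rw [habs, abs_of_nonneg (by positivity)]
      omega
    · exact (hev.add (by exact_mod_cast hme)).mul_left _
  · refine ⟨t * m, emin q - p, ?_, le_rfl, by omega, ?_, Or.inr rfl, fun hme => ?_⟩
    · rw [habs, abs_of_nonneg (by positivity), pow_succ]
      omega
    · rw [hst, zpow_sub₀ two_ne_zero, zpow_natCast]
      push_cast
      field_simp
    · exact Even.mul_left (by exact_mod_cast hme) _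

namespace Admissible

variable (H : Admissible p q)
include H

theorem exists_int {x : ℝ} (h : x ∈ FinFloat p q) :
    ∃ n k : ℤ, |n| < 2 ^ (p + 1) ∧ emin q - p ≤ k ∧ k + p ≤ emax q ∧ x = n * 2 ^ k ∧
      (2 ^ p ≤ |n| ∨ k = emin q - p) := by
  obtain ⟨m, h⟩ := h
  have h2 := emin_eq q
  have h3 := H.seven_le_emax
  obtain ⟨n, k, h⟩ := h.exists_int (by have := H.two_le; omega) (by omega)
  exact ⟨n, k, h.1, h.2.1, h.2.2.1, h.2.2.2.1, h.2.2.2.2.1⟩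

end Admissible

/-- The least positive float. -/
noncomputable def tiny (p q : ℕ) : ℝ := 2 ^ (emin q - p)

theorem tiny_pos (p q : ℕ) : 0 < tiny p q := zpow_pos two_pos _

theorem two_zpow_sub_one (k : ℤ) : (2 : ℝ) ^ (k - 1) = 2 ^ k / 2 := by
  rw [zpow_sub₀ two_ne_zero, zpow_one]

theorem two_zpow_add_one (k : ℤ) : (2 : ℝ) ^ (k + 1) = 2 ^ k * 2 := by
  rw [zpow_add₀ two_ne_zero, zpow_one]

theorem two_zpow_mono {j k : ℤ} (h : j ≤ k) : (2 : ℝ) ^ j ≤ 2 ^ k :=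
  zpow_le_zpow_right₀ one_le_two h

theorem two_zpow_strictMono {j k : ℤ} (h : j < k) : (2 : ℝ) ^ j < 2 ^ k :=
  zpow_lt_zpow_right₀ one_lt_two h

theorem two_zpow_pos (k : ℤ) : (0 : ℝ) < 2 ^ k := zpow_pos two_pos _

theorem two_zpow_mul (j k : ℤ) : (2 : ℝ) ^ j * 2 ^ k = 2 ^ (j + k) :=
  (zpow_add₀ two_ne_zero _ _).symm

/-- An integer with at most `j + 1 ≤ p + 1` binary digits times a power of two is a float, as long
as the exponent of the leading digit is at most `emax`. -/
theorem intCast_mul_zpow_mem_of_le (n k : ℤ) (j : ℕ) (hj : j ≤ p) (hn : |n| < 2 ^ (j + 1))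
    (hk : emin q - p ≤ k) (hk' : k + j ≤ emax q) (hq : emin q ≤ emax q) :
    (n : ℝ) * 2 ^ k ∈ FinFloat p q := by
  by_cases h : k + p ≤ emax q
  · refine intCast_mul_zpow_mem n k (hn.trans_le ?_) hk h
    exact pow_le_pow_right₀ (by norm_num) (by omega)
  · obtain ⟨i, hi⟩ : ∃ i : ℕ, k = emax q - p + i := ⟨(k - (emax q - p)).toNat, by omega⟩
    have h1 : (n : ℝ) * 2 ^ k = ((n * 2 ^ i : ℤ) : ℝ) * 2 ^ (emax q - p) := by
      rw [hi, zpow_add₀ two_ne_zero, zpow_natCast]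
      push_cast
      ring
    rw [h1]
    refine intCast_mul_zpow_mem _ _ ?_ (by omega) (by omega)
    rw [abs_mul, abs_of_pos (by positivity : (0 : ℤ) < 2 ^ i)]
    calc |n| * 2 ^ i < 2 ^ (j + 1) * 2 ^ i := mul_lt_mul_of_pos_right hn (by positivity)
      _ = 2 ^ (j + 1 + i) := by rw [← pow_add]
      _ ≤ 2 ^ (p + 1) := pow_le_pow_right₀ (by norm_num) (by omega)

/-! ### Uniqueness of rounding -/

theorem finFloat_lt_zpow_mul {n k : ℤ} (hn : |n| < 2 ^ (p + 1)) :
    |(n : ℝ) * 2 ^ k| < 2 ^ (k + p + 1) := by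
  have h1 : |(n : ℝ)| < 2 ^ (p + 1) := by exact_mod_cast hn
  rw [abs_mul, abs_of_pos (two_zpow_pos k)]
  calc |(n : ℝ)| * 2 ^ k < 2 ^ (p + 1) * 2 ^ k := mul_lt_mul_of_pos_right h1 (two_zpow_pos k)
    _ = 2 ^ (k + p + 1) := by
      rw [← zpow_natCast, two_zpow_mul]
      congr 1
      push_cast
      ring

/-- Between two floats `0 ≤ y < y'` whose last mantissa bits vanish there is another float. -/
theorem exists_between_even_pos (hp : 1 ≤ p) (hq : emin q ≤ emax q) {y y' : ℝ}
    (hy : LastBitZero p q y) (hy' : LastBitZero p q y') (h0 : 0 ≤ y) (h : y < y') :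
    ∃ z ∈ FinFloat p q, y < z ∧ z < y' := by
  obtain ⟨m, hm, hy⟩ := hy
  obtain ⟨m', hm', hy'⟩ := hy'
  obtain ⟨n, k, hn, hk, hk', rfl, hnk, he⟩ := hy.exists_int hp hq
  obtain ⟨n', l, hn', hl, hl', rfl, hnl, he'⟩ := hy'.exists_int hp hq
  replace he := he hm
  replace he' := he' hm'
  have hn0 : 0 ≤ n := by
    have := nonneg_of_mul_nonneg_left h0 (two_zpow_pos k)
    exact_mod_cast this
  have hn'0 : 0 < n' := by
    have := pos_of_mul_pos_left (h0.trans_lt h) (two_zpow_pos l).le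
    exact_mod_cast this
  rw [abs_of_nonneg hn0] at hn hnk
  rw [abs_of_pos hn'0] at hn' hnl
  have hE : Even ((2 : ℤ) ^ (p + 1)) := Int.even_pow.mpr ⟨even_two, by omega⟩
  have hn1 : n + 1 < 2 ^ (p + 1) := by
    obtain ⟨a, ha⟩ := he
    obtain ⟨b, hb⟩ := hE
    omega
  refine ⟨((n + 1 : ℤ) : ℝ) * 2 ^ k, intCast_mul_zpow_mem _ _ (by rwa [abs_of_pos (by omega)])
    hk hk', ?_, ?_⟩
  · push_cast
    linarith [two_zpow_pos k]
  · -- `y'` has exponent at least that of `y`, so it is an even multiple of the same spacing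
    have hkl : k ≤ l := by
      by_contra hlk
      push Not at hlk
      have h1 : (2 : ℤ) ^ p ≤ n := by omega
      have h2 := (le_abs_self _).trans_lt (finFloat_lt_zpow_mul (k := l)
        (by rwa [abs_of_pos hn'0]))
      have h3 : (2 : ℝ) ^ (l + p + 1) ≤ 2 ^ (k + p) := two_zpow_mono (by omega)
      have h4 : (2 : ℝ) ^ (k + p) ≤ n * 2 ^ k := by
        rw [zpow_add₀ two_ne_zero, mul_comm, zpow_natCast]
        exact mul_le_mul_of_nonneg_right (by exact_mod_cast h1) (two_zpow_pos k).le
      linarith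
    obtain ⟨i, hi⟩ : ∃ i : ℕ, l = k + i := ⟨(l - k).toNat, by omega⟩
    have h1 : (n' : ℝ) * 2 ^ l = ((n' * 2 ^ i : ℤ) : ℝ) * 2 ^ k := by
      rw [hi, zpow_add₀ two_ne_zero, zpow_natCast]
      push_cast
      ring
    rw [h1] at h ⊢
    have h2 : n < n' * 2 ^ i := by
      have := lt_of_mul_lt_mul_right h (two_zpow_pos k).le
      exact_mod_cast this
    have h3 : Even (n' * 2 ^ i) := he'.mul_right _
    have h4 : n + 1 < n' * 2 ^ i := by
      obtain ⟨a, ha⟩ := he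
      obtain ⟨b, hb⟩ := h3
      omega
    exact mul_lt_mul_of_pos_right (by exact_mod_cast h4) (two_zpow_pos k)

theorem LastBitZero.neg {y : ℝ} (h : LastBitZero p q y) : LastBitZero p q (-y) := by
  obtain ⟨m, hm, h⟩ := h
  exact ⟨m, hm, h.neg⟩

theorem exists_between_even (hp : 1 ≤ p) (hq : emin q ≤ emax q) {y y' : ℝ}
    (hy : LastBitZero p q y) (hy' : LastBitZero p q y') (h : y < y') :
    ∃ z ∈ FinFloat p q, y < z ∧ z < y' := by
  rcases le_or_gt 0 y with h0 | h0
  · exact exists_between_even_pos hp hq hy hy' h0 h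
  rcases le_or_gt y' 0 with h1 | h1
  · obtain ⟨z, hz, hz1, hz2⟩ := exists_between_even_pos hp hq hy'.neg hy.neg (by linarith)
      (by linarith)
    exact ⟨-z, neg_mem_finFloat hz, by linarith, by linarith⟩
  · exact ⟨0, zero_mem_finFloat p q, h0, h1⟩

theorem IsNearest.eq_of_lt (hp : 1 ≤ p) (hq : emin q ≤ emax q) {x y y' : ℝ}
    (h : IsNearest p q x y) (h' : IsNearest p q x y') (hlt : y < y') : False := by
  have heq : |x - y| = |x - y'| := le_antisymm (h.2.1 _ h'.1) (h'.2.1 _ h.1)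
  have e1 := h.2.2 _ h'.1 hlt.ne' heq.symm
  have e2 := h'.2.2 _ h.1 hlt.ne heq
  obtain ⟨z, hz, h1, h2⟩ := exists_between_even hp hq e1 e2 hlt
  have := h.2.1 z hz
  have hmid : x - y = (y' - y) / 2 := by
    rcases abs_eq_abs.mp heq with h | h <;> linarith
  rw [abs_of_pos (by linarith : 0 < x - y), le_abs] at this
  rcases this with h | h <;> linarith

theorem IsNearest.unique (hp : 1 ≤ p) (hq : emin q ≤ emax q) {x y y' : ℝ}
    (h : IsNearest p q x y) (h' : IsNearest p q x y') : y = y' := by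
  rcases lt_trichotomy y y' with hl | hl | hl
  · exact (h.eq_of_lt hp hq h' hl).elim
  · exact hl
  · exact (h'.eq_of_lt hp hq h hl).elim

theorem IsNearest.neg {x y : ℝ} (h : IsNearest p q x y) : IsNearest p q (-x) (-y) := by
  have key : ∀ a b : ℝ, |-a - -b| = |a - b| := fun a b => by
    rw [← abs_neg]
    congr 1
    ring
  have key' : ∀ a b : ℝ, |-a - b| = |a - -b| := fun a b => by
    rw [← key a (-b), neg_neg]
  refine ⟨neg_mem_finFloat h.1, fun z hz => ?_, fun z hz hne heq => ?_⟩
  · rw [key, key']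
    exact h.2.1 _ (neg_mem_finFloat hz)
  · rw [key, key'] at heq
    exact (h.2.2 _ (neg_mem_finFloat hz) (fun h => hne (by linarith)) heq).neg

theorem isNearest_nearest (p q : ℕ) (x : ℝ) : IsNearest p q x (nearest p q x) :=
  (exists_isNearest p q x).choose_spec

/-! ### Rounding -/

theorem le_nearest {r a : ℝ} (ha : a ∈ FinFloat p q) (h : a ≤ r) : a ≤ nearest p q r := by
  have h1 := (isNearest_nearest p q r).2.1 a ha
  by_contra hlt
  push Not at hlt
  rw [abs_of_pos (by linarith), abs_of_nonneg (by linarith)] at h1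
  linarith

theorem nearest_le {r b : ℝ} (hb : b ∈ FinFloat p q) (h : r ≤ b) : nearest p q r ≤ b := by
  have h1 := (isNearest_nearest p q r).2.1 b hb
  by_contra hlt
  push Not at hlt
  rw [abs_of_neg (by linarith), abs_of_nonpos (by linarith)] at h1
  linarith

theorem nearest_eq_of_forall {r y : ℝ} (hy : y ∈ FinFloat p q)
    (h : ∀ z ∈ FinFloat p q, z ≠ y → |r - y| < |r - z|) : nearest p q r = ⟨y, hy⟩ := by
  by_contra hne
  have h1 := (isNearest_nearest p q r).2.1 y hy
  have h2 := h _ (nearest p q r).2 (fun e => hne (Subtype.ext e))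
  linarith

theorem nearest_coe (x : FinFloat p q) : nearest p q x = x :=
  nearest_eq_of_forall x.2 fun z _ hz => by
    rw [sub_self, abs_zero, abs_pos]
    exact sub_ne_zero.mpr hz.symm

theorem maxFloat_eq (p q : ℕ) : maxFloat p q = (2 ^ (p + 1) - 1) * 2 ^ (emax q - p) := by
  unfold maxFloat
  rw [zpow_neg, zpow_sub₀ two_ne_zero, zpow_natCast, pow_succ]
  field_simp

theorem maxFloat_lt (p q : ℕ) : maxFloat p q < 2 ^ (emax q + 1) := by
  rw [two_zpow_add_one, mul_comm]
  unfold maxFloat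
  exact mul_lt_mul_of_pos_right (by linarith [two_zpow_pos (-(p : ℤ))]) (two_zpow_pos _)

namespace Admissible

variable (H : Admissible p q)
include H

theorem emin_le_emax : emin q ≤ emax q := by
  have h2 := emin_eq q
  have h3 := H.seven_le_emax
  omega

theorem one_le : 1 ≤ p := by
  have := H.two_le
  omega

theorem zpow_mem {k : ℤ} (h1 : emin q - p ≤ k) (h2 : k ≤ emax q) :
    (2 : ℝ) ^ k ∈ FinFloat p q := by
  have := intCast_mul_zpow_mem_of_le (p := p) (q := q) 1 k 0 (by omega) (by norm_num) h1
    (by simpa using h2) H.emin_le_emax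
  simpa using this

/-- Three-digit integers times a power of two. -/
theorem mul_zpow_mem (n k : ℤ) (hn : |n| < 8) (h1 : emin q - p ≤ k) (h2 : k + 2 ≤ emax q) :
    (n : ℝ) * 2 ^ k ∈ FinFloat p q :=
  intCast_mul_zpow_mem_of_le n k 2 H.two_le (by simpa using hn) h1 (by simpa using h2)
    H.emin_le_emax

theorem tiny_mem : tiny p q ∈ FinFloat p q :=
  H.zpow_mem le_rfl (by have := H.emin_le_emax; omega)

theorem exists_eq_mul_tiny {x : ℝ} (h : x ∈ FinFloat p q) : ∃ n : ℤ, x = n * tiny p q := by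
  obtain ⟨n, k, -, hk, -, rfl, -⟩ := H.exists_int h
  obtain ⟨i, hi⟩ : ∃ i : ℕ, k = emin q - p + i := ⟨(k - (emin q - p)).toNat, by omega⟩
  refine ⟨n * 2 ^ i, ?_⟩
  rw [hi, zpow_add₀ two_ne_zero, zpow_natCast, tiny]
  push_cast
  ring

theorem add_tiny_le {x y : ℝ} (hx : x ∈ FinFloat p q) (hy : y ∈ FinFloat p q) (h : x < y) :
    x + tiny p q ≤ y := by
  obtain ⟨m, rfl⟩ := H.exists_eq_mul_tiny hx
  obtain ⟨n, rfl⟩ := H.exists_eq_mul_tiny hy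
  have h1 : m < n := by
    have := lt_of_mul_lt_mul_right h (tiny_pos p q).le
    exact_mod_cast this
  have h2 : (m : ℝ) + 1 ≤ n := by exact_mod_cast h1
  nlinarith [tiny_pos p q]

theorem abs_le_maxFloat {x : ℝ} (h : x ∈ FinFloat p q) : |x| ≤ maxFloat p q := by
  obtain ⟨n, k, hn, -, hk, rfl, -⟩ := H.exists_int h
  rw [maxFloat_eq, abs_mul, abs_of_pos (two_zpow_pos k)]
  have h1 : |(n : ℝ)| ≤ 2 ^ (p + 1) - 1 := by
    have : |n| ≤ 2 ^ (p + 1) - 1 := by omega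
    exact_mod_cast this
  have h2 : (1 : ℝ) ≤ 2 ^ (p + 1) := one_le_pow₀ (by norm_num)
  exact mul_le_mul h1 (two_zpow_mono (by omega)) (two_zpow_pos k).le (by linarith)

theorem maxFloat_mem : maxFloat p q ∈ FinFloat p q := by
  rw [maxFloat_eq]
  have h0 : (1 : ℤ) ≤ 2 ^ (p + 1) := one_le_pow₀ (by norm_num)
  have := intCast_mul_zpow_mem (p := p) (q := q) (2 ^ (p + 1) - 1) (emax q - p)
    (by rw [abs_of_nonneg (by omega)]; omega) (by have := H.emin_le_emax; omega) (by omega)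
  simpa using this

theorem roundReal_eq_nearest {r a b : ℝ} (ha : a ∈ FinFloat p q) (hb : b ∈ FinFloat p q)
    (har : a ≤ r) (hrb : r ≤ b) : roundReal p q r = .finite (nearest p q r) := by
  have h1 := abs_le.mp (H.abs_le_maxFloat ha)
  have h2 := abs_le.mp (H.abs_le_maxFloat hb)
  have h3 := two_zpow_pos (emax q - p - 1)
  rw [roundReal, if_neg (by linarith), if_neg (by linarith)]

theorem exists_roundReal_eq {r a b : ℝ} (ha : a ∈ FinFloat p q) (hb : b ∈ FinFloat p q)
    (har : a ≤ r) (hrb : r ≤ b) :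
    ∃ y : FinFloat p q, roundReal p q r = .finite y ∧ a ≤ y ∧ y ≤ b :=
  ⟨nearest p q r, H.roundReal_eq_nearest ha hb har hrb, le_nearest ha har, nearest_le hb hrb⟩

theorem roundReal_coe (x : FinFloat p q) : roundReal p q x = .finite x := by
  rw [H.roundReal_eq_nearest x.2 x.2 le_rfl le_rfl, nearest_coe]

theorem roundReal_of_mem {x : ℝ} (h : x ∈ FinFloat p q) : roundReal p q x = .finite ⟨x, h⟩ :=
  H.roundReal_coe ⟨x, h⟩

theorem roundReal_eq_negInf {r : ℝ} (h : r ≤ -2 ^ (emax q + 1)) :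
    roundReal p q r = .negInf := by
  have h1 := maxFloat_lt p q
  have h2 : (0 : ℝ) ≤ maxFloat p q := (abs_nonneg _).trans
    (H.abs_le_maxFloat (zero_mem_finFloat p q))
  have h3 := two_zpow_pos (emax q - p - 1)
  have h4 := two_zpow_pos (emax q + 1)
  have h5 : maxFloat p q + 2 ^ (emax q - p - 1) ≤ 2 ^ (emax q + 1) := by
    rw [two_zpow_add_one, maxFloat, zpow_sub₀ two_ne_zero, zpow_sub₀ two_ne_zero, zpow_neg]
    have h6 := mul_pos (two_zpow_pos (emax q)) (inv_pos.mpr (two_zpow_pos (p : ℤ)))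
    simp only [zpow_one, div_eq_mul_inv]
    linarith
  rw [roundReal, if_neg (by linarith), if_pos (by linarith)]

theorem roundReal_neg {r : ℝ} {y : FinFloat p q} (h : roundReal p q r = .finite y) :
    roundReal p q (-r) = .finite ⟨-y, neg_mem_finFloat y.2⟩ := by
  have h3 := two_zpow_pos (emax q - p - 1)
  unfold roundReal at h ⊢
  split_ifs at h with h1 h2
  have h4 : nearest p q r = y := by simpa using h
  rw [if_neg (by linarith), if_neg (by linarith)]
  congr 1
  apply Subtype.ext
  refine (isNearest_nearest p q (-r)).unique H.one_le H.emin_le_emax ?_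
  have := (isNearest_nearest p q r).neg
  rwa [h4] at this

/-- All floats are multiples of the least positive one, so reals that are closer than half of it
to a float are rounded to that float. -/
theorem roundReal_eq_of_abs_lt {r y : ℝ} (hy : y ∈ FinFloat p q) (h : |r - y| < tiny p q / 2) :
    roundReal p q r = .finite ⟨y, hy⟩ := by
  have h1 := abs_le.mp (H.abs_le_maxFloat hy)
  have h2 : tiny p q ≤ 2 ^ (emax q - p - 1) * 2 := by
    rw [← two_zpow_add_one]
    exact two_zpow_mono (by have := H.emin_le_emax; omega)
  have h3 := abs_lt.mp h
  rw [roundReal, if_neg (by linarith), if_neg (by linarith), nearest_eq_of_forall hy]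
  intro z hz hzy
  rcases lt_or_gt_of_ne hzy with hlt | hlt
  · have := H.add_tiny_le hz hy hlt
    exact h.trans (lt_of_lt_of_le (by linarith) (le_abs_self _))
  · have := H.add_tiny_le hy hz hlt
    exact h.trans (lt_of_lt_of_le (by linarith) (neg_le_abs _))

/-- A real number above half of the least positive float is rounded to a positive float. -/
theorem tiny_le_nearest {r : ℝ} (h : tiny p q / 2 < r) : tiny p q ≤ nearest p q r := by
  have h1 := (isNearest_nearest p q r).2.1 _ H.tiny_mem
  by_contra hlt
  push Not at hlt
  have h2 : (nearest p q r : ℝ) ≤ 0 := by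
    by_contra hpos
    push Not at hpos
    have := H.add_tiny_le (zero_mem_finFloat p q) (nearest p q r).2 hpos
    linarith
  rw [abs_of_pos (a := r - (nearest p q r : ℝ)) (by linarith [tiny_pos p q]), le_abs'] at *
  rcases abs_cases (r - tiny p q) with ⟨h3, _⟩ | ⟨h3, _⟩ <;> rcases h1 with h1 | h1 <;> linarith

/-- Below `2 ^ e` the spacing of floats is at least `2 ^ (e - p - 1)`, above it is at least twice as
large, so reals in the following interval are rounded to the power. -/
theorem roundReal_eq_zpow {r : ℝ} {e : ℤ} (he : e ≤ emax q)
    (hmem : (2 : ℝ) ^ e ∈ FinFloat p q)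
    (h1 : 2 ^ e - 2 ^ (e - p - 2) < r) (h2 : r < 2 ^ e + 2 ^ (e - p - 1)) :
    roundReal p q r = .finite ⟨2 ^ e, hmem⟩ := by
  have a1 := abs_le.mp (H.abs_le_maxFloat hmem)
  have a2 : (2 : ℝ) ^ (e - p - 1) ≤ 2 ^ (emax q - p - 1) := two_zpow_mono (by omega)
  have e1 : (2 : ℝ) ^ (e - p - 1) = 2 ^ (e - p - 2) * 2 := by
    rw [← two_zpow_add_one]; congr 1; ring
  have e2 : (2 : ℝ) ^ (e - p) = 2 ^ (e - p - 2) * 4 := by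
    rw [show e - p = e - p - 2 + 1 + 1 by ring, two_zpow_add_one, two_zpow_add_one]; ring_nf
  have e3 := two_zpow_pos (e - p - 2)
  have mult : ∀ n k j : ℤ, j ≤ k → ∃ m : ℤ, (n : ℝ) * 2 ^ k = m * 2 ^ j := by
    intro n k j hjk
    obtain ⟨i, hi⟩ : ∃ i : ℕ, k = j + i := ⟨(k - j).toNat, by omega⟩
    refine ⟨n * 2 ^ i, ?_⟩
    rw [hi, zpow_add₀ two_ne_zero, zpow_natCast]
    push_cast
    ring
  have gap : ∀ m m' j : ℤ, (m : ℝ) * 2 ^ j < m' * 2 ^ j → (m : ℝ) * 2 ^ j + 2 ^ j ≤ m' * 2 ^ j := by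
    intro m m' j hlt
    have := lt_of_mul_lt_mul_right hlt (two_zpow_pos j).le
    have h : (m : ℝ) + 1 ≤ m' := by exact_mod_cast this
    nlinarith [two_zpow_pos j]
  rw [roundReal, if_neg (by linarith), if_neg (by linarith [two_zpow_pos e]),
    nearest_eq_of_forall hmem]
  intro z hz hne
  obtain ⟨n, k, hn, hk, hk', rfl, -⟩ := H.exists_int hz
  have hb := (le_abs_self _).trans_lt (finFloat_lt_zpow_mul (k := k) hn)
  rcases lt_or_gt_of_ne hne with hlt | hlt
  · have hz2 : (n : ℝ) * 2 ^ k ≤ 2 ^ e - 2 ^ (e - p - 1) := by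
      by_cases hke : e - p - 1 ≤ k
      · obtain ⟨m, hm⟩ := mult n k _ hke
        obtain ⟨m', hm'⟩ := mult 1 e (e - p - 1) (by omega)
        rw [Int.cast_one, one_mul] at hm'
        rw [hm, hm'] at hlt ⊢
        have := gap _ _ _ hlt
        linarith
      · have h3 : (2 : ℝ) ^ (k + p + 1) ≤ 2 ^ (e - 1) := two_zpow_mono (by omega)
        have h4 : (2 : ℝ) ^ (e - p - 1) ≤ 2 ^ (e - 1) := two_zpow_mono (by omega)
        rw [two_zpow_sub_one e] at h3 h4
        linarith
    rw [abs_of_pos (a := r - (n : ℝ) * 2 ^ k) (by linarith), abs_lt]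
    constructor <;> linarith
  · have hz2 : 2 ^ e + 2 ^ (e - p) ≤ (n : ℝ) * 2 ^ k := by
      have hke : e - p ≤ k := by
        by_contra hke
        have : (2 : ℝ) ^ (k + p + 1) ≤ 2 ^ e := two_zpow_mono (by omega)
        linarith
      obtain ⟨m, hm⟩ := mult n k _ hke
      obtain ⟨m', hm'⟩ := mult 1 e (e - p) (by omega)
      rw [Int.cast_one, one_mul] at hm'
      rw [hm, hm'] at hlt ⊢
      exact gap _ _ _ hlt
    rw [abs_of_neg (a := r - (n : ℝ) * 2 ^ k) (by linarith), abs_lt]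
    constructor <;> linarith

end Admissible

/-! ### Floating-point operations -/

/-- The float zero. -/
def zeroFloat (p q : ℕ) : FinFloat p q := ⟨0, zero_mem_finFloat p q⟩

/-- The negative of a finite float. -/
noncomputable def negFloat (x : FinFloat p q) : FinFloat p q := ⟨-x, neg_mem_finFloat x.2⟩

/-- `e` is a finite float in the interval `[a, b]`. -/
def Between (a b : ℝ) (e : ExtFloat p q) : Prop :=
  ∃ x : FinFloat p q, e = .finite x ∧ a ≤ x ∧ x ≤ b

/-- `e` is `-∞` or a finite float that is at most `b`. -/
def AtMost (b : ℝ) (e : ExtFloat p q) : Prop :=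
  e = .negInf ∨ ∃ x : FinFloat p q, e = .finite x ∧ x ≤ b

theorem Between.atMost {a b : ℝ} {e : ExtFloat p q} (h : Between a b e) : AtMost b e := by
  obtain ⟨x, h, -, h2⟩ := h
  exact Or.inr ⟨x, h, h2⟩

theorem finite_add_finite (x y : FinFloat p q) :
    (ExtFloat.finite x).add (.finite y) = roundReal p q ((x : ℝ) + y) := rfl

theorem finite_mul_finite (x y : FinFloat p q) :
    (ExtFloat.finite x).mul (.finite y) = roundReal p q ((x : ℝ) * y) := rfl

theorem add_comm' (e f : ExtFloat p q) : e.add f = f.add e := by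
  cases e <;> cases f <;> simp [ExtFloat.add, add_comm]

theorem negInf_add_of_atMost {b : ℝ} {e : ExtFloat p q} (h : AtMost b e) :
    ExtFloat.negInf.add e = .negInf := by
  rcases h with rfl | ⟨x, rfl, -⟩ <;> rfl

namespace Admissible

variable (H : Admissible p q)
include H

theorem between_roundReal {r a b : ℝ} (ha : a ∈ FinFloat p q) (hb : b ∈ FinFloat p q)
    (har : a ≤ r) (hrb : r ≤ b) : Between a b (roundReal p q r) :=
  H.exists_roundReal_eq ha hb har hrb

theorem atMost_roundReal {r b : ℝ} (hb : b ∈ FinFloat p q) (hrb : r ≤ b) :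
    AtMost b (roundReal p q r) := by
  have h2 := abs_le.mp (H.abs_le_maxFloat hb)
  have h3 := two_zpow_pos (emax q - p - 1)
  rw [roundReal, if_neg (by linarith)]
  split_ifs
  · exact Or.inl rfl
  · exact Or.inr ⟨_, rfl, nearest_le hb hrb⟩

theorem between_add {a b c d l u : ℝ} {e f : ExtFloat p q} (he : Between a b e)
    (hf : Between c d f) (hl : l ∈ FinFloat p q) (hu : u ∈ FinFloat p q) (h1 : l ≤ a + c)
    (h2 : b + d ≤ u) : Between l u (e.add f) := by
  obtain ⟨x, rfl, hx1, hx2⟩ := he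
  obtain ⟨y, rfl, hy1, hy2⟩ := hf
  exact H.between_roundReal hl hu (by linarith) (by linarith)

theorem atMost_add {b d u : ℝ} {e f : ExtFloat p q} (he : AtMost b e) (hf : AtMost d f)
    (hu : u ∈ FinFloat p q) (h : b + d ≤ u) : AtMost u (e.add f) := by
  rcases he with rfl | ⟨x, rfl, hx⟩
  · exact Or.inl (negInf_add_of_atMost hf)
  rcases hf with rfl | ⟨y, rfl, hy⟩
  · exact Or.inl rfl
  · exact H.atMost_roundReal hu (by linarith)

theorem add_zero (e : ExtFloat p q) : e.add (.finite (zeroFloat p q)) = e := by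
  cases e with
  | finite x =>
    rw [finite_add_finite]
    simp [zeroFloat, H.roundReal_coe]
  | posInf => rfl
  | negInf => rfl
  | nan => rfl

theorem zero_add (e : ExtFloat p q) : (ExtFloat.finite (zeroFloat p q)).add e = e := by
  rw [add_comm', H.add_zero]

theorem zero_mul (x : FinFloat p q) :
    (ExtFloat.finite (zeroFloat p q)).mul (.finite x) = .finite (zeroFloat p q) := by
  rw [finite_mul_finite]
  have := H.roundReal_coe (zeroFloat p q)
  simpa [zeroFloat] using this

theorem mul_zero (x : FinFloat p q) :
    (ExtFloat.finite x).mul (.finite (zeroFloat p q)) = .finite (zeroFloat p q) := by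
  rw [finite_mul_finite]
  have := H.roundReal_coe (zeroFloat p q)
  simpa [zeroFloat] using this

theorem mul_of_mem {x y : FinFloat p q} (h : (x : ℝ) * y ∈ FinFloat p q) :
    (ExtFloat.finite x).mul (.finite y) = .finite ⟨x * y, h⟩ :=
  H.roundReal_of_mem h

theorem add_of_mem {x y : FinFloat p q} (h : (x : ℝ) + y ∈ FinFloat p q) :
    (ExtFloat.finite x).add (.finite y) = .finite ⟨x + y, h⟩ :=
  H.roundReal_of_mem h

end Admissible

/-! ### Summation orders -/

/-- After the entries `i` and `j` are added, the remaining ones are listed, without repetition, by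
a map `ι`. -/
theorem reducePair_spec {n : ℕ} (x : Fin (n + 2) → ExtFloat p q) (i j : Fin (n + 2)) (hij : i < j) :
    ∃ ι : Fin n → Fin (n + 2), Function.Injective ι ∧ (∀ k, ι k ≠ i) ∧ (∀ k, ι k ≠ j) ∧
      (∀ a, a ≠ i → a ≠ j → ∃ k, ι k = a) ∧ reducePair x i j hij 0 = (x i).add (x j) ∧
      ∀ k : Fin n, reducePair x i j hij k.succ = x (ι k) := by
  set i' := i.castPred (Fin.ne_last_of_lt hij) with hi'
  have hji : j.succAbove i' = i := by
    rw [Fin.succAbove_of_castSucc_lt _ _ (by simpa [hi'] using hij)]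
    simp [hi']
  refine ⟨fun k => j.succAbove (i'.succAbove k), ?_, fun k hk => ?_, fun k => Fin.succAbove_ne _ _,
    fun a hai haj => ?_, by simp [reducePair], fun k => by simp [reducePair, hi']⟩
  · exact Fin.succAbove_right_injective.comp Fin.succAbove_right_injective
  · exact Fin.succAbove_ne i' k (Fin.succAbove_right_injective (hk.trans hji.symm))
  · obtain ⟨b, rfl⟩ := Fin.exists_succAbove_eq haj
    obtain ⟨c, rfl⟩ := Fin.exists_succAbove_eq (x := b) (y := i') fun e => hai (by rw [e, hji])
    exact ⟨c, rfl⟩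

namespace Admissible

variable (H : Admissible p q)
include H

theorem sum_single {n : ℕ} (o : SumOrder n) (x : Fin n → ExtFloat p q) (a : Fin n)
    (h : ∀ k, k ≠ a → x k = .finite (zeroFloat p q)) : o.sum x = x a := by
  induction o with
  | single => rw [Subsingleton.elim a 0]; rfl
  | @step n i j hij o ih =>
    obtain ⟨ι, hinj, hi, hj, hsurj, h0, hs⟩ := reducePair_spec x i j hij
    by_cases ha : a = i ∨ a = j
    · rw [SumOrder.sum, ih _ 0, h0]
      · rcases ha with rfl | rfl
        · rw [h j hij.ne', H.add_zero]
        · rw [h i hij.ne, H.zero_add]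
      · intro k hk
        obtain ⟨k, rfl⟩ := Fin.exists_succ_eq.mpr hk
        rw [hs]
        refine h _ ?_
        rcases ha with rfl | rfl
        exacts [hi k, hj k]
    · push Not at ha
      obtain ⟨c, rfl⟩ := hsurj a ha.1 ha.2
      rw [SumOrder.sum, ih _ c.succ, hs]
      intro k hk
      rcases Fin.eq_zero_or_eq_succ k with rfl | ⟨k, rfl⟩
      · rw [h0, h i ha.1.symm, h j ha.2.symm, H.zero_add]
      · rw [hs]
        exact h _ fun e => hk (by rw [hinj e])

/-- If all but two summands vanish, then the order of summation does not matter. -/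
theorem sum_pair {n : ℕ} (o : SumOrder n) (x : Fin n → ExtFloat p q) (a b : Fin n) (hab : a ≠ b)
    (h : ∀ k, k ≠ a → k ≠ b → x k = .finite (zeroFloat p q)) : o.sum x = (x a).add (x b) := by
  induction o with
  | single => exact absurd (Subsingleton.elim a b) hab
  | @step n i j hij o ih =>
    obtain ⟨ι, hinj, hi, hj, hsurj, h0, hs⟩ := reducePair_spec x i j hij
    -- exactly one of the two summands takes part in the first addition
    have one : ∀ a b : Fin (n + 2), a ≠ b →
        (∀ k, k ≠ a → k ≠ b → x k = .finite (zeroFloat p q)) →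
        a = i ∨ a = j → b ≠ i → b ≠ j → o.sum (reducePair x i j hij) = (x a).add (x b) := by
      intro a b hab h ha hbi hbj
      obtain ⟨c, rfl⟩ := hsurj b hbi hbj
      rw [ih _ 0 c.succ (Fin.succ_ne_zero c).symm, h0, hs]
      · rcases ha with rfl | rfl
        · rw [h j hij.ne' hbj.symm, H.add_zero]
        · rw [h i hij.ne hbi.symm, H.zero_add]
      · intro k hk hkc
        obtain ⟨k, rfl⟩ := Fin.exists_succ_eq.mpr hk
        rw [hs]
        refine h _ ?_ fun e => hkc (by rw [hinj e])
        rcases ha with rfl | rfl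
        exacts [hi k, hj k]
    have h' : ∀ k, k ≠ b → k ≠ a → x k = .finite (zeroFloat p q) := fun k h1 h2 => h k h2 h1
    rw [SumOrder.sum]
    by_cases ha : a = i ∨ a = j <;> by_cases hb : b = i ∨ b = j
    · rw [H.sum_single _ _ 0, h0]
      · rcases ha with rfl | rfl <;> rcases hb with rfl | rfl
        · exact absurd rfl hab
        · rfl
        · exact add_comm' _ _
        · exact absurd rfl hab
      · intro k hk
        obtain ⟨k, rfl⟩ := Fin.exists_succ_eq.mpr hk
        rw [hs]
        refine h _ ?_ ?_
        · rcases ha with rfl | rfl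
          exacts [hi k, hj k]
        · rcases hb with rfl | rfl
          exacts [hi k, hj k]
    · push Not at hb
      exact one a b hab h ha hb.1 hb.2
    · push Not at ha
      rw [one b a hab.symm h' hb ha.1 ha.2, add_comm']
    · push Not at ha hb
      obtain ⟨c, rfl⟩ := hsurj a ha.1 ha.2
      obtain ⟨d, rfl⟩ := hsurj b hb.1 hb.2
      rw [ih _ c.succ d.succ (fun e => hab (by rw [Fin.succ_injective _ e])), hs, hs]
      intro k hkc hkd
      rcases Fin.eq_zero_or_eq_succ k with rfl | ⟨k, rfl⟩
      · rw [h0, h i ha.1.symm hb.1.symm, h j ha.2.symm hb.2.symm, H.zero_add]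
      · rw [hs]
        exact h _ (fun e => hkc (by rw [hinj e])) (fun e => hkd (by rw [hinj e]))

end Admissible

/-! ### Neurons -/

/-- The affine function `(w ⊗ e) ⊕ b` of one float. -/
noncomputable def affineOne (w b : FinFloat p q) (e : ExtFloat p q) : ExtFloat p q :=
  ((ExtFloat.finite w).mul e).add (.finite b)

/-- The affine function `((w ⊗ e) ⊕ (w' ⊗ e')) ⊕ b` of two floats. -/
noncomputable def affineTwo (w w' b : FinFloat p q) (e e' : ExtFloat p q) : ExtFloat p q :=
  (((ExtFloat.finite w).mul e).add ((ExtFloat.finite w').mul e')).add (.finite b)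

/-- For inputs `X x`, where `x` ranges over `D`, the finite-valued functions on `D` that are
computed by a neuron of the hidden layer number `l`, after the activation function. Neurons use one
coordinate in the first hidden layer and two neurons of the previous layer later on, so that sums
do not depend on the reduction order. -/
def Reach {D : Type*} {d : ℕ} (σ : ExtFloat p q → ExtFloat p q) (X : D → Fin d → FinFloat p q) :
    ℕ → (D → FinFloat p q) → Prop
  | 0, h => ∃ i w b, ∀ x, .finite (h x) = σ (affineOne w b (.finite (X x i)))
  | l + 1, h => ∃ h₁ h₂, Reach σ X l h₁ ∧ Reach σ X l h₂ ∧ ∃ w₁ w₂ b, ∀ x,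
      .finite (h x) = σ (affineTwo w₁ w₂ b (.finite (h₁ x)) (.finite (h₂ x)))

theorem castAdd_ne_natAdd {n : ℕ} (k : Fin n) : Fin.castAdd n k ≠ Fin.natAdd n k := by
  intro h
  have h1 := congrArg Fin.val h
  have h2 := k.pos
  simp only [Fin.val_castAdd, Fin.val_natAdd] at h1
  omega

namespace Admissible

variable (H : Admissible p q)
include H

variable {D : Type*} {d : ℕ} {σ : ExtFloat p q → ExtFloat p q} {X : D → Fin d → FinFloat p q}

theorem reach_of_affineOne {l : ℕ} {h h' : D → FinFloat p q} (hh : Reach σ X l h)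
    (w b : FinFloat p q) (e : ∀ x, .finite (h' x) = σ (affineOne w b (.finite (h x)))) :
    Reach σ X (l + 1) h' := by
  refine ⟨h, h, hh, hh, w, zeroFloat p q, b, fun x => ?_⟩
  rw [e, affineOne, affineTwo, H.zero_mul, H.add_zero]

/-- A network whose inputs are computed by neurons of layer `l` is a network in the original
inputs. -/
theorem exists_network_of_reach (S : ReductionOrder) (hd : 0 < d) (l : ℕ) :
    ∀ {n m : ℕ}, 0 < n → ∀ (N : Network p q n m) (g : Fin n → D → FinFloat p q),
      (∀ k, Reach σ X l (g k)) →
      ∃ N' : Network p q d m, ∀ x,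
        N'.eval S σ (fun i => .finite (X x i)) = N.eval S σ (fun k => .finite (g k x)) := by
  induction l with
  | zero =>
    intro n m _ N g hg
    choose i w b h using hg
    refine ⟨.layer hd ⟨fun k j => if j = i k then w k else zeroFloat p q, b⟩ N, fun x => ?_⟩
    rw [Network.eval]
    congr 1
    funext k
    rw [h, AffineParams.eval, H.sum_single _ _ (i k)]
    · simp [affineOne]
    · intro j hj
      simp only [if_neg hj]
      exact H.zero_mul _
  | succ l ih =>
    intro n m hn N g hg
    choose h₁ h₂ r₁ r₂ w₁ w₂ b h using hg
    obtain ⟨N', hN'⟩ := ih (n := n + n) (by omega)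
      (.layer (by omega) ⟨fun k => Fin.append (fun j => if j = k then w₁ k else zeroFloat p q)
        (fun j => if j = k then w₂ k else zeroFloat p q), b⟩ N) (Fin.append h₁ h₂) (by
          intro k
          refine Fin.addCases (fun k => ?_) (fun k => ?_) k
          · rw [Fin.append_left]; exact r₁ k
          · rw [Fin.append_right]; exact r₂ k)
    refine ⟨N', fun x => ?_⟩
    rw [hN', Network.eval]
    congr 1
    funext k
    rw [h, AffineParams.eval, H.sum_pair _ _ (Fin.castAdd n k) (Fin.natAdd n k)]
    · simp only [affineTwo, Fin.append_left, Fin.append_right, if_true]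
    · exact castAdd_ne_natAdd k
    · intro j hj1 hj2
      induction j using Fin.addCases with
      | left j =>
        have : j ≠ k := fun e => hj1 (by rw [e])
        simp only [Fin.append_left, if_neg this]
        exact H.zero_mul _
      | right j =>
        have : j ≠ k := fun e => hj2 (by rw [e])
        simp only [Fin.append_right, if_neg this]
        exact H.zero_mul _

/-- If neurons `u z` vanish at all points but `z`, then they can be combined in the output layer:
at each point at most two summands, the ones that belong to this point, are nonzero. -/
theorem exists_network_of_delta [Fintype D] [Nonempty D] (S : ReductionOrder) (hd : 0 < d)
    (f : D → ExtFloat p q) (l : ℕ) (u : D → D → FinFloat p q) (hu : ∀ z, Reach σ X l (u z))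
    (h0 : ∀ z x, x ≠ z → u z x = zeroFloat p q) (w₁ w₂ : D → FinFloat p q)
    (hf : ∀ z, ((ExtFloat.finite (w₁ z)).mul (.finite (u z z))).add
      ((ExtFloat.finite (w₂ z)).mul (.finite (u z z))) = f z) :
    ∃ N : Network p q d 1, ∀ x, N.eval S σ (fun i => .finite (X x i)) 0 = f x := by
  classical
  set n := Fintype.card D
  have hn : 0 < n := Fintype.card_pos
  let e : D ≃ Fin n := Fintype.equivFin D
  obtain ⟨N, hN⟩ := H.exists_network_of_reach (σ := σ) (X := X) S hd l (n := n + n) (m := 1)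
    (by omega)
    (.last (by omega) ⟨fun _ => Fin.append (w₁ ∘ e.symm) (w₂ ∘ e.symm), fun _ => zeroFloat p q⟩)
    (Fin.append (u ∘ e.symm) (u ∘ e.symm)) (by
      intro k
      refine Fin.addCases (fun k => ?_) (fun k => ?_) k
      · rw [Fin.append_left]; exact hu _
      · rw [Fin.append_right]; exact hu _)
  refine ⟨N, fun x => ?_⟩
  rw [hN, Network.eval, AffineParams.eval, H.add_zero,
    H.sum_pair _ _ (Fin.castAdd n (e x)) (Fin.natAdd n (e x))]
  · simpa only [Fin.append_left, Fin.append_right, Function.comp, e.symm_apply_apply] using hf x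
  · exact castAdd_ne_natAdd (e x)
  · intro j hj1 hj2
    induction j using Fin.addCases with
    | left j =>
      have : x ≠ e.symm j := fun h => hj1 (by rw [h, e.apply_symm_apply])
      simp only [Fin.append_left, Function.comp, h0 _ _ this]
      exact H.mul_zero _
    | right j =>
      have : x ≠ e.symm j := fun h => hj2 (by rw [h, e.apply_symm_apply])
      simp only [Fin.append_right, Function.comp, h0 _ _ this]
      exact H.mul_zero _

/-! ### Scaling a delta function to a prescribed value -/

theorem mul_zpow_neg_mem_of_abs_le_one {y : ℝ} (hy : y ∈ FinFloat p q) (h : |y| ≤ 1) {e : ℤ}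
    (h1 : -emax q ≤ e) (h2 : e ≤ 0) : y * 2 ^ (-e) ∈ FinFloat p q := by
  obtain ⟨n, k, hn, hk, hk', rfl, hnorm⟩ := H.exists_int hy
  have hMp := H.add_two_le_emax
  have hem := emin_eq q
  have hkp : k + p ≤ 0 := by
    rcases hnorm with hnorm | rfl
    · have hnorm' : (2 : ℝ) ^ p ≤ |(n : ℝ)| := by exact_mod_cast hnorm
      rw [abs_mul, abs_of_pos (two_zpow_pos k)] at h
      have h3 : (2 : ℝ) ^ (k + p) ≤ 2 ^ (0 : ℤ) := by
        rw [zpow_add₀ two_ne_zero, zpow_natCast, mul_comm, zpow_zero]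
        exact (mul_le_mul_of_nonneg_right hnorm' (two_zpow_pos k).le).trans h
      exact (zpow_le_zpow_iff_right₀ one_lt_two).mp h3
    · omega
  rw [mul_assoc, two_zpow_mul]
  exact intCast_mul_zpow_mem _ _ hn (by omega) (by omega)

theorem mul_zpow_neg_mem_of_one_le_abs {y : ℝ} (hy : y ∈ FinFloat p q) (h : 1 ≤ |y|) {e : ℤ}
    (h1 : 0 ≤ e) (h2 : e ≤ emax q - 1) : y * 2 ^ (-e) ∈ FinFloat p q := by
  obtain ⟨n, k, hn, hk, hk', rfl, -⟩ := H.exists_int hy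
  have hem := emin_eq q
  have hkp : 0 < k + p + 1 := by
    have h3 : (2 : ℝ) ^ (0 : ℤ) < 2 ^ (k + p + 1) := by
      rw [zpow_zero]
      exact h.trans_lt (finFloat_lt_zpow_mul hn)
    exact (zpow_lt_zpow_iff_right₀ one_lt_two).mp h3
  rw [mul_assoc, two_zpow_mul]
  exact intCast_mul_zpow_mem _ _ hn (by omega) (by omega)

/-- Two summands suffice to get any float, or any infinity, from powers of two: one for finite
floats, and two overflowing ones for infinite ones. -/
theorem exists_weights {e₁ e₂ : ℤ} (h1 : -emax q ≤ e₁) (h1' : e₁ ≤ 0) (h2 : 0 ≤ e₂)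
    (h2' : e₂ ≤ emax q - 1) (m₁ : (2 : ℝ) ^ e₁ ∈ FinFloat p q) (m₂ : (2 : ℝ) ^ e₂ ∈ FinFloat p q)
    (y : ExtFloat p q) (hy : y ≠ .nan) :
    ∃ (s : Bool) (w w' : FinFloat p q),
      ((ExtFloat.finite w).mul (.finite (if s then ⟨2 ^ e₁, m₁⟩ else ⟨2 ^ e₂, m₂⟩))).add
        ((ExtFloat.finite w').mul (.finite (if s then ⟨2 ^ e₁, m₁⟩ else ⟨2 ^ e₂, m₂⟩))) = y := by
  have scale : ∀ (y : FinFloat p q) (e : ℤ) (m : (2 : ℝ) ^ e ∈ FinFloat p q)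
      (hm : (y : ℝ) * 2 ^ (-e) ∈ FinFloat p q),
      ((ExtFloat.finite ⟨y * 2 ^ (-e), hm⟩).mul (.finite ⟨2 ^ e, m⟩)).add
        ((ExtFloat.finite (zeroFloat p q)).mul (.finite ⟨2 ^ e, m⟩)) = .finite y := by
    intro y e m hm
    have h3 : (y : ℝ) * 2 ^ (-e) * 2 ^ e = y := by
      rw [mul_assoc, two_zpow_mul, neg_add_cancel, zpow_zero, mul_one]
    rw [H.zero_mul, H.add_zero, finite_mul_finite]
    simp only [h3]
    exact H.roundReal_coe y
  have hM := maxFloat_lt p q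
  have hM0 : (2 : ℝ) ^ emax q ≤ maxFloat p q := by
    have := H.abs_le_maxFloat (H.zpow_mem (k := emax q)
      (by have := H.emin_le_emax; omega) le_rfl)
    rwa [abs_of_pos (two_zpow_pos _)] at this
  have hone : (1 : ℝ) ≤ 2 ^ e₂ := one_le_zpow₀ one_le_two h2
  have hMe : maxFloat p q ≤ maxFloat p q * 2 ^ e₂ :=
    le_mul_of_one_le_right ((two_zpow_pos _).le.trans hM0) hone
  have hhalf : (2 : ℝ) ^ (emax q - p - 1) < 2 ^ emax q := two_zpow_strictMono (by omega)
  have hpos := two_zpow_pos (emax q - p - 1)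
  have hpos' := two_zpow_pos (emax q)
  cases y with
  | finite y =>
    rcases le_total |(y : ℝ)| 1 with h | h
    · exact ⟨true, _, _, scale y e₁ m₁ (H.mul_zpow_neg_mem_of_abs_le_one y.2 h h1 h1')⟩
    · exact ⟨false, _, _, scale y e₂ m₂ (H.mul_zpow_neg_mem_of_one_le_abs y.2 h h2 h2')⟩
  | posInf =>
    refine ⟨false, ⟨maxFloat p q, H.maxFloat_mem⟩, ⟨maxFloat p q, H.maxFloat_mem⟩, ?_⟩
    rw [finite_mul_finite]
    simp only [Bool.false_eq_true, if_false]
    by_cases hov : maxFloat p q + 2 ^ (emax q - p - 1) ≤ maxFloat p q * 2 ^ e₂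
    · rw [roundReal, if_pos hov]
      rfl
    · have h4 : roundReal p q (maxFloat p q * 2 ^ e₂) =
          .finite (nearest p q (maxFloat p q * 2 ^ e₂)) := by
        rw [roundReal, if_neg hov, if_neg (by linarith)]
      have h5 := le_nearest H.maxFloat_mem hMe
      rw [h4, finite_add_finite, roundReal, if_pos (by linarith)]
  | negInf =>
    refine ⟨false, ⟨-maxFloat p q, neg_mem_finFloat H.maxFloat_mem⟩,
      ⟨-maxFloat p q, neg_mem_finFloat H.maxFloat_mem⟩, ?_⟩
    rw [finite_mul_finite]
    simp only [Bool.false_eq_true, if_false, neg_mul]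
    by_cases hov : -(maxFloat p q * 2 ^ e₂) ≤ -maxFloat p q - 2 ^ (emax q - p - 1)
    · rw [roundReal, if_neg (by linarith), if_pos hov]
      rfl
    · have h4 : roundReal p q (-(maxFloat p q * 2 ^ e₂)) =
          .finite (nearest p q (-(maxFloat p q * 2 ^ e₂))) := by
        rw [roundReal, if_neg (by linarith), if_neg hov]
      have h5 := nearest_le (neg_mem_finFloat H.maxFloat_mem) (neg_le_neg hMe)
      rw [h4, finite_add_finite, roundReal, if_neg (by linarith), if_pos (by linarith)]
  | nan => exact absurd rfl hy

open Classical in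
/-- It suffices to reach the delta functions of all points, once with a small and once with a large
power of two as their value. -/
theorem exists_network_of_reach_delta [Fintype D] [Nonempty D] (S : ReductionOrder) (hd : 0 < d)
    (f : D → {y : ExtFloat p q // y ≠ .nan}) {e₁ e₂ : ℤ} (h1 : -emax q ≤ e₁) (h1' : e₁ ≤ 0)
    (h2 : 0 ≤ e₂) (h2' : e₂ ≤ emax q - 1)
    (m₁ : (2 : ℝ) ^ e₁ ∈ FinFloat p q) (m₂ : (2 : ℝ) ^ e₂ ∈ FinFloat p q) (l : ℕ)
    (r₁ : ∀ z, Reach σ X l (fun x => if x = z then ⟨2 ^ e₁, m₁⟩ else zeroFloat p q))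
    (r₂ : ∀ z, Reach σ X l (fun x => if x = z then ⟨2 ^ e₂, m₂⟩ else zeroFloat p q)) :
    ∃ N : Network p q d 1, ∀ x, N.eval S σ (fun i => .finite (X x i)) 0 = (f x).1 := by
  choose s w w' h using fun z => H.exists_weights h1 h1' h2 h2' m₁ m₂ (f z).1 (f z).2
  refine H.exists_network_of_delta S hd (fun x => (f x).1) l
    (fun z x => if x = z then (if s z then ⟨2 ^ e₁, m₁⟩ else ⟨2 ^ e₂, m₂⟩) else zeroFloat p q)
    (fun z => ?_) (fun z x hx => if_neg hx) w w' (fun z => ?_)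
  · cases s z
    · simpa using r₂ z
    · simpa using r₁ z
  · simpa using h z

end Admissible

/-! ### Boolean combinations -/

/-- Suppose that classes `C 0, C 1, …` of predicates on a finite set are such that nor-gates lead
from each class to the next, and that the class `C 0` separates points in both directions. Then
some class `C l` contains the complements of all singletons. -/
theorem exists_forall_ne_mem {D : Type*} [Finite D] [Nontrivial D] (C : ℕ → (D → Prop) → Prop)
    (hnor : ∀ l P Q, C l P → C l Q → C (l + 1) (fun x => ¬ (P x ∨ Q x)))
    (hsep : ∀ x y : D, x ≠ y → ∃ P, C 0 P ∧ ¬ P x ∧ P y) :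
    ∃ l, ∀ z, C l (fun x => x ≠ z) := by
  classical
  have := Fintype.ofFinite D
  have hor : ∀ l P Q, C l P → C l Q → C (l + 2) (fun x => P x ∨ Q x) := by
    intro l P Q hP hQ
    have := hnor (l + 1) _ _ (hnor l P Q hP hQ) (hnor l P Q hP hQ)
    simpa only [or_self, not_not] using this
  have key : ∀ (n : ℕ) (z : D) (T : Finset D), T.card ≤ n → z ∉ T →
      ∃ P, C (2 * n) P ∧ ¬ P z ∧ ∀ y ∈ T, P y := by
    intro n
    induction n with
    | zero =>
      intro z T hT _
      obtain ⟨y, hy⟩ := exists_ne z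
      obtain ⟨P, h1, h2, -⟩ := hsep z y hy.symm
      refine ⟨P, h1, h2, ?_⟩
      simp [Finset.card_eq_zero.mp (Nat.le_zero.mp hT)]
    | succ n ih =>
      -- a predicate moves up by two layers as `P ∨ P`
      have lift : ∀ x y : D, x ≠ y → ∃ P, C (2 * n) P ∧ ¬ P x ∧ P y := by
        intro x y hxy
        obtain ⟨P, h1, h2, h3⟩ := hsep x y hxy
        refine ⟨P, ?_, h2, h3⟩
        clear ih
        induction n with
        | zero => exact h1
        | succ n ih =>
          have := hor _ _ _ ih ih
          simp only [or_self] at this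
          exact this
      intro z T hT hz
      rcases T.eq_empty_or_nonempty with rfl | ⟨y, hy⟩
      · obtain ⟨P, h1, h2, h3⟩ := ih z ∅ (by simp) (by simp)
        exact ⟨_, hor _ _ _ h1 h1, by simpa using h2, by simp⟩
      · obtain ⟨P, h1, h2, h3⟩ := ih z (T.erase y)
          (by rw [Finset.card_erase_of_mem hy]; omega) (fun h => hz (Finset.mem_of_mem_erase h))
        obtain ⟨Q, h4, h5, h6⟩ := lift z y (fun e => hz (e ▸ hy))
        refine ⟨_, hor _ _ _ h1 h4, by simp [h2, h5], fun x hx => ?_⟩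
        by_cases hxy : x = y
        · exact Or.inr (hxy ▸ h6)
        · exact Or.inl (h3 x (Finset.mem_erase.mpr ⟨hxy, hx⟩))
  refine ⟨2 * Fintype.card D, fun z => ?_⟩
  obtain ⟨P, h1, h2, h3⟩ := key (Fintype.card D) z (Finset.univ.erase z)
    ((Finset.card_le_card (Finset.erase_subset _ _)).trans_eq Finset.card_univ) (by simp)
  have : (fun x => x ≠ z) = P := by
    funext x
    by_cases hx : x = z
    · subst hx
      simp [h2]
    · simp [hx, h3 x (by simp [hx])]
  rwa [this]

/-! ### Activation functions that vanish or saturate at `-∞` -/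

/-- Activation functions with the rough shape of the rectifier: they are comparable to the identity
on the positive half-line, and nonpositive, bounded and convergent at `-∞` on the negative one. -/
structure ReluLike (ρ : ℝ → ℝ) : Prop where
  zero : ρ 0 = 0
  half_lt : ∀ t, 0 < t → t / 2 < ρ t
  le_mul : ∀ t, 0 < t → ρ t ≤ 5 / 4 * t
  neg_two_le : ∀ t, t ≤ 0 → -2 ≤ ρ t
  nonpos : ∀ t, t ≤ 0 → ρ t ≤ 0
  tendsto : ∃ L : ℝ, Filter.Tendsto ρ Filter.atBot (nhds L)

/-- The rounded activation function takes the value `2 ^ e` at a float `c = a * 2 ^ e`, where the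
scaling factor `a` is a float, too. -/
def HitsPow (p q : ℕ) (ρ : ℝ → ℝ) (e : ℤ) : Prop :=
  ∃ (a c : FinFloat p q) (hm : (2 : ℝ) ^ e ∈ FinFloat p q),
    (c : ℝ) = a * 2 ^ e ∧ |(a : ℝ)| ≤ 2 ∧ roundReal p q (ρ c) = .finite ⟨2 ^ e, hm⟩

theorem correctlyRounded_negInf {ρ : ℝ → ℝ} {L : ℝ}
    (h : Filter.Tendsto ρ Filter.atBot (nhds L)) :
    correctlyRounded p q ρ .negInf = roundReal p q L := by
  have h1 : Filter.Tendsto (fun t : ℝ => (ρ t : EReal)) Filter.atBot (nhds (L : EReal)) :=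
    (continuous_coe_real_ereal.tendsto L).comp h
  have h2 : ∃ l : EReal, Filter.Tendsto (fun t : ℝ => (ρ t : EReal)) Filter.atBot (nhds l) :=
    ⟨L, h1⟩
  have h3 : h2.choose = L := tendsto_nhds_unique h2.choose_spec h1
  rw [correctlyRounded, dif_pos h2, h3]
  simp [roundEReal]

namespace Admissible

variable (H : Admissible p q)
include H

theorem small_mem (n : ℤ) (hn : |n| < 8) : (n : ℝ) ∈ FinFloat p q := by
  have h1 := H.seven_le_emax
  have h2 := emin_eq q
  simpa using H.mul_zpow_mem n 0 hn (by omega) (by omega)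

theorem pow_mem (n : ℕ) (hn : n ≤ 7) : (2 : ℝ) ^ n ∈ FinFloat p q := by
  have h1 := H.seven_le_emax
  have h2 := emin_eq q
  have := H.zpow_mem (k := n) (by omega) (by omega)
  simpa using this

theorem sixteen_mem : (16 : ℝ) ∈ FinFloat p q := by
  have := H.pow_mem 4 (by norm_num)
  norm_num at this
  exact this

theorem eight_mem : (16 : ℝ) / 2 ∈ FinFloat p q := by
  have := H.pow_mem 3 (by norm_num)
  norm_num at this ⊢
  exact this

theorem atMost_mul {w x : FinFloat p q} {a u : ℝ} (hw : (w : ℝ) ≤ 0) (hx : a ≤ x)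
    (hu : u ∈ FinFloat p q) (h : (w : ℝ) * a ≤ u) :
    AtMost u ((ExtFloat.finite w).mul (.finite x)) :=
  H.atMost_roundReal hu ((mul_le_mul_of_nonpos_left hx hw).trans h)

theorem mul_eq_negInf {w x : FinFloat p q} {a : ℝ} (hw : (w : ℝ) ≤ 0) (hx : a ≤ x)
    (h : (w : ℝ) * a ≤ -2 ^ (emax q + 1)) :
    (ExtFloat.finite w).mul (.finite x) = .negInf :=
  H.roundReal_eq_negInf ((mul_le_mul_of_nonpos_left hx hw).trans h)

theorem between_mul {w x : FinFloat p q} {a b l u : ℝ} (hw : (w : ℝ) ≤ 0) (h1 : a ≤ x)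
    (h2 : x ≤ b) (hl : l ∈ FinFloat p q) (hu : u ∈ FinFloat p q) (hl' : l ≤ w * b)
    (hu' : w * a ≤ u) : Between l u ((ExtFloat.finite w).mul (.finite x)) :=
  H.between_roundReal hl hu (hl'.trans (mul_le_mul_of_nonpos_left h2 hw))
    ((mul_le_mul_of_nonpos_left h1 hw).trans hu')

theorem le_two_zpow_emax : (128 : ℝ) ≤ 2 ^ emax q := by
  have h1 : (2 : ℝ) ^ (7 : ℤ) ≤ 2 ^ emax q := two_zpow_mono H.seven_le_emax
  norm_num at h1
  exact h1

theorem five_mem : 5 / 4 * (2 : ℝ) ^ emax q ∈ FinFloat p q := by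
  have h1 := H.seven_le_emax
  have h2 := emin_eq q
  have := H.mul_zpow_mem 5 (emax q - 2) (by norm_num) (by omega) (by omega)
  rw [zpow_sub₀ two_ne_zero] at this
  convert this using 1
  norm_num
  ring

theorem seven_mem : 7 / 4 * (2 : ℝ) ^ emax q ∈ FinFloat p q := by
  have h1 := H.seven_le_emax
  have h2 := emin_eq q
  have := H.mul_zpow_mem 7 (emax q - 2) (by norm_num) (by omega) (by omega)
  rw [zpow_sub₀ two_ne_zero] at this
  convert this using 1
  norm_num
  ring

theorem emax_mem : (2 : ℝ) ^ emax q ∈ FinFloat p q :=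
  H.zpow_mem (by have := H.emin_le_emax; omega) le_rfl

theorem emax_sub_mem (n : ℕ) (hn : n ≤ 7) : (2 : ℝ) ^ (emax q - n) ∈ FinFloat p q := by
  have h1 := H.seven_le_emax
  have h2 := emin_eq q
  exact H.zpow_mem (by omega) (by omega)

variable {ρ : ℝ → ℝ} (hρ : ReluLike ρ)
include hρ

theorem reluLike_zero :
    correctlyRounded p q ρ (.finite (zeroFloat p q)) = .finite (zeroFloat p q) := by
  have h := H.roundReal_coe (zeroFloat p q)
  simpa [correctlyRounded, zeroFloat, hρ.zero] using h

theorem reluLike_pos {a b u : ℝ} {e : ExtFloat p q} (he : Between a b e) (ha : 0 < a)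
    (ha' : a / 2 ∈ FinFloat p q) (hu : u ∈ FinFloat p q) (hbu : 5 / 4 * b ≤ u) :
    Between (a / 2) u (correctlyRounded p q ρ e) := by
  obtain ⟨x, rfl, h1, h2⟩ := he
  have h3 := hρ.half_lt x (ha.trans_le h1)
  have h4 := hρ.le_mul x (ha.trans_le h1)
  exact H.between_roundReal ha' hu (by linarith) (by linarith)

theorem reluLike_tiny {b u : ℝ} {e : ExtFloat p q} (he : Between (tiny p q) b e)
    (hu : u ∈ FinFloat p q) (hbu : 5 / 4 * b ≤ u) :
    Between (tiny p q) u (correctlyRounded p q ρ e) := by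
  obtain ⟨x, rfl, h1, h2⟩ := he
  have h0 := tiny_pos p q
  have h3 := hρ.half_lt x (h0.trans_le h1)
  have h4 := hρ.le_mul x (h0.trans_le h1)
  exact ⟨nearest p q (ρ x),
    H.roundReal_eq_nearest (zero_mem_finFloat p q) hu (by linarith) (by linarith),
    H.tiny_le_nearest (by linarith), nearest_le hu (by linarith)⟩

theorem reluLike_negInf :
    Between (-2) 0 (correctlyRounded p q ρ .negInf) := by
  obtain ⟨L, hL⟩ := hρ.tendsto
  rw [correctlyRounded_negInf hL]
  refine H.between_roundReal (by simpa using H.small_mem (-2) (by norm_num))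
    (zero_mem_finFloat p q) (ge_of_tendsto hL ?_) (le_of_tendsto hL ?_)
  · filter_upwards [Filter.eventually_le_atBot 0] with t ht using hρ.neg_two_le t ht
  · filter_upwards [Filter.eventually_le_atBot 0] with t ht using hρ.nonpos t ht

theorem reluLike_nonpos {e : ExtFloat p q} (he : AtMost 0 e) :
    Between (-2) 0 (correctlyRounded p q ρ e) := by
  rcases he with rfl | ⟨x, rfl, h⟩
  · exact H.reluLike_negInf hρ
  · exact H.between_roundReal (by simpa using H.small_mem (-2) (by norm_num))
      (zero_mem_finFloat p q) (hρ.neg_two_le x h) (hρ.nonpos x h)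

variable {D : Type*} {d : ℕ} {X : D → Fin d → FinFloat p q}

/-- The first hidden layer: comparison of a coordinate with a constant. A positive difference of
two floats is at least the least positive float, and stays so after the activation. -/
theorem reluLike_compare (hX : ∀ x i, |(X x i : ℝ)| ≤ 2 ^ (emax q - 1)) (i : Fin d)
    (z : FinFloat p q) (hz : |(z : ℝ)| ≤ 2 ^ (emax q - 1)) (s : ℝ) (hs : s = 1 ∨ s = -1) :
    ∃ h, Reach (correctlyRounded p q ρ) X 0 h ∧
      ∀ x, (s * z < s * X x i → tiny p q ≤ h x) ∧
        (¬ s * z < s * X x i → -2 ≤ (h x : ℝ) ∧ (h x : ℝ) ≤ 0) := by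
  have smem : ∀ v ∈ FinFloat p q, s * v ∈ FinFloat p q := by
    rintro v hv
    rcases hs with rfl | rfl
    · simpa using hv
    · simpa using neg_mem_finFloat hv
  have hsabs : ∀ v : ℝ, |s * v| = |v| := by
    intro v
    rcases hs with rfl | rfl <;> simp
  have hs' : s ∈ FinFloat p q := by simpa using smem 1 (by simpa using H.small_mem 1 (by norm_num))
  let w : FinFloat p q := ⟨s, hs'⟩
  let b : FinFloat p q := ⟨-(s * z), neg_mem_finFloat (smem _ z.2)⟩
  have key : ∀ x, affineOne w b (.finite (X x i)) = roundReal p q (s * X x i - s * z) := by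
    intro x
    rw [affineOne, H.mul_of_mem (smem _ (X x i).2), finite_add_finite, sub_eq_add_neg]
  have hex : ∀ x, ∃ y : FinFloat p q,
      .finite y = correctlyRounded p q ρ (affineOne w b (.finite (X x i))) ∧
      (s * z < s * X x i → tiny p q ≤ y) ∧
        (¬ s * z < s * X x i → -2 ≤ (y : ℝ) ∧ (y : ℝ) ≤ 0) := by
    intro x
    rw [key]
    by_cases hlt : s * z < s * X x i
    · have h1 := H.add_tiny_le (smem _ z.2) (smem _ (X x i).2) hlt
      have h2 := abs_le.mp (hsabs z ▸ hz)
      have h3 := abs_le.mp (hsabs (X x i) ▸ hX x i)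
      rw [two_zpow_sub_one] at h2 h3
      obtain ⟨y, hy, hy1, -⟩ := H.reluLike_tiny hρ (H.between_roundReal
        (r := s * X x i - s * z) H.tiny_mem H.emax_mem (by linarith) (by linarith))
        H.five_mem le_rfl
      exact ⟨y, hy.symm, fun _ => hy1, fun h => absurd hlt h⟩
    · obtain ⟨y, hy, hy1⟩ := H.reluLike_nonpos hρ (H.atMost_roundReal
        (r := s * X x i - s * z) (zero_mem_finFloat p q) (by linarith))
      exact ⟨y, hy.symm, fun h => absurd h hlt, fun _ => hy1⟩
  choose h h1 h2 using hex
  exact ⟨h, ⟨i, w, b, h1⟩, h2⟩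

/-- A layer that swaps the two alternatives and enlarges the gap between them. -/
theorem reluLike_amplify {l : ℕ} {h : D → FinFloat p q} {P : D → Prop} {a b : ℝ}
    (hh : Reach (correctlyRounded p q ρ) X l h)
    (hP : ∀ x, (P x → a ≤ h x) ∧ (¬ P x → -2 ≤ (h x : ℝ) ∧ (h x : ℝ) ≤ 0))
    (hb : b ∈ FinFloat p q) (hb' : b / 2 ∈ FinFloat p q) (hb0 : 0 < b) (hb16 : b ≤ 16)
    (hab : b ≤ 2 ^ (emax q - 1) * a) :
    ∃ h', Reach (correctlyRounded p q ρ) X (l + 1) h' ∧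
      ∀ x, (¬ P x → b / 2 ≤ h' x) ∧ (¬ ¬ P x → -2 ≤ (h' x : ℝ) ∧ (h' x : ℝ) ≤ 0) := by
  have hM := H.le_two_zpow_emax
  have hp1 := two_zpow_sub_one (emax q)
  let w : FinFloat p q := ⟨-2 ^ (emax q - 1), neg_mem_finFloat
    (by simpa using H.emax_sub_mem 1 (by norm_num))⟩
  have hw : (w : ℝ) = -2 ^ (emax q - 1) := rfl
  have hw0 : (w : ℝ) ≤ 0 := by linarith
  have hex : ∀ x, ∃ y : FinFloat p q,
      .finite y = correctlyRounded p q ρ (affineOne w ⟨b, hb⟩ (.finite (h x))) ∧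
      (¬ P x → b / 2 ≤ y) ∧ (¬ ¬ P x → -2 ≤ (y : ℝ) ∧ (y : ℝ) ≤ 0) := by
    intro x
    have hbb : Between b b (ExtFloat.finite (⟨b, hb⟩ : FinFloat p q)) := ⟨_, rfl, le_rfl, le_rfl⟩
    by_cases hPx : P x
    · obtain ⟨y, hy, hy1⟩ := H.reluLike_nonpos hρ (H.atMost_add
        (H.atMost_mul (w := w) hw0 ((hP x).1 hPx) (neg_mem_finFloat hb) (by rw [hw]; linarith))
        hbb.atMost (zero_mem_finFloat p q) (by linarith))
      exact ⟨y, hy.symm, fun h => absurd hPx h, fun _ => hy1⟩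
    · obtain ⟨h1, h2⟩ := (hP x).2 hPx
      obtain ⟨y, hy, hy1, -⟩ := H.reluLike_pos hρ (H.between_add (l := b)
        (u := 5 / 4 * 2 ^ emax q) (H.between_mul (w := w) hw0 h1 h2 (zero_mem_finFloat p q)
          H.emax_mem (by linarith) (by rw [hw]; linarith)) hbb hb H.five_mem (by linarith)
          (by linarith)) hb0 hb' H.seven_mem (by linarith)
      exact ⟨y, hy.symm, fun _ => hy1, fun h => absurd hPx h⟩
  choose h' h1 h2 using hex
  exact ⟨h', H.reach_of_affineOne hh w ⟨b, hb⟩ h1, h2⟩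

/-- Four amplifying layers make the gap so large that the next product overflows. -/
theorem reluLike_gap (hX : ∀ x i, |(X x i : ℝ)| ≤ 2 ^ (emax q - 1)) (i : Fin d)
    (z : FinFloat p q) (hz : |(z : ℝ)| ≤ 2 ^ (emax q - 1)) (s : ℝ) (hs : s = 1 ∨ s = -1) :
    ∃ h, Reach (correctlyRounded p q ρ) X 3 h ∧
      ∀ x, (¬ s * z < s * X x i → 8 ≤ (h x : ℝ)) ∧
        (s * z < s * X x i → -2 ≤ (h x : ℝ) ∧ (h x : ℝ) ≤ 0) := by
  have hM := H.le_two_zpow_emax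
  have hMp := H.add_two_le_emax
  have hem := emin_eq q
  have hp1 := two_zpow_sub_one (emax q)
  have e1 : (2 : ℝ) ^ (-(p : ℤ)) / 2 = 2 ^ (-(p : ℤ) - 1) := (two_zpow_sub_one _).symm
  have one : (1 : ℝ) ∈ FinFloat p q := by simpa using H.pow_mem 0 (by norm_num)
  have half : (1 : ℝ) / 2 ∈ FinFloat p q := by
    have := H.zpow_mem (p := p) (q := q) (k := -1) (by omega) (by omega)
    simpa using this
  have hp0 : (2 : ℝ) ^ (-(p : ℤ)) ≤ 1 := zpow_le_one_of_nonpos₀ one_le_two (by omega)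
  obtain ⟨h₀, r₀, H₀⟩ := H.reluLike_compare hρ hX i z hz s hs
  obtain ⟨h₁, r₁, H₁⟩ := H.reluLike_amplify hρ (b := 2 ^ (-(p : ℤ))) r₀ H₀
    (H.zpow_mem (by omega) (by omega)) (e1 ▸ H.zpow_mem (by omega) (by omega)) (two_zpow_pos _)
    (by linarith) (by rw [tiny, two_zpow_mul]; exact two_zpow_mono (by omega))
  obtain ⟨h₂, r₂, H₂⟩ := H.reluLike_amplify hρ (b := 1) r₁ H₁ one half one_pos (by norm_num) (by
    rw [e1, two_zpow_mul]
    exact one_le_zpow₀ one_le_two (by omega))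
  obtain ⟨h₃, r₃, H₃⟩ := H.reluLike_amplify hρ (b := 16) r₂ H₂ H.sixteen_mem H.eight_mem
    (by norm_num) le_rfl
    (by linarith)
  refine ⟨h₃, r₃, fun x => ⟨fun hx => ?_, fun hx => ?_⟩⟩
  · have := (H₃ x).1 (not_not.mpr hx)
    linarith
  · exact (H₃ x).2 (fun h => h (not_not.mpr hx))

end Admissible

/-- The weight `-2 ^ (emax - 2)`, which sends floats `≥ 8` to `-∞`. -/
theorem Admissible.neg_quarter_mem (H : Admissible p q) :
    -(2 : ℝ) ^ (emax q - 2) ∈ FinFloat p q :=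
  neg_mem_finFloat (by simpa using H.emax_sub_mem 2 (by norm_num))

theorem quarter_mul_eight (q : ℕ) : -(2 : ℝ) ^ (emax q - 2) * 8 = -2 ^ (emax q + 1) := by
  rw [neg_mul, show (8 : ℝ) = 2 ^ (3 : ℤ) by norm_num, two_zpow_mul]
  congr 2
  ring

theorem four_mul_quarter (q : ℕ) : (2 : ℝ) ^ (emax q - 2) * 4 = 2 ^ emax q := by
  rw [show (4 : ℝ) = 2 ^ (2 : ℤ) by norm_num, two_zpow_mul]
  congr 1
  ring

/-- The predicate `P` is computed in layer `l`: the neuron takes a value `τ ≥ 8` where it is true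
and the value `κ` where it is false. -/
def Encodes {D : Type*} {d : ℕ} (σ : ExtFloat p q → ExtFloat p q) (X : D → Fin d → FinFloat p q)
    (κ : FinFloat p q) (l : ℕ) (P : D → Prop) : Prop :=
  ∃ (τ : FinFloat p q) (h : D → FinFloat p q), 8 ≤ (τ : ℝ) ∧ Reach σ X l h ∧
    ∀ x, (P x → h x = τ) ∧ (¬ P x → h x = κ)

namespace Admissible

variable (H : Admissible p q)
include H

theorem quarter_mul_eq_negInf {x : FinFloat p q} (hx : 8 ≤ (x : ℝ)) :
    (ExtFloat.finite ⟨_, H.neg_quarter_mem⟩).mul (.finite x) = .negInf :=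
  H.mul_eq_negInf (neg_nonpos.mpr (two_zpow_pos _).le) hx (quarter_mul_eight q).le

theorem between_quarter_mul {x : FinFloat p q} (h1 : -2 ≤ (x : ℝ)) (h2 : (x : ℝ) ≤ 0) :
    Between 0 (2 ^ (emax q - 1))
      ((ExtFloat.finite (⟨_, H.neg_quarter_mem⟩ : FinFloat p q)).mul (.finite x)) := by
  have h3 := four_mul_quarter q
  have h4 := two_zpow_sub_one (emax q)
  exact H.between_mul (neg_nonpos.mpr (two_zpow_pos _).le) h1 h2 (zero_mem_finFloat p q)
    (by simpa using H.emax_sub_mem 1 (by norm_num)) (by simp) (by linarith)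

theorem negFloat_mul {a x y : FinFloat p q}
    (h : (ExtFloat.finite a).mul (.finite x) = .finite y) :
    (ExtFloat.finite (negFloat a)).mul (.finite x) = .finite (negFloat y) := by
  have := H.roundReal_neg h
  rw [finite_mul_finite]
  rw [← neg_mul] at this
  exact this

variable {ρ : ℝ → ℝ} (hρ : ReluLike ρ) {κ : FinFloat p q}
  (hκ : correctlyRounded p q ρ .negInf = .finite κ)
include hρ hκ

theorem reluLike_kappa : -2 ≤ (κ : ℝ) ∧ (κ : ℝ) ≤ 0 := by
  obtain ⟨y, hy, h⟩ := H.reluLike_negInf hρ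
  rw [hκ] at hy
  cases hy
  exact h

variable {D : Type*} {d : ℕ} {X : D → Fin d → FinFloat p q}

/-- A layer in which one of two alternatives overflows to `-∞` and is thereby sent to `κ`. -/
theorem reluLike_saturate {l : ℕ} {h : D → FinFloat p q} {P : D → Prop}
    (hh : Reach (correctlyRounded p q ρ) X l h)
    (hP : ∀ x, (P x → 8 ≤ (h x : ℝ)) ∧ (¬ P x → -2 ≤ (h x : ℝ) ∧ (h x : ℝ) ≤ 0)) :
    ∃ h', Reach (correctlyRounded p q ρ) X (l + 1) h' ∧
      ∀ x, (P x → h' x = κ) ∧ (¬ P x → 8 ≤ (h' x : ℝ)) ∧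
        .finite (h' x) = correctlyRounded p q ρ
          (affineOne ⟨_, H.neg_quarter_mem⟩ ⟨_, H.sixteen_mem⟩ (.finite (h x))) := by
  have hM := H.le_two_zpow_emax
  have h4 := two_zpow_sub_one (emax q)
  have hex : ∀ x, ∃ y : FinFloat p q,
      (P x → y = κ) ∧ (¬ P x → 8 ≤ (y : ℝ)) ∧ .finite y = correctlyRounded p q ρ
        (affineOne ⟨_, H.neg_quarter_mem⟩ ⟨_, H.sixteen_mem⟩ (.finite (h x))) := by
    intro x
    by_cases hPx : P x
    · refine ⟨κ, fun _ => rfl, fun h => absurd hPx h, ?_⟩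
      rw [affineOne, H.quarter_mul_eq_negInf ((hP x).1 hPx), ← hκ]
      rfl
    · obtain ⟨h1, h2⟩ := (hP x).2 hPx
      obtain ⟨y, hy, hy1, -⟩ := H.reluLike_pos hρ (H.between_add (l := 16) (u := 2 ^ emax q)
        (H.between_quarter_mul h1 h2) (f := .finite ⟨_, H.sixteen_mem⟩)
        ⟨_, rfl, le_rfl, le_rfl⟩ H.sixteen_mem H.emax_mem (by linarith) (by simp only; linarith))
        (by norm_num) H.eight_mem H.five_mem le_rfl
      exact ⟨y, fun h => absurd h hPx, fun _ => by linarith, hy.symm⟩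
  choose h' h1 h2 h3 using hex
  exact ⟨h', H.reach_of_affineOne hh _ _ h3, fun x => ⟨h1 x, h2 x, h3 x⟩⟩

/-- Comparison of a coordinate with a constant, encoded in layer `5`. -/
theorem reluLike_encodes_le (hX : ∀ x i, |(X x i : ℝ)| ≤ 2 ^ (emax q - 1)) (i : Fin d)
    (z : FinFloat p q) (hz : |(z : ℝ)| ≤ 2 ^ (emax q - 1)) (s : ℝ) (hs : s = 1 ∨ s = -1) :
    Encodes (correctlyRounded p q ρ) X κ 5 (fun x => ¬ s * z < s * X x i) := by
  obtain ⟨h, r, e⟩ := H.reluLike_gap hρ hX i z hz s hs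
  obtain ⟨h', r', e'⟩ := H.reluLike_saturate hρ hκ (P := fun x => ¬ s * z < s * X x i) r
    (fun x => ⟨(e x).1, fun hx => (e x).2 (not_not.mp hx)⟩)
  obtain ⟨hκ1, hκ2⟩ := H.reluLike_kappa hρ hκ
  obtain ⟨h'', r'', e''⟩ := H.reluLike_saturate hρ hκ (P := fun x => s * z < s * X x i) r'
    (fun x => ⟨fun hx => (e' x).2.1 (not_not.mpr hx),
      fun hx => by rw [(e' x).1 hx]; exact ⟨hκ1, hκ2⟩⟩)
  -- the alternative that does not overflow is now computed from the constant `κ`, so its value is a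
  -- constant, too
  by_cases hex : ∃ x₀, ¬ s * z < s * X x₀ i
  · obtain ⟨x₀, hx₀⟩ := hex
    refine ⟨h'' x₀, h'', (e'' x₀).2.1 hx₀, r'', fun x => ⟨fun hx => ?_, fun hx => ?_⟩⟩
    · have h1 := (e'' x).2.2
      have h2 := (e'' x₀).2.2
      rw [(e' x).1 hx] at h1
      rw [(e' x₀).1 hx₀] at h2
      have := h1.trans h2.symm
      exact ExtFloat.finite.inj this
    · exact (e'' x).1 (not_not.mp hx)
  · exact ⟨⟨_, H.sixteen_mem⟩, h'', by norm_num, r'', fun x => ⟨fun hx => absurd ⟨x, hx⟩ hex,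
      fun hx => (e'' x).1 (not_not.mp hx)⟩⟩

/-- The nor-gate: a true input overflows, and if both are false, then the result is a constant. -/
theorem reluLike_nor {l : ℕ} {P Q : D → Prop} (hP : Encodes (correctlyRounded p q ρ) X κ l P)
    (hQ : Encodes (correctlyRounded p q ρ) X κ l Q) :
    Encodes (correctlyRounded p q ρ) X κ (l + 1) (fun x => ¬ (P x ∨ Q x)) := by
  classical
  obtain ⟨τ₁, h₁, t₁, r₁, e₁⟩ := hP
  obtain ⟨τ₂, h₂, t₂, r₂, e₂⟩ := hQ
  obtain ⟨hκ1, hκ2⟩ := H.reluLike_kappa hρ hκ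
  have hM := H.le_two_zpow_emax
  have h4 := two_zpow_sub_one (emax q)
  have hf := H.between_quarter_mul hκ1 hκ2
  obtain ⟨τ, hτ, hτ1, -⟩ := H.reluLike_pos hρ (H.between_add (l := 16) (u := 5 / 4 * 2 ^ emax q)
    (H.between_add (l := 0) (u := 2 ^ emax q) hf hf (zero_mem_finFloat p q) H.emax_mem
      (by linarith) (by linarith)) (f := .finite ⟨_, H.sixteen_mem⟩)
    ⟨_, rfl, le_rfl, le_rfl⟩ H.sixteen_mem H.five_mem (by linarith) (by simp only; linarith))
    (by norm_num) H.eight_mem H.seven_mem (by linarith)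
  refine ⟨τ, fun x => if P x ∨ Q x then κ else τ, by linarith, ⟨h₁, h₂, r₁, r₂,
    ⟨_, H.neg_quarter_mem⟩, ⟨_, H.neg_quarter_mem⟩, ⟨_, H.sixteen_mem⟩, fun x => ?_⟩,
    fun x => ⟨fun hx => if_neg hx, fun hx => if_pos (not_not.mp hx)⟩⟩
  beta_reduce
  by_cases hPx : P x
  · have hat : AtMost (2 ^ (emax q - 1)) ((ExtFloat.finite
        (⟨_, H.neg_quarter_mem⟩ : FinFloat p q)).mul (.finite (h₂ x))) := by
      by_cases hQx : Q x
      · rw [(e₂ x).1 hQx, H.quarter_mul_eq_negInf t₂]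
        exact Or.inl rfl
      · rw [(e₂ x).2 hQx]
        exact hf.atMost
    rw [if_pos (Or.inl hPx), affineTwo, (e₁ x).1 hPx, H.quarter_mul_eq_negInf t₁,
      negInf_add_of_atMost hat, ← hκ]
    rfl
  · by_cases hQx : Q x
    · rw [if_pos (Or.inr hQx), affineTwo, (e₁ x).2 hPx, (e₂ x).1 hQx, H.quarter_mul_eq_negInf t₂,
        add_comm' _ ExtFloat.negInf, negInf_add_of_atMost hf.atMost, ← hκ]
      rfl
    · rw [if_neg (by tauto), affineTwo, (e₁ x).2 hPx, (e₂ x).2 hQx, hτ]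

omit hρ in
/-- A neuron that overflows before the activation, and hence is `κ`, where `P` holds, and that is
the value `y` of the activation function at `c` elsewhere. -/
theorem reluLike_select {l : ℕ} {g : D → FinFloat p q} {P : D → Prop}
    (hg : Reach (correctlyRounded p q ρ) X l g)
    (hP : ∀ x, (P x → 2 ≤ (g x : ℝ)) ∧ (¬ P x → g x = zeroFloat p q)) {c y : FinFloat p q}
    (hc : correctlyRounded p q ρ (.finite c) = .finite y) :
    ∃ h, Reach (correctlyRounded p q ρ) X (l + 1) h ∧
      ∀ x, (P x → h x = κ) ∧ (¬ P x → h x = y) := by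
  classical
  refine ⟨fun x => if P x then κ else y, H.reach_of_affineOne hg
    (negFloat ⟨_, H.emax_mem⟩) c (fun x => ?_), fun x => ⟨fun h => if_pos h, fun h => if_neg h⟩⟩
  by_cases hPx : P x
  · rw [if_pos hPx, affineOne, H.mul_eq_negInf (a := 2)
      (by simpa [negFloat] using (two_zpow_pos (emax q)).le) ((hP x).1 hPx)
      (by simp [negFloat, two_zpow_add_one]), ← hκ]
    rfl
  · rw [if_neg hPx, affineOne, (hP x).2 hPx, H.mul_zero, H.zero_add, hc]

open Classical in
/-- The complement of a point, once encoded, gives rise to a delta function: two neurons that have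
the same value `κ` off the point, with opposite weights, cancel there exactly. -/
theorem reluLike_delta {l : ℕ} {z : D}
    (hz : Encodes (correctlyRounded p q ρ) X κ l (fun x => x ≠ z)) {e : ℤ}
    (he : HitsPow p q ρ e) (hm : (2 : ℝ) ^ e ∈ FinFloat p q) :
    Reach (correctlyRounded p q ρ) X (l + 3)
      (fun x => if x = z then ⟨2 ^ e, hm⟩ else zeroFloat p q) := by
  obtain ⟨τ, h, t, r, eh⟩ := hz
  obtain ⟨hκ1, hκ2⟩ := H.reluLike_kappa hρ hκ
  obtain ⟨a, c, _, hac, ha, hc⟩ := he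
  have hM := H.le_two_zpow_emax
  have hMp := H.add_two_le_emax
  have hem := emin_eq q
  have half : (1 : ℝ) / 2 ∈ FinFloat p q := by
    have := H.zpow_mem (p := p) (q := q) (k := -1) (by omega) (by omega)
    simpa using this
  have mone : (-1 : ℝ) ∈ FinFloat p q := by simpa using H.small_mem (-1) (by norm_num)
  have two : (2 : ℝ) ∈ FinFloat p q := by simpa using H.small_mem 2 (by norm_num)
  have four : (4 : ℝ) ∈ FinFloat p q := by simpa using H.small_mem 4 (by norm_num)
  -- shift the value `κ` to zero
  obtain ⟨k, hk, hk1, hk2⟩ := H.exists_roundReal_eq (r := 1 / 2 * (κ : ℝ)) mone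
    (zero_mem_finFloat p q) (by linarith) (by linarith)
  have hτM : (τ : ℝ) ≤ 2 ^ emax q * 2 := by
    rw [← two_zpow_add_one]
    exact (le_abs_self _).trans ((H.abs_le_maxFloat τ.2).trans (maxFloat_lt p q).le)
  obtain ⟨τ', hτ', hτ1, -⟩ := H.reluLike_pos hρ (H.between_add (l := 4) (u := 5 / 4 * 2 ^ emax q)
    (H.between_roundReal (r := 1 / 2 * (τ : ℝ)) four H.emax_mem (by linarith) (by linarith))
    (f := .finite (negFloat k)) ⟨_, rfl, le_rfl, le_rfl⟩ four H.five_mem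
    (by simp only [negFloat]; linarith) (by simp only [negFloat]; linarith))
    (by norm_num) (by norm_num; exact two) H.seven_mem (by linarith)
  have rg : Reach (correctlyRounded p q ρ) X (l + 1)
      (fun x => if x ≠ z then τ' else zeroFloat p q) := by
    refine H.reach_of_affineOne r ⟨1 / 2, half⟩ (negFloat k) fun x => ?_
    by_cases hx : x ≠ z
    · rw [if_pos hx, (eh x).1 hx, affineOne, finite_mul_finite, hτ']
    · rw [if_neg hx, (eh x).2 hx, affineOne, finite_mul_finite]
      simp only
      rw [hk, H.add_of_mem (by simpa [negFloat] using zero_mem_finFloat p q)]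
      refine (H.reluLike_zero hρ).symm.trans ?_
      congr 2
      exact Subtype.ext (by simp [negFloat, zeroFloat])
  have hg : ∀ x, (x ≠ z → 2 ≤ (((if x ≠ z then τ' else zeroFloat p q) : FinFloat p q) : ℝ)) ∧
      (¬ x ≠ z → (if x ≠ z then τ' else zeroFloat p q) = zeroFloat p q) := by
    intro x
    refine ⟨fun hx => ?_, fun hx => if_neg hx⟩
    rw [if_pos hx]
    linarith
  -- off `z` both neurons are `κ`, at `z` they are `2 ^ e` and zero
  obtain ⟨h₁, r₁, e₁⟩ := H.reluLike_select hκ rg hg (c := c) (y := ⟨2 ^ e, hm⟩) hc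
  obtain ⟨h₂, r₂, e₂⟩ := H.reluLike_select hκ rg hg (H.reluLike_zero hρ)
  refine ⟨h₁, h₂, r₁, r₂, a, negFloat a, zeroFloat p q, fun x => ?_⟩
  beta_reduce
  rw [affineTwo, H.add_zero]
  by_cases hx : x ≠ z
  · obtain ⟨y, hy, -, -⟩ := H.exists_roundReal_eq (r := (a : ℝ) * κ)
      (neg_mem_finFloat four) four
      (by have := abs_le.mp ha; nlinarith) (by have := abs_le.mp ha; nlinarith)
    have hy' : (ExtFloat.finite a).mul (.finite κ) = .finite y := hy
    rw [if_neg hx, (e₁ x).1 hx, (e₂ x).1 hx, hy', H.negFloat_mul hy',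
      H.add_of_mem (by simpa [negFloat] using zero_mem_finFloat p q)]
    refine (H.reluLike_zero hρ).symm.trans ?_
    congr 2
    exact Subtype.ext (by simp [negFloat, zeroFloat])
  · have hx' : x = z := not_not.mp hx
    rw [if_pos hx', (e₁ x).2 hx, (e₂ x).2 hx, H.mul_zero, H.add_zero, finite_mul_finite]
    simp only
    rw [← hac, H.roundReal_coe]
    exact hc.symm

omit hκ in
/-- Networks with rectifier-like activation functions compute all functions on sets of bounded
inputs. -/
theorem exists_network_of_reluLike [Finite D] [Nontrivial D] (S : ReductionOrder) (hd : 0 < d)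
    (hX : ∀ x i, |(X x i : ℝ)| ≤ 2 ^ (emax q - 1)) (hinj : Function.Injective X)
    {e₁ e₂ : ℤ} (h1 : -emax q ≤ e₁) (h1' : e₁ ≤ 0) (h2 : 0 ≤ e₂) (h2' : e₂ ≤ emax q - 1)
    (u₁ : HitsPow p q ρ e₁) (u₂ : HitsPow p q ρ e₂)
    (f : D → {y : ExtFloat p q // y ≠ .nan}) :
    ∃ N : Network p q d 1, ∀ x,
      N.eval S (correctlyRounded p q ρ) (fun i => .finite (X x i)) 0 = (f x).1 := by
  have := Fintype.ofFinite D
  obtain ⟨κ, hκ, -, -⟩ := H.reluLike_negInf hρ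
  obtain ⟨l, hl⟩ := exists_forall_ne_mem
    (fun l P => Encodes (correctlyRounded p q ρ) X κ (5 + l) P)
    (fun l P Q hP hQ => H.reluLike_nor hρ hκ hP hQ) (by
      intro x y hxy
      obtain ⟨i, hi⟩ : ∃ i, X x i ≠ X y i := by
        by_contra hne
        push Not at hne
        exact hxy (hinj (funext hne))
      rcases lt_or_gt_of_ne (fun h => hi (Subtype.ext h)) with hlt | hlt
      · refine ⟨_, H.reluLike_encodes_le hρ hκ hX i (X y i) (hX y i) (-1) (Or.inr rfl), ?_, ?_⟩ <;>
          simp [hlt]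
      · refine ⟨_, H.reluLike_encodes_le hρ hκ hX i (X y i) (hX y i) 1 (Or.inl rfl), ?_, ?_⟩ <;>
          simp [hlt])
  obtain ⟨_, _, m₁, _⟩ := id u₁
  obtain ⟨_, _, m₂, _⟩ := id u₂
  exact H.exists_network_of_reach_delta S hd f h1 h1' h2 h2' m₁ m₂ _
    (fun z => H.reluLike_delta hρ hκ (hl z) u₁ m₁) (fun z => H.reluLike_delta hρ hκ (hl z) u₂ m₂)

end Admissible

/-! ### Odd activation functions -/

/-- Odd activation functions that are dominated by the identity, positive on `(0, 2]`, close to the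
identity at some small points, and equal to `1` after rounding at some float `n * 2 ^ (-p)`. -/
structure SineLike (p q : ℕ) (ρ : ℝ → ℝ) : Prop where
  odd : ∀ t, ρ (-t) = -ρ t
  abs_le : ∀ t, |ρ t| ≤ |t|
  tiny_lt : ∀ t, tiny p q ≤ t → t ≤ 2 → tiny p q / 2 < ρ t
  two_tiny : |ρ (2 * tiny p q) - 2 * tiny p q| < tiny p q / 2
  zpow : ∃ hm : (2 : ℝ) ^ (1 - (p : ℤ)) ∈ FinFloat p q,
    roundReal p q (ρ (2 ^ (1 - (p : ℤ)))) = .finite ⟨2 ^ (1 - (p : ℤ)), hm⟩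
  one : ∃ (n : ℤ) (hm : (1 : ℝ) ∈ FinFloat p q), |n| < 2 ^ (p + 1) ∧
    roundReal p q (ρ (n * 2 ^ (-(p : ℤ)))) = .finite ⟨1, hm⟩

/-- The multiple `k` of the least positive float, meaningful for small `k`. -/
noncomputable def multTiny (p q : ℕ) (k : ℤ) : FinFloat p q := nearest p q (k * tiny p q)

namespace Admissible

variable (H : Admissible p q)
include H

theorem mul_tiny_mem (k : ℤ) (hk : |k| < 8) : (k : ℝ) * tiny p q ∈ FinFloat p q :=
  H.mul_zpow_mem k _ hk le_rfl
    (by have := H.seven_le_emax; have := emin_eq q; have := H.add_two_le_emax; omega)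

theorem coe_multTiny (k : ℤ) (hk : |k| < 8) : (multTiny p q k : ℝ) = k * tiny p q := by
  have := nearest_coe (⟨_, H.mul_tiny_mem k hk⟩ : FinFloat p q)
  rw [multTiny, this]

theorem multTiny_zero : multTiny p q 0 = zeroFloat p q :=
  Subtype.ext (by rw [H.coe_multTiny 0 (by norm_num)]; simp [zeroFloat])

theorem roundReal_eq_multTiny {r : ℝ} {k : ℤ} (hk : |k| < 8)
    (h : |r - k * tiny p q| < tiny p q / 2) : roundReal p q r = .finite (multTiny p q k) := by
  rw [H.roundReal_eq_of_abs_lt (H.mul_tiny_mem k hk) h]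
  congr 1
  exact Subtype.ext (H.coe_multTiny k hk).symm

/-- Affine functions of small multiples of the least positive float: the product is rounded to an
integral multiple. -/
theorem affineOne_multTiny {w : FinFloat p q} {k j m : ℤ} (hk : |k| < 8) (hj : |j| < 8)
    (hm : |m| < 8) (hjm : |j + m| < 8) (h : |(w : ℝ) * k - j| < 1 / 2) :
    affineOne w (multTiny p q m) (.finite (multTiny p q k)) = .finite (multTiny p q (j + m)) := by
  have ht := tiny_pos p q
  rw [affineOne, finite_mul_finite, H.coe_multTiny k hk, H.roundReal_eq_multTiny hj,
    finite_add_finite, H.coe_multTiny j hj, H.coe_multTiny m hm]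
  · refine H.roundReal_eq_multTiny hjm ?_
    push_cast
    rw [← add_mul, sub_self, abs_zero]
    linarith
  · rw [show (w : ℝ) * (k * tiny p q) - j * tiny p q = (w * k - j) * tiny p q by ring, abs_mul,
      abs_of_pos ht]
    nlinarith

theorem eighth_mem (n : ℤ) (hn : |n| < 8) : (n : ℝ) / 8 ∈ FinFloat p q := by
  have h1 := H.seven_le_emax
  have h2 := emin_eq q
  have h3 := H.add_two_le_emax
  have h4 := H.mul_zpow_mem n (-3) hn (by omega) (by omega)
  convert h4 using 1
  norm_num
  ring

/-- Multiplication by `5 / 8` decreases the absolute value, even after rounding, of all floats but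
zero and the least positive one. -/
theorem nearest_five_eighths_lt {u : ℝ} (hu : u ∈ FinFloat p q) (ht : tiny p q < u) :
    (nearest p q (5 / 8 * u) : ℝ) < u := by
  have h0 := tiny_pos p q
  obtain ⟨n, k, hn, hk, hk', hnk, hnorm⟩ := H.exists_int hu
  have hkpos := two_zpow_pos k
  have hn0 : (0 : ℝ) < n := pos_of_mul_pos_left (hnk ▸ h0.trans ht) hkpos.le
  have hn0' : 0 < n := by exact_mod_cast hn0
  have hn2 : 2 ≤ n := by
    rcases hnorm with h | rfl
    · rw [abs_of_pos hn0'] at h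
      have h1 : (2 : ℤ) ^ 1 ≤ 2 ^ p := pow_le_pow_right₀ (by norm_num) H.one_le
      omega
    · have h1 : (1 : ℝ) * tiny p q < n * tiny p q := by rw [one_mul]; exact hnk ▸ ht
      have h2 : (1 : ℝ) < n := lt_of_mul_lt_mul_right h1 h0.le
      have : 1 < n := by exact_mod_cast h2
      omega
  have hn2' : (2 : ℝ) ≤ n := by exact_mod_cast hn2
  rw [abs_of_pos hn0'] at hn
  have hv := intCast_mul_zpow_mem (p := p) (q := q) (n - 1) k
    (by rw [abs_of_nonneg (by omega)]; omega) hk hk'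
  have h1 := (isNearest_nearest p q (5 / 8 * u)).2.1 _ hv
  by_contra hle
  push Not at hle
  have h2 : 3 / 8 * u ≤ |5 / 8 * u - (nearest p q (5 / 8 * u) : ℝ)| := by
    rw [abs_sub_comm]
    exact le_trans (by linarith) (le_abs_self _)
  have h3 : |5 / 8 * u - ((n - 1 : ℤ) : ℝ) * 2 ^ k| < 3 / 8 * u := by
    rw [hnk]
    push_cast
    rw [abs_lt]
    constructor <;> nlinarith
  linarith

variable {ρ : ℝ → ℝ} (hρ : SineLike p q ρ)
include hρ

theorem sineLike_exists (x : FinFloat p q) :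
    ∃ y : FinFloat p q, correctlyRounded p q ρ (.finite x) = .finite y ∧ |(y : ℝ)| ≤ |(x : ℝ)| := by
  have h0 := abs_le.mp (hρ.abs_le x)
  have hx : |(x : ℝ)| ∈ FinFloat p q := by
    rcases abs_choice (x : ℝ) with h | h <;> rw [h]
    exacts [x.2, neg_mem_finFloat x.2]
  obtain ⟨y, hy, h1, h2⟩ := H.exists_roundReal_eq (neg_mem_finFloat hx) hx h0.1 h0.2
  exact ⟨y, hy, abs_le.mpr ⟨h1, h2⟩⟩

theorem sineLike_neg {x y : FinFloat p q}
    (h : correctlyRounded p q ρ (.finite x) = .finite y) :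
    correctlyRounded p q ρ (.finite (negFloat x)) = .finite (negFloat y) := by
  have := H.roundReal_neg h
  rw [← hρ.odd] at this
  exact this

theorem sineLike_pos {x : FinFloat p q} (h1 : tiny p q ≤ x) (h2 : (x : ℝ) ≤ 2) :
    ∃ y : FinFloat p q, correctlyRounded p q ρ (.finite x) = .finite y ∧ tiny p q ≤ y ∧
      (y : ℝ) ≤ x := by
  have h3 := hρ.tiny_lt x h1 h2
  have h4 := (abs_le.mp (hρ.abs_le x)).2
  rw [abs_of_pos ((tiny_pos p q).trans_le h1)] at h4
  refine ⟨nearest p q (ρ x), ?_, H.tiny_le_nearest h3, nearest_le x.2 h4⟩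
  exact H.roundReal_eq_nearest (zero_mem_finFloat p q) x.2 (by linarith [tiny_pos p q]) h4

theorem sineLike_multTiny {k : ℤ} (hk : -1 ≤ k) (hk' : k ≤ 2) :
    correctlyRounded p q ρ (.finite (multTiny p q k)) = .finite (multTiny p q k) := by
  have h0 := tiny_pos p q
  have ht : tiny p q ≤ 2 := by
    have h1 := emin_eq q
    have h2 := H.seven_le_emax
    have := two_zpow_mono (j := emin q - p) (k := 1) (by omega)
    simpa [tiny] using this
  have h1 := hρ.tiny_lt _ le_rfl ht
  have h2 := (abs_le.mp (hρ.abs_le (tiny p q))).2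
  rw [abs_of_pos h0] at h2
  rw [correctlyRounded, H.coe_multTiny k (by rw [abs_lt]; omega)]
  refine H.roundReal_eq_multTiny (by rw [abs_lt]; omega) ?_
  obtain rfl | rfl | rfl | rfl : k = -1 ∨ k = 0 ∨ k = 1 ∨ k = 2 := by omega
  · have : ((-1 : ℤ) : ℝ) * tiny p q = -tiny p q := by simp
    rw [this, hρ.odd, abs_lt]
    constructor <;> linarith
  · have := abs_nonpos_iff.mp ((hρ.abs_le 0).trans_eq abs_zero)
    simp [this, h0]
  · rw [Int.cast_one, one_mul, abs_lt]
    constructor <;> linarith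
  · exact hρ.two_tiny

variable {D : Type*} {d : ℕ} {X : D → Fin d → FinFloat p q}

/-- The first hidden layer: the difference of a scaled coordinate and its value at a given point
vanishes at this point, and at each other one it is nonzero. -/
theorem sineLike_difference {i : Fin d} {w : FinFloat p q} {v : D → FinFloat p q}
    (hv : ∀ x, (ExtFloat.finite w).mul (.finite (X x i)) = .finite (v x))
    (hv' : ∀ x, |(v x : ℝ)| ≤ 2 ^ (emax q - 1)) {a b : D} (hab : v a ≠ v b)
    (ha : |(v a : ℝ)| ≤ 1) (hb : |(v b : ℝ)| ≤ 1) :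
    ∃ h, Reach (correctlyRounded p q ρ) X 0 h ∧ h a = zeroFloat p q ∧
      (tiny p q ≤ h b ∧ (h b : ℝ) ≤ 2 ∨ tiny p q ≤ -h b ∧ -(h b : ℝ) ≤ 2) := by
  have ht := tiny_pos p q
  have two : (2 : ℝ) ∈ FinFloat p q := by simpa using H.small_mem 2 (by norm_num)
  have hpre : ∀ x, affineOne w (negFloat (v a)) (.finite (X x i)) =
      roundReal p q ((v x : ℝ) - v a) := by
    intro x
    rw [affineOne, hv, finite_add_finite]
    rfl
  have hex : ∀ x, ∃ y : FinFloat p q, .finite y =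
      correctlyRounded p q ρ (affineOne w (negFloat (v a)) (.finite (X x i))) := by
    intro x
    have h1 := abs_le.mp (hv' x)
    have h2 := abs_le.mp (hv' a)
    have h3 := two_zpow_sub_one (emax q)
    obtain ⟨r, hr, -, -⟩ := H.exists_roundReal_eq (r := (v x : ℝ) - v a)
      (neg_mem_finFloat H.emax_mem) H.emax_mem (by linarith) (by linarith)
    obtain ⟨y, hy, -⟩ := H.sineLike_exists hρ r
    exact ⟨y, by rw [hpre, hr, hy]⟩
  choose h hh using hex
  have h1 := abs_le.mp ha
  have h2 := abs_le.mp hb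
  refine ⟨h, ⟨i, w, _, hh⟩, ?_, ?_⟩
  · have h3 := hh a
    rw [hpre, sub_self] at h3
    have h4 : roundReal p q 0 = .finite (zeroFloat p q) := H.roundReal_coe (zeroFloat p q)
    rw [h4, ← H.multTiny_zero, H.sineLike_multTiny hρ (by norm_num) (by norm_num)] at h3
    rw [ExtFloat.finite.inj h3, H.multTiny_zero]
  · rcases lt_or_gt_of_ne (fun h => hab (Subtype.ext h)) with hlt | hlt
    · left
      have h3 := H.add_tiny_le (v a).2 (v b).2 hlt
      obtain ⟨r, hr, hr1, hr2⟩ := H.exists_roundReal_eq (r := (v b : ℝ) - v a)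
        H.tiny_mem two (by linarith) (by linarith)
      obtain ⟨y, hy, hy1, hy2⟩ := H.sineLike_pos hρ hr1 hr2
      have h4 := hh b
      rw [hpre, hr, hy] at h4
      rw [ExtFloat.finite.inj h4]
      exact ⟨hy1, hy2.trans hr2⟩
    · right
      have h3 := H.add_tiny_le (v b).2 (v a).2 hlt
      obtain ⟨r, hr, hr1, hr2⟩ := H.exists_roundReal_eq (r := (v a : ℝ) - v b)
        H.tiny_mem two (by linarith) (by linarith)
      obtain ⟨y, hy, hy1, hy2⟩ := H.sineLike_pos hρ hr1 hr2
      have h4 := hh b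
      have h5 := H.roundReal_neg hr
      rw [neg_sub] at h5
      rw [hpre, h5] at h4
      have h6 := h4.trans (H.sineLike_neg hρ hy)
      rw [ExtFloat.finite.inj h6]
      simp only [negFloat, neg_neg]
      exact ⟨hy1, hy2.trans hr2⟩

/-- Floats are told apart either by their values, if both are in `[-1, 1]`, or after scaling by
`2 ^ emin`, which sends all inputs into this interval. -/
theorem sineLike_separate (hX : ∀ x i, |(X x i : ℝ)| ≤ 2 ^ (emax q - 1)) {a b : D} {i : Fin d}
    (hab : X a i ≠ X b i) :
    ∃ h, Reach (correctlyRounded p q ρ) X 0 h ∧ h a = zeroFloat p q ∧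
      (tiny p q ≤ h b ∧ (h b : ℝ) ≤ 2 ∨ tiny p q ≤ -h b ∧ -(h b : ℝ) ≤ 2) := by
  have one : (1 : ℝ) ∈ FinFloat p q := by simpa using H.small_mem 1 (by norm_num)
  have hem := emin_eq q
  have hM := H.seven_le_emax
  by_cases hsmall : |(X a i : ℝ)| ≤ 1 ∧ |(X b i : ℝ)| ≤ 1
  · refine H.sineLike_difference hρ (w := ⟨1, one⟩) (v := fun x => X x i) (i := i) (fun x => ?_)
      (fun x => hX x i) hab hsmall.1 hsmall.2
    rw [finite_mul_finite, one_mul, H.roundReal_coe]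
  · have wmem : (2 : ℝ) ^ emin q ∈ FinFloat p q := H.zpow_mem (by omega) (by omega)
    have wpos := two_zpow_pos (emin q)
    have hw : (2 : ℝ) ^ emin q * 2 ^ (emax q - 1) = 1 := by
      rw [two_zpow_mul, hem, show 1 - emax q + (emax q - 1) = 0 by ring, zpow_zero]
    have hex : ∀ x, ∃ y : FinFloat p q, (ExtFloat.finite ⟨2 ^ emin q, wmem⟩).mul
        (.finite (X x i)) = .finite y ∧ |(y : ℝ)| ≤ 1 := by
      intro x
      have h1 := abs_le.mp (hX x i)
      obtain ⟨y, hy, h2, h3⟩ := H.exists_roundReal_eq (r := 2 ^ emin q * (X x i : ℝ))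
        (neg_mem_finFloat one) one (by nlinarith) (by nlinarith)
      exact ⟨y, hy, abs_le.mpr ⟨h2, h3⟩⟩
    choose v hv hv1 using hex
    -- scaling is exact for `|x| ≥ 1`
    have exact : ∀ x, 1 ≤ |(X x i : ℝ)| → (v x : ℝ) = 2 ^ emin q * X x i := by
      intro x hx
      have h1 := H.mul_zpow_neg_mem_of_one_le_abs (X x i).2 hx (e := emax q - 1) (by omega) le_rfl
      rw [neg_sub, ← hem, mul_comm] at h1
      have h2 := (hv x).symm.trans (H.mul_of_mem h1)
      rw [ExtFloat.finite.inj h2]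
    have small : ∀ x, |(X x i : ℝ)| ≤ 1 → |(v x : ℝ)| ≤ 2 ^ emin q := by
      intro x hx
      have h1 := abs_le.mp hx
      obtain ⟨y, hy, h2, h3⟩ := H.exists_roundReal_eq (r := 2 ^ emin q * (X x i : ℝ))
        (neg_mem_finFloat wmem) wmem (by nlinarith) (by nlinarith)
      have h4 := (hv x).symm.trans hy
      rw [ExtFloat.finite.inj h4]
      exact abs_le.mpr ⟨h2, h3⟩
    have large : ∀ x, 1 < |(X x i : ℝ)| → 2 ^ emin q < |(v x : ℝ)| := by
      intro x hx
      rw [exact x hx.le, abs_mul, abs_of_pos wpos]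
      exact lt_mul_of_one_lt_right wpos hx
    refine H.sineLike_difference hρ hv (fun x => (hv1 x).trans
      (one_le_zpow₀ one_le_two (by omega))) (fun hvab => ?_) (hv1 a) (hv1 b)
    rcases le_or_gt |(X a i : ℝ)| 1 with ha | ha
    · rcases le_or_gt |(X b i : ℝ)| 1 with hb | hb
      · exact hsmall ⟨ha, hb⟩
      · have h1 := small a ha
        have h2 := large b hb
        rw [hvab] at h1
        linarith
    · rcases le_or_gt |(X b i : ℝ)| 1 with hb | hb
      · have h1 := small b hb
        have h2 := large a ha
        rw [hvab] at h2
        linarith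
      · have h1 := exact a ha.le
        rw [hvab, exact b hb.le] at h1
        exact hab (Subtype.ext (mul_left_cancel₀ wpos.ne' h1).symm)

/-- One layer with the weight `5 / 8` on positive values. -/
theorem sineLike_shrink_pos {u : FinFloat p q} (hu : 0 < (u : ℝ)) :
    ∃ y : FinFloat p q, .finite y = correctlyRounded p q ρ (affineOne
        ⟨((5 : ℤ) : ℝ) / 8, H.eighth_mem 5 (by norm_num)⟩ (zeroFloat p q) (.finite u)) ∧
      (tiny p q < u → |(y : ℝ)| < u) ∧ |(y : ℝ)| ≤ u ∧
      (tiny p q ≤ u → (u : ℝ) ≤ 2 → tiny p q ≤ y) := by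
  have ht := tiny_pos p q
  have hpre : affineOne ⟨((5 : ℤ) : ℝ) / 8, H.eighth_mem 5 (by norm_num)⟩ (zeroFloat p q)
      (.finite u) = .finite (nearest p q (5 / 8 * u)) := by
    rw [affineOne, H.add_zero, finite_mul_finite]
    push_cast
    exact H.roundReal_eq_nearest (zero_mem_finFloat p q) u.2 (by linarith) (by linarith)
  have h1 : (nearest p q (5 / 8 * u) : ℝ) ≤ u := nearest_le u.2 (by linarith)
  have h2 : 0 ≤ (nearest p q (5 / 8 * u) : ℝ) :=
    le_nearest (zero_mem_finFloat p q) (by linarith)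
  obtain ⟨y, hy, hy1⟩ := H.sineLike_exists hρ (nearest p q (5 / 8 * u))
  rw [abs_of_nonneg h2] at hy1
  refine ⟨y, by rw [hpre, hy], fun h => hy1.trans_lt (H.nearest_five_eighths_lt u.2 h),
    hy1.trans h1, fun h3 h4 => ?_⟩
  obtain ⟨y', hy', h5, -⟩ := H.sineLike_pos hρ (x := nearest p q (5 / 8 * u))
    (H.tiny_le_nearest (by linarith)) (h1.trans h4)
  rw [hy] at hy'
  rwa [ExtFloat.finite.inj hy']

theorem sineLike_shrink (u : FinFloat p q) :
    ∃ y : FinFloat p q, .finite y = correctlyRounded p q ρ (affineOne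
        ⟨((5 : ℤ) : ℝ) / 8, H.eighth_mem 5 (by norm_num)⟩ (zeroFloat p q) (.finite u)) ∧
      (tiny p q < |(u : ℝ)| → |(y : ℝ)| < |(u : ℝ)|) ∧ |(y : ℝ)| ≤ |(u : ℝ)| ∧
      (tiny p q ≤ u → (u : ℝ) ≤ 2 → tiny p q ≤ y ∧ (y : ℝ) ≤ 2) ∧
      (tiny p q ≤ -u → -(u : ℝ) ≤ 2 → tiny p q ≤ -y ∧ -(y : ℝ) ≤ 2) := by
  have ht := tiny_pos p q
  rcases lt_trichotomy (u : ℝ) 0 with hu | hu | hu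
  · obtain ⟨y, hy, h1, h2, h3⟩ := H.sineLike_shrink_pos hρ (u := negFloat u)
      (by simp only [negFloat]; linarith)
    have hpre : ∀ e, affineOne ⟨((5 : ℤ) : ℝ) / 8, H.eighth_mem 5 (by norm_num)⟩ (zeroFloat p q)
        (.finite (negFloat u)) = .finite e → affineOne
          ⟨((5 : ℤ) : ℝ) / 8, H.eighth_mem 5 (by norm_num)⟩ (zeroFloat p q) (.finite u) =
          .finite (negFloat e) := by
      intro e he
      rw [affineOne, H.add_zero, finite_mul_finite] at he ⊢
      have := H.roundReal_neg he
      simpa [negFloat] using this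
    obtain ⟨e, he, -, -⟩ := H.exists_roundReal_eq (r := ((5 : ℤ) : ℝ) / 8 * (negFloat u : ℝ))
      (zero_mem_finFloat p q) (negFloat u).2 (by simp only [negFloat]; push_cast; linarith)
      (by simp only [negFloat]; push_cast; linarith)
    have he' : affineOne ⟨((5 : ℤ) : ℝ) / 8, H.eighth_mem 5 (by norm_num)⟩ (zeroFloat p q)
        (.finite (negFloat u)) = .finite e := by
      rw [affineOne, H.add_zero, finite_mul_finite, he]
    refine ⟨negFloat y, ?_, ?_⟩
    · rw [hpre e he']
      exact (H.sineLike_neg hρ (by rw [← he', ← hy])).symm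
    · simp only [negFloat] at h1 h2 h3 ⊢
      rw [abs_neg, abs_of_neg hu]
      refine ⟨h1, h2, fun h => by linarith, fun h4 h5 => ⟨?_, ?_⟩⟩
      · rw [neg_neg]; exact h3 h4 h5
      · rw [neg_neg]; exact (le_abs_self _).trans (h2.trans h5)
  · have hu' : u = multTiny p q 0 := by
      rw [H.multTiny_zero]; exact Subtype.ext hu
    refine ⟨multTiny p q 0, ?_, ?_⟩
    · have h1 := H.affineOne_multTiny (w := ⟨((5 : ℤ) : ℝ) / 8, H.eighth_mem 5 (by norm_num)⟩)
        (k := 0) (j := 0) (m := 0) (by norm_num) (by norm_num) (by norm_num) (by norm_num)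
        (by norm_num)
      rw [H.multTiny_zero, _root_.add_zero, H.multTiny_zero] at h1
      rw [hu', H.multTiny_zero, h1, ← H.multTiny_zero,
        H.sineLike_multTiny hρ (by norm_num) (by norm_num)]
    · rw [H.multTiny_zero, hu]
      simp only [zeroFloat, abs_zero, neg_zero]
      exact ⟨fun h => by linarith, le_rfl, fun h => by linarith, fun h => by linarith⟩
  · obtain ⟨y, hy, h1, h2, h3⟩ := H.sineLike_shrink_pos hρ hu
    rw [abs_of_pos hu]
    exact ⟨y, hy, h1, h2, fun h4 h5 => ⟨h3 h4 h5, (le_abs_self _).trans (h2.trans h5)⟩,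
      fun h => by linarith⟩

/-- Iterated multiplication by `5 / 8` leaves only the sign of a float, times the least positive
float. -/
theorem sineLike_sign (N : ℕ) : ∀ {l : ℕ} {h : D → FinFloat p q},
    Reach (correctlyRounded p q ρ) X l h → (∀ x, |(h x : ℝ)| ≤ (N + 1) * tiny p q) →
    ∃ h', Reach (correctlyRounded p q ρ) X (l + N) h' ∧ ∀ x, |(h' x : ℝ)| ≤ tiny p q ∧
      (|(h x : ℝ)| = 0 → |(h' x : ℝ)| = 0) ∧ (tiny p q ≤ h x ∧ (h x : ℝ) ≤ 2 → tiny p q ≤ h' x) ∧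
      (tiny p q ≤ -h x ∧ -(h x : ℝ) ≤ 2 → tiny p q ≤ -h' x) := by
  induction N with
  | zero =>
    intro l h hh hb
    exact ⟨h, hh, fun x => ⟨by simpa using hb x, fun h => h, fun h => h.1, fun h => h.1⟩⟩
  | succ N ih =>
    intro l h hh hb
    choose s hs h1 h2 h3 h4 using fun x => H.sineLike_shrink hρ (h x)
    have ht := tiny_pos p q
    obtain ⟨h', r', e'⟩ := ih (H.reach_of_affineOne hh _ _ hs) (fun x => by
      rcases le_or_gt |(h x : ℝ)| (tiny p q) with hx | hx
      · have := h2 x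
        have hN : (0 : ℝ) ≤ N * tiny p q := by positivity
        linarith
      · have h5 := h1 x hx
        have abs_mem : ∀ y : FinFloat p q, |(y : ℝ)| ∈ FinFloat p q := by
          intro y
          rcases abs_choice (y : ℝ) with h | h <;> rw [h]
          exacts [y.2, neg_mem_finFloat y.2]
        have h6 := H.add_tiny_le (abs_mem _) (abs_mem _) h5
        have h7 := hb x
        push_cast at h7
        linarith)
    refine ⟨h', by rwa [show l + (N + 1) = l + 1 + N by ring], fun x => ?_⟩
    obtain ⟨a1, a2, a3, a4⟩ := e' x
    refine ⟨a1, fun hx => a2 (le_antisymm ((h2 x).trans_eq hx) (abs_nonneg _)),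
      fun hx => a3 (h3 x hx.1 hx.2), fun hx => a4 (h4 x hx.1 hx.2)⟩

end Admissible

/-- The predicate `P` is computed in layer `l`, with the least positive float as the value of
true and zero as the value of false. -/
def TinyEncodes {D : Type*} {d : ℕ} (σ : ExtFloat p q → ExtFloat p q)
    (X : D → Fin d → FinFloat p q) (l : ℕ) (P : D → Prop) : Prop :=
  ∃ k : D → ℤ, Reach σ X l (fun x => multTiny p q (k x)) ∧
    ∀ x, (P x → k x = 1) ∧ (¬ P x → k x = 0)

namespace Admissible

variable (H : Admissible p q)
include H

variable {ρ : ℝ → ℝ} (hρ : SineLike p q ρ)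
include hρ

variable {D : Type*} {d : ℕ} {X : D → Fin d → FinFloat p q}

/-- A layer acting on small multiples of the least positive float. -/
theorem sineLike_multTiny_layer {l : ℕ} {k j : D → ℤ} (n m : ℤ)
    (hr : Reach (correctlyRounded p q ρ) X l (fun x => multTiny p q (k x)))
    (hn : |n| < 8) (hm : |m| < 8) (hk : ∀ x, -1 ≤ k x ∧ k x ≤ 2)
    (hj : ∀ x, -1 ≤ j x + m ∧ j x + m ≤ 2 ∧ |j x| < 8)
    (h : ∀ x, |(n : ℝ) / 8 * k x - j x| < 1 / 2) :
    Reach (correctlyRounded p q ρ) X (l + 1) (fun x => multTiny p q (j x + m)) := by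
  refine H.reach_of_affineOne hr ⟨(n : ℝ) / 8, H.eighth_mem n hn⟩ (multTiny p q m) fun x => ?_
  obtain ⟨h1, h2⟩ := hk x
  obtain ⟨h3, h4, h5⟩ := hj x
  rw [H.affineOne_multTiny (by rw [abs_lt]; omega) h5 hm (by rw [abs_lt]; omega) (h x),
    H.sineLike_multTiny hρ h3 h4]

/-- The nor-gate: the weight `-5 / 8` sends both `1` and `2`, as multiples of the least positive
float, to `-1`, and a bias is added. -/
theorem sineLike_nor {l : ℕ} {P Q : D → Prop} (hP : TinyEncodes (correctlyRounded p q ρ) X l P)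
    (hQ : TinyEncodes (correctlyRounded p q ρ) X l Q) :
    TinyEncodes (correctlyRounded p q ρ) X (l + 2) (fun x => ¬ (P x ∨ Q x)) := by
  classical
  obtain ⟨k₁, r₁, e₁⟩ := hP
  obtain ⟨k₂, r₂, e₂⟩ := hQ
  have c₁ : ∀ x, k₁ x = 0 ∨ k₁ x = 1 := fun x => by
    by_cases hx : P x
    exacts [Or.inr ((e₁ x).1 hx), Or.inl ((e₁ x).2 hx)]
  have c₂ : ∀ x, k₂ x = 0 ∨ k₂ x = 1 := fun x => by
    by_cases hx : Q x
    exacts [Or.inr ((e₂ x).1 hx), Or.inl ((e₂ x).2 hx)]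
  have one : (1 : ℝ) ∈ FinFloat p q := by simpa using H.small_mem 1 (by norm_num)
  have one_mul' : ∀ k : ℤ, (ExtFloat.finite (⟨1, one⟩ : FinFloat p q)).mul
      (.finite (multTiny p q k)) = .finite (multTiny p q k) := by
    intro k
    rw [finite_mul_finite, one_mul, H.roundReal_coe]
  have r : Reach (correctlyRounded p q ρ) X (l + 1) (fun x => multTiny p q (k₁ x + k₂ x)) := by
    refine ⟨_, _, r₁, r₂, ⟨1, one⟩, ⟨1, one⟩, zeroFloat p q, fun x => ?_⟩
    have h1 : |k₁ x| < 8 ∧ |k₂ x| < 8 ∧ |k₁ x + k₂ x| < 8 ∧ -1 ≤ k₁ x + k₂ x ∧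
        k₁ x + k₂ x ≤ 2 := by
      rcases c₁ x with h | h <;> rcases c₂ x with h' | h' <;> rw [h, h'] <;> norm_num
    have h2 := H.mul_tiny_mem _ h1.2.2.1
    push_cast at h2
    rw [add_mul, ← H.coe_multTiny _ h1.1, ← H.coe_multTiny _ h1.2.1] at h2
    have h3 : (⟨_, h2⟩ : FinFloat p q) = multTiny p q (k₁ x + k₂ x) := Subtype.ext (by
      change (multTiny p q (k₁ x) : ℝ) + multTiny p q (k₂ x) = _
      rw [H.coe_multTiny _ h1.1, H.coe_multTiny _ h1.2.1, H.coe_multTiny _ h1.2.2.1]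
      push_cast
      ring)
    rw [affineTwo, H.add_zero, one_mul', one_mul', H.add_of_mem h2, h3,
      H.sineLike_multTiny hρ h1.2.2.2.1 h1.2.2.2.2]
  refine ⟨_, H.sineLike_multTiny_layer hρ (j := fun x => if P x ∨ Q x then -1 else 0) (-5) 1 r
    (by norm_num) (by norm_num) (fun x => ?_) (fun x => ?_) (fun x => ?_), fun x => ?_⟩
  · rcases c₁ x with h | h <;> rcases c₂ x with h' | h' <;> rw [h, h'] <;> norm_num
  · split_ifs <;> norm_num
  · by_cases hPx : P x <;> by_cases hQx : Q x
    · rw [if_pos (Or.inl hPx), (e₁ x).1 hPx, (e₂ x).1 hQx, abs_lt]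
      norm_num
    · rw [if_pos (Or.inl hPx), (e₁ x).1 hPx, (e₂ x).2 hQx, abs_lt]
      norm_num
    · rw [if_pos (Or.inr hQx), (e₁ x).2 hPx, (e₂ x).1 hQx, abs_lt]
      norm_num
    · rw [if_neg (by tauto), (e₁ x).2 hPx, (e₂ x).2 hQx, abs_lt]
      norm_num
  · beta_reduce
    exact ⟨fun h => by rw [if_neg h]; norm_num, fun h => by rw [if_pos (not_not.mp h)]; norm_num⟩

/-- Two layers that detect one of the two signs: the weight `± 7 / 8` keeps `-1`, `0` and `1`, up to
the sign, and after a bias is added, the weight `3 / 8` sends `0` and `1` to `0` and `2` to `1`. -/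
theorem sineLike_encodes_sign {l : ℕ} {k : D → ℤ}
    (hr : Reach (correctlyRounded p q ρ) X l (fun x => multTiny p q (k x)))
    (hk : ∀ x, k x = -1 ∨ k x = 0 ∨ k x = 1) (s : ℤ) (hs : s = 1 ∨ s = -1) :
    TinyEncodes (correctlyRounded p q ρ) X (l + 2) (fun x => k x = s) := by
  classical
  have hsk : ∀ x, (s * k x = -1 ∨ s * k x = 0 ∨ s * k x = 1) := fun x => by
    rcases hs with rfl | rfl <;> rcases hk x with h | h | h <;> rw [h] <;> norm_num
  have r := H.sineLike_multTiny_layer hρ (j := fun x => s * k x)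
    (s * 7) 1 hr (by rcases hs with rfl | rfl <;> norm_num) (by norm_num)
    (fun x => by rcases hk x with h | h | h <;> rw [h] <;> norm_num)
    (fun x => by rcases hsk x with h | h | h <;> simp only [h] <;> norm_num)
    (fun x => by
      push_cast
      have : (s : ℝ) * 7 / 8 * k x - s * k x = -1 / 8 * ((s * k x : ℤ) : ℝ) := by
        push_cast
        ring
      rw [this, abs_lt]
      rcases hsk x with h | h | h <;> rw [h] <;> norm_num)
  refine ⟨_, H.sineLike_multTiny_layer hρ (j := fun x => if k x = s then 1 else 0) 3 0 r
    (by norm_num) (by norm_num) (fun x => by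
      rcases hsk x with h | h | h <;> simp only [h] <;> norm_num)
    (fun x => by split_ifs <;> norm_num) (fun x => ?_), fun x => ?_⟩
  · have h1 : ((s * k x + 1 : ℤ) : ℝ) = ((s * k x : ℤ) : ℝ) + 1 := by push_cast; ring
    rw [h1]
    by_cases hx : k x = s
    · rw [if_pos hx, hx]
      rcases hs with rfl | rfl <;> norm_num [abs_lt]
    · rw [if_neg hx]
      have h2 : s * k x = -1 ∨ s * k x = 0 := by
        rcases hsk x with h | h | h
        · exact Or.inl h
        · exact Or.inr h
        · exfalso
          apply hx
          rcases hs with rfl | rfl <;> omega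
      rcases h2 with h | h <;> rw [h, abs_lt] <;> norm_num
  · exact ⟨fun h => by rw [if_pos h]; norm_num, fun h => by rw [if_neg h]; norm_num⟩

open Classical in
/-- Two layers turn the least positive float into `1`, and keep zero. In between its value is
`2 ^ (1 - p)`. -/
theorem sineLike_delta {l : ℕ} {P : D → Prop}
    (hP : TinyEncodes (correctlyRounded p q ρ) X l P) (hm : (2 : ℝ) ^ (0 : ℤ) ∈ FinFloat p q) :
    Reach (correctlyRounded p q ρ) X (l + 2)
      (fun x => if P x then ⟨2 ^ (0 : ℤ), hm⟩ else zeroFloat p q) := by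
  obtain ⟨k, r, e⟩ := hP
  obtain ⟨hz, hpow⟩ := hρ.zpow
  obtain ⟨n, hm1, hn, hone⟩ := hρ.one
  have hem := emin_eq q
  have hM := H.add_two_le_emax
  have hzero : correctlyRounded p q ρ (.finite (zeroFloat p q)) = .finite (zeroFloat p q) := by
    have := H.sineLike_multTiny hρ (k := 0) (by norm_num) (by norm_num)
    rwa [H.multTiny_zero] at this
  have r1 : Reach (correctlyRounded p q ρ) X (l + 1)
      (fun x => if P x then ⟨2 ^ (1 - (p : ℤ)), hz⟩ else zeroFloat p q) := by
    refine H.reach_of_affineOne r ⟨2 ^ emax q, H.emax_mem⟩ (zeroFloat p q) fun x => ?_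
    rw [affineOne, H.add_zero]
    by_cases hx : P x
    · rw [if_pos hx, (e x).1 hx, finite_mul_finite, H.coe_multTiny 1 (by norm_num)]
      have h1 : (2 : ℝ) ^ emax q * (((1 : ℤ) : ℝ) * tiny p q) = 2 ^ (1 - (p : ℤ)) := by
        rw [Int.cast_one, one_mul, tiny, two_zpow_mul, hem]
        congr 1
        ring
      simp only [h1]
      rw [H.roundReal_of_mem hz]
      exact hpow.symm
    · rw [if_neg hx, (e x).2 hx, H.multTiny_zero, H.mul_zero, hzero]
  refine H.reach_of_affineOne r1
    ⟨n * 2 ^ (-1 : ℤ), intCast_mul_zpow_mem n (-1) hn (by omega) (by omega)⟩ (zeroFloat p q)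
    fun x => ?_
  rw [affineOne, H.add_zero]
  by_cases hx : P x
  · have h1 : (n : ℝ) * 2 ^ (-1 : ℤ) * 2 ^ (1 - (p : ℤ)) = n * 2 ^ (-(p : ℤ)) := by
      rw [mul_assoc, two_zpow_mul]
      congr 2
      ring
    have h2 := intCast_mul_zpow_mem (p := p) (q := q) n (-p) hn (by omega) (by omega)
    simp only [if_pos hx]
    rw [finite_mul_finite]
    simp only [h1]
    rw [H.roundReal_of_mem h2]
    refine Eq.trans ?_ hone.symm
    simp only [zpow_zero]
  · rw [if_neg hx, if_neg hx, H.mul_zero, hzero]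

/-- Networks with sine-like activation functions compute all functions on sets of bounded inputs. -/
theorem exists_network_of_sineLike [Finite D] [Nontrivial D] (S : ReductionOrder) (hd : 0 < d)
    (hX : ∀ x i, |(X x i : ℝ)| ≤ 2 ^ (emax q - 1)) (hinj : Function.Injective X)
    (f : D → {y : ExtFloat p q // y ≠ .nan}) :
    ∃ N : Network p q d 1, ∀ x,
      N.eval S (correctlyRounded p q ρ) (fun i => .finite (X x i)) 0 = (f x).1 := by
  have := Fintype.ofFinite D
  have ht := tiny_pos p q
  obtain ⟨n, hn⟩ := exists_nat_ge (maxFloat p q / tiny p q)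
  rw [div_le_iff₀ ht] at hn
  obtain ⟨l, hl⟩ := exists_forall_ne_mem
    (fun l P => TinyEncodes (correctlyRounded p q ρ) X (0 + n + 2 + 2 * l) P)
    (fun l P Q hP hQ => H.sineLike_nor hρ hP hQ) (by
      intro x y hxy
      obtain ⟨i, hi⟩ : ∃ i, X x i ≠ X y i := by
        by_contra hne
        push Not at hne
        exact hxy (hinj (funext hne))
      obtain ⟨h, r, h0, h1⟩ := H.sineLike_separate hρ hX hi
      obtain ⟨h', r', e'⟩ := H.sineLike_sign hρ n r (fun x => by
        have := H.abs_le_maxFloat (h x).2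
        linarith)
      have hk : ∀ x, ∃ k : ℤ, h' x = multTiny p q k ∧ (k = -1 ∨ k = 0 ∨ k = 1) := by
        intro x
        obtain ⟨k, hk⟩ := H.exists_eq_mul_tiny (h' x).2
        have h2 := (e' x).1
        rw [hk, abs_mul, abs_of_pos ht] at h2
        have h3 : |(k : ℝ)| ≤ 1 := le_of_mul_le_mul_right (by linarith) ht
        have h4 : |k| ≤ 1 := by exact_mod_cast h3
        rw [_root_.abs_le] at h4
        exact ⟨k, Subtype.ext (by rw [hk, H.coe_multTiny k (by rw [abs_lt]; omega)]), by omega⟩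
      choose k hk1 hk2 using hk
      have hval : ∀ x, (h' x : ℝ) = k x * tiny p q := fun x => by
        rw [hk1, H.coe_multTiny]
        rcases hk2 x with h | h | h <;> rw [h] <;> norm_num
      have r'' : Reach (correctlyRounded p q ρ) X (0 + n) (fun x => multTiny p q (k x)) := by
        have : h' = fun x => multTiny p q (k x) := funext hk1
        rwa [← this]
      have hx : k x = 0 := by
        have h2 := (e' x).2.1 (by rw [h0]; simp [zeroFloat])
        rw [hval, abs_eq_zero, mul_eq_zero] at h2
        exact_mod_cast h2.resolve_right ht.ne'
      rcases h1 with h1 | h1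
      · have h2 := (e' y).2.2.1 h1
        rw [hval] at h2
        refine ⟨_, H.sineLike_encodes_sign hρ r'' hk2 1 (Or.inl rfl), by omega, ?_⟩
        rcases hk2 y with h | h | h
        · rw [h] at h2; push_cast at h2; linarith
        · rw [h] at h2; push_cast at h2; linarith
        · exact h
      · have h2 := (e' y).2.2.2 h1
        rw [hval] at h2
        refine ⟨_, H.sineLike_encodes_sign hρ r'' hk2 (-1) (Or.inr rfl), by omega, ?_⟩
        rcases hk2 y with h | h | h
        · exact h
        · rw [h] at h2; push_cast at h2; linarith
        · rw [h] at h2; push_cast at h2; linarith)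
  have hm : (2 : ℝ) ^ (0 : ℤ) ∈ FinFloat p q := by simpa using H.small_mem 1 (by norm_num)
  have hM := H.seven_le_emax
  have key : ∀ z, Reach (correctlyRounded p q ρ) X (0 + n + 2 + 2 * l + 2 + 2)
      (fun x => open Classical in if x = z then ⟨2 ^ (0 : ℤ), hm⟩ else zeroFloat p q) := by
    intro z
    have h1 := H.sineLike_nor hρ (hl z) (hl z)
    simp only [ne_eq, or_self, not_not] at h1
    exact H.sineLike_delta hρ h1 hm
  exact H.exists_network_of_reach_delta S hd f (e₁ := 0) (e₂ := 0) (by omega) le_rfl le_rfl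
    (by omega) hm hm _ key key

end Admissible

/-! ### Powers of two as values of activation functions -/

namespace Admissible

variable (H : Admissible p q)
include H

/-- Functions that are linear on the positive half-line, with a slope in `[1, 5 / 4)`, take the
value `1` after rounding. -/
theorem hitsPow_zero_of_linear {ρ : ℝ → ℝ} {lam : ℝ} (h1 : 1 ≤ lam) (h2 : lam < 5 / 4)
    (hρ : ∀ t, 0 < t → ρ t = lam * t) : HitsPow p q ρ 0 := by
  have hem := emin_eq q
  have hM := H.add_two_le_emax
  have hpos : 0 < lam := by linarith
  have hP : (1 : ℝ) ≤ 2 ^ (p + 1) := one_le_pow₀ (by norm_num)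
  set n : ℤ := ⌊((2 : ℝ) ^ (p + 1) + 3 / 4) / lam⌋ with hn
  -- the multiples of `lam` are closer to each other than the length of the interval that is
  -- rounded to the power of two
  have n1 : (n : ℝ) * lam ≤ 2 ^ (p + 1) + 3 / 4 := (le_div_iff₀ hpos).mp (Int.floor_le _)
  have n2 : (2 : ℝ) ^ (p + 1) + 3 / 4 < (n + 1) * lam :=
    (div_lt_iff₀ hpos).mp (Int.lt_floor_add_one _)
  have n3 : (0 : ℝ) < n := by
    by_contra h
    push Not at h
    nlinarith
  have n3' : 0 < n := by exact_mod_cast n3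
  have n4 : n ≤ 2 ^ (p + 1) := by
    have h4 : (n : ℝ) < 2 ^ (p + 1) + 1 := by nlinarith
    have h5 : n < 2 ^ (p + 1) + 1 := by exact_mod_cast h4
    omega
  have n4' : (n : ℝ) ≤ 2 ^ (p + 1) := by exact_mod_cast n4
  have hu : (2 : ℝ) ^ (p + 1) * 2 ^ (-(p : ℤ) - 1) = 1 := by
    rw [← zpow_natCast, two_zpow_mul]
    push_cast
    rw [show (p : ℤ) + 1 + (-(p : ℤ) - 1) = 0 by ring, zpow_zero]
  have one : (2 : ℝ) ^ (0 : ℤ) ∈ FinFloat p q := by simpa using H.small_mem 1 (by norm_num)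
  have upos := two_zpow_pos (-(p : ℤ) - 1)
  have hmem : (n : ℝ) * 2 ^ (-(p : ℤ) - 1) ∈ FinFloat p q := by
    rcases n4.lt_or_eq with h | h
    · exact intCast_mul_zpow_mem n _ (by rwa [abs_of_pos n3']) (by omega) (by omega)
    · rw [h]
      push_cast
      rw [hu]
      simpa using one
  refine ⟨⟨_, hmem⟩, ⟨_, hmem⟩, one, by simp, ?_, ?_⟩
  · rw [abs_of_pos (mul_pos n3 upos)]
    nlinarith
  · refine H.roundReal_eq_zpow (by omega) one ?_ ?_
    · rw [hρ _ (mul_pos n3 upos), zpow_zero, show (0 : ℤ) - p - 2 = -(p : ℤ) - 1 - 1 by ring,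
        two_zpow_sub_one]
      nlinarith
    · rw [hρ _ (mul_pos n3 upos), zpow_zero, show (0 : ℤ) - p - 1 = -(p : ℤ) - 1 by ring]
      nlinarith

/-- The argument is `n` times the least positive float, where the spacing of floats does not depend
on their size. -/
theorem hitsPow_neg_emax {ρ : ℝ → ℝ} (n : ℤ) (h0 : 0 < n) (hn : n ≤ 2 ^ p)
    (h : |ρ (n * tiny p q) - 2 ^ (-emax q)| < tiny p q / 2) : HitsPow p q ρ (-emax q) := by
  have hem := emin_eq q
  have hM := H.add_two_le_emax
  have hp := H.two_le
  have hn0 : (0 : ℝ) < n := by exact_mod_cast h0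
  have hn' : (n : ℝ) ≤ 2 ^ p := by exact_mod_cast hn
  have habs : |n| < 2 ^ (p + 1) := by
    rw [abs_of_pos h0, pow_succ]
    have : (0 : ℤ) < 2 ^ p := by positivity
    omega
  refine ⟨⟨n * 2 ^ (1 - (p : ℤ)), intCast_mul_zpow_mem n _ habs (by omega) (by omega)⟩,
    ⟨n * tiny p q, intCast_mul_zpow_mem n _ habs le_rfl (by omega)⟩,
    H.zpow_mem (by omega) (by omega), ?_, ?_, H.roundReal_eq_of_abs_lt _ h⟩
  · simp only
    rw [mul_assoc, two_zpow_mul, tiny, hem]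
    congr 2
    ring
  · simp only
    rw [abs_of_pos (mul_pos hn0 (two_zpow_pos _))]
    calc (n : ℝ) * 2 ^ (1 - (p : ℤ)) ≤ 2 ^ p * 2 ^ (1 - (p : ℤ)) :=
          mul_le_mul_of_nonneg_right hn' (two_zpow_pos _).le
      _ = 2 := by
        rw [← zpow_natCast, two_zpow_mul, show (p : ℤ) + (1 - p) = 1 by ring, zpow_one]

theorem hitsPow_emax_sub_one {ρ : ℝ → ℝ}
    (h1 : 2 ^ (emax q - 1) - 2 ^ (emax q - 1) * 2 ^ (-(p : ℤ) - 2) < ρ (2 ^ (emax q - 1)))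
    (h2 : ρ (2 ^ (emax q - 1)) ≤ 2 ^ (emax q - 1)) : HitsPow p q ρ (emax q - 1) := by
  have hem := emin_eq q
  have hM := H.add_two_le_emax
  have hm := H.zpow_mem (k := emax q - 1) (by omega) (by omega)
  refine ⟨⟨1, by simpa using H.small_mem 1 (by norm_num)⟩, ⟨_, hm⟩, hm, by simp, by simp,
    H.roundReal_eq_zpow (by omega) hm ?_ ?_⟩
  · rwa [two_zpow_mul, show emax q - 1 + (-(p : ℤ) - 2) = emax q - 1 - p - 2 by ring] at h1
  · exact h2.trans_lt (lt_add_of_pos_right _ (two_zpow_pos _))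

end Admissible

/-! ### Piecewise linear and exponential units -/

theorem reluLike_relu : ReluLike relu where
  zero := by simp [relu]
  half_lt t ht := by rw [relu, max_eq_right ht.le]; linarith
  le_mul t ht := by rw [relu, max_eq_right ht.le]; linarith
  neg_two_le t ht := by rw [relu, max_eq_left ht]; norm_num
  nonpos t ht := by rw [relu, max_eq_left ht]
  tendsto := by
    refine ⟨0, tendsto_const_nhds.congr' ?_⟩
    filter_upwards [Filter.eventually_le_atBot 0] with t ht
    rw [relu, max_eq_left ht]

theorem reluLike_selu {α lam : ℝ} (hlam1 : 1 ≤ lam) (hlam2 : lam < 5 / 4) (hα : 0 ≤ α)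
    (hαlam : lam * α ≤ 2) : ReluLike (selu α lam) where
  zero := by simp [selu]
  half_lt t ht := by rw [selu, if_pos ht]; nlinarith
  le_mul t ht := by rw [selu, if_pos ht]; nlinarith
  neg_two_le t ht := by
    rw [selu, if_neg (not_lt.mpr ht)]
    have h1 := Real.exp_pos t
    have h2 : 0 ≤ lam * α := by positivity
    nlinarith
  nonpos t ht := by
    rw [selu, if_neg (not_lt.mpr ht)]
    have h1 : Real.exp t ≤ 1 := Real.exp_le_one_iff.mpr ht
    have h2 : 0 ≤ lam * α := by positivity
    nlinarith
  tendsto := by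
    refine ⟨lam * (α * (0 - 1)), Filter.Tendsto.congr' ?_
      (((Real.tendsto_exp_atBot.sub_const 1).const_mul α).const_mul lam)⟩
    filter_upwards [Filter.eventually_le_atBot 0] with t ht
    rw [selu, if_neg (not_lt.mpr ht)]

theorem elu_eq_selu : elu = selu 1 1 := by
  funext t
  unfold elu selu
  rcases lt_trichotomy t 0 with h | rfl | h
  · rw [if_neg (not_le.mpr h), if_neg (not_lt.mpr h.le)]
    ring
  · simp
  · rw [if_pos h.le, if_pos h]
    ring

/-! ### Gated units -/

/-- Gates `g` for activation functions `t ↦ t * g t`: functions with values in `[0, 1]`, above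
`1 / 2` on the positive half-line, that tend to `0` and `1` at `∓∞` at an exponential rate. -/
structure Gate (g : ℝ → ℝ) : Prop where
  nonneg : ∀ t, 0 ≤ g t
  le_one : ∀ t, g t ≤ 1
  half_lt : ∀ t, 0 < t → 1 / 2 < g t
  left : ∀ s, 2 ≤ s → g (-s) ≤ Real.exp (-s / 2)
  right : ∀ s, 2 ≤ s → 1 - g s ≤ Real.exp (-s / 2)

theorem mul_exp_neg_half_le (s : ℝ) : s * Real.exp (-s / 2) ≤ 2 := by
  have h1 := Real.add_one_le_exp (s / 2)
  rw [neg_div, Real.exp_neg, ← div_eq_mul_inv, div_le_iff₀ (Real.exp_pos _)]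
  linarith

theorem Gate.reluLike {g : ℝ → ℝ} (hg : Gate g) : ReluLike (fun t => t * g t) where
  zero := by simp
  half_lt t ht := by
    have := hg.half_lt t ht
    nlinarith
  le_mul t ht := by
    have := hg.le_one t
    nlinarith
  neg_two_le t ht := by
    have h0 := hg.nonneg t
    rcases le_or_gt (-2) t with h | h
    · have := hg.le_one t
      nlinarith
    · have h1 := hg.left (-t) (by linarith)
      have h2 := mul_exp_neg_half_le (-t)
      rw [neg_neg] at h1 h2
      have h3 : -t * g t ≤ -t * Real.exp (t / 2) := mul_le_mul_of_nonneg_left h1 (by linarith)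
      linarith
  nonpos t ht := mul_nonpos_of_nonpos_of_nonneg ht (hg.nonneg t)
  tendsto := by
    refine ⟨0, ?_⟩
    have h1 : Filter.Tendsto (fun t : ℝ => -(2 * ((-t / 2) ^ 1 * Real.exp (-(-t / 2)))))
        Filter.atBot (nhds (-(2 * 0))) := by
      refine Filter.Tendsto.neg (Filter.Tendsto.const_mul 2 ?_)
      refine (Real.tendsto_pow_mul_exp_neg_atTop_nhds_zero 1).comp ?_
      exact (Filter.tendsto_neg_atBot_atTop).atTop_div_const two_pos
    rw [mul_zero, neg_zero] at h1
    refine tendsto_of_tendsto_of_tendsto_of_le_of_le' h1 tendsto_const_nhds ?_ ?_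
    · filter_upwards [Filter.eventually_le_atBot (-2)] with t ht
      have h1 := hg.left (-t) (by linarith)
      rw [neg_neg] at h1
      rw [show -(-t / 2) = t / 2 by ring]
      have h3 : -t * g t ≤ -t * Real.exp (t / 2) := mul_le_mul_of_nonneg_left h1 (by linarith)
      linarith
    · filter_upwards [Filter.eventually_le_atBot 0] with t ht
      exact mul_nonpos_of_nonpos_of_nonneg ht (hg.nonneg t)

namespace Admissible

variable (H : Admissible p q)
include H

theorem hitsPow_emax_of_gate {g : ℝ → ℝ} (hg : Gate g) :
    HitsPow p q (fun t => t * g t) (emax q - 1) := by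
  have hM7 := H.seven_le_emax
  have hM := H.add_two_le_emax
  set c : ℝ := 2 ^ (emax q - 1) with hc
  have c64 : (64 : ℝ) ≤ c := by
    have h := two_zpow_mono (j := 6) (k := emax q - 1) (by omega)
    norm_num at h
    exact h
  have hexp : Real.exp (-c / 2) < 2 ^ (-(p : ℤ) - 2) := by
    have h1 : (2 : ℝ) ^ (-(emax q)) ≤ 2 ^ (-(p : ℤ) - 2) := two_zpow_mono (by omega)
    have h2 : (2 : ℝ) ^ emax q = c * 2 := by rw [← two_zpow_add_one]; congr 1; ring
    have h3 : c * 2 < Real.exp (c / 2) := by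
      have h4 := Real.add_one_le_exp (c / 4)
      have h5 : Real.exp (c / 2) = Real.exp (c / 4) * Real.exp (c / 4) := by
        rw [← Real.exp_add]
        congr 1
        ring
      rw [h5]
      nlinarith
    refine lt_of_lt_of_le ?_ h1
    rw [zpow_neg, neg_div, Real.exp_neg, h2]
    exact inv_strictAnti₀ (by linarith) h3
  have h1 := hg.right c (by linarith)
  have h2 := hg.le_one c
  exact H.hitsPow_emax_sub_one (by nlinarith) (by nlinarith)

/-- At small arguments `t * g t` is close to `g₀ * t`. The power `2 ^ (-emax)` is the multiple
`2 ^ (p - 1)` of the least positive float, and it is attained at the multiple `n` if `g₀ * n` is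
close to `2 ^ (p - 1)`. -/
theorem hitsPow_neg_emax_of_gate {g : ℝ → ℝ} {g₀ : ℝ}
    (h : ∀ c, 0 < c → c ≤ 1 / 8 → |g c - g₀| ≤ c / 2) (n : ℤ) (h0 : 0 < n) (hn : n ≤ 2 ^ p)
    (hng : |g₀ * n - 2 ^ (p - 1)| ≤ 1 / 5) : HitsPow p q (fun t => t * g t) (-emax q) := by
  have hem := emin_eq q
  have hM7 := H.seven_le_emax
  have hM := H.add_two_le_emax
  have hp := H.two_le
  have ht := tiny_pos p q
  have hn0 : (0 : ℝ) < n := by exact_mod_cast h0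
  have hn' : (n : ℝ) ≤ 2 ^ p := by exact_mod_cast hn
  refine H.hitsPow_neg_emax n h0 hn ?_
  set c : ℝ := n * tiny p q with hc
  have hcpos : 0 < c := mul_pos hn0 ht
  have e1 : (2 : ℝ) ^ p * tiny p q = 2 ^ (1 - emax q) := by
    rw [← zpow_natCast, tiny, two_zpow_mul, hem]
    congr 1
    ring
  have e2 : (2 : ℝ) ^ (-emax q) = 2 ^ (p - 1) * tiny p q := by
    rw [← zpow_natCast, tiny, two_zpow_mul, hem]
    congr 1
    push_cast [Nat.cast_sub (by omega : 1 ≤ p)]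
    ring
  have hc1 : c ≤ 2 ^ (1 - emax q) := by
    rw [← e1]
    exact mul_le_mul_of_nonneg_right hn' ht.le
  have hc2 : c ≤ 1 / 8 := by
    refine hc1.trans ((two_zpow_mono (k := -3) (by omega)).trans_eq ?_)
    norm_num
  -- the quadratic error is at most half of the least positive float
  have hc3 : c * c ≤ tiny p q / 2 := by
    calc c * c ≤ 2 ^ (1 - emax q) * 2 ^ (1 - emax q) :=
          mul_le_mul hc1 hc1 hcpos.le (two_zpow_pos _).le
      _ = 2 ^ (1 - emax q + (1 - emax q)) := two_zpow_mul _ _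
      _ ≤ 2 ^ (emin q - p - 1) := two_zpow_mono (by omega)
      _ = _ := two_zpow_sub_one _
  have h1 := abs_le.mp (h c hcpos hc2)
  have h2 := abs_le.mp hng
  have h3 : c * g c - 2 ^ (-emax q) = c * (g c - g₀) + (g₀ * n - 2 ^ (p - 1)) * tiny p q := by
    rw [e2, hc]
    ring
  rw [h3, abs_lt]
  constructor <;> nlinarith

end Admissible

theorem gate_swish : Gate (fun t => 1 / (1 + Real.exp (-t))) where
  nonneg t := by positivity
  le_one t := by
    rw [div_le_one (by positivity)]
    linarith [Real.exp_pos (-t)]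
  half_lt t ht := by
    have : Real.exp (-t) < 1 := Real.exp_lt_one_iff.mpr (by linarith)
    exact one_div_lt_one_div_of_lt (by positivity) (by linarith)
  left s hs := by
    rw [neg_neg, neg_div, Real.exp_neg, ← one_div]
    have : Real.exp (s / 2) ≤ Real.exp s := Real.exp_le_exp.mpr (by linarith)
    exact one_div_le_one_div_of_le (Real.exp_pos _) (by linarith)
  right s hs := by
    have h1 := Real.exp_pos (-s)
    have h2 : Real.exp (-s) ≤ Real.exp (-s / 2) := Real.exp_le_exp.mpr (by linarith)
    rw [sub_le_iff_le_add, ← sub_le_iff_le_add', le_div_iff₀ (by linarith)]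
    nlinarith [Real.exp_pos (-s / 2)]

theorem gate_swish_zero (c : ℝ) (hc : 0 < c) : |1 / (1 + Real.exp (-c)) - 1 / 2| ≤ c / 2 := by
  have h1 := Real.exp_pos (-c)
  have h2 := Real.add_one_le_exp (-c)
  have h3 : Real.exp (-c) < 1 := Real.exp_lt_one_iff.mpr (by linarith)
  have h4 : 1 / (1 + Real.exp (-c)) - 1 / 2 = (1 - Real.exp (-c)) / (2 * (1 + Real.exp (-c))) := by
    field_simp
    ring
  rw [h4, abs_of_pos (div_pos (by linarith) (by linarith)), div_le_iff₀ (by linarith)]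
  nlinarith

/-- The gate of `mish` as a rational function of the exponential. -/
theorem tanh_softplus (t : ℝ) : Real.tanh (softplus t) =
    ((1 + Real.exp t) ^ 2 - 1) / ((1 + Real.exp t) ^ 2 + 1) := by
  have h : 0 < 1 + Real.exp t := by positivity
  rw [softplus, Real.tanh_eq_sinh_div_cosh, Real.sinh_eq, Real.cosh_eq, Real.exp_neg,
    Real.exp_log h]
  field_simp

theorem gate_mish : Gate (fun t => Real.tanh (softplus t)) where
  nonneg t := by
    rw [tanh_softplus]
    have := Real.exp_pos t
    exact div_nonneg (by nlinarith) (by positivity)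
  le_one t := (Real.tanh_lt_one _).le
  half_lt t ht := by
    rw [tanh_softplus, div_lt_div_iff₀ two_pos (by positivity)]
    have : 1 < Real.exp t := Real.one_lt_exp_iff.mpr ht
    nlinarith
  left s hs := by
    rw [tanh_softplus, div_le_iff₀ (by positivity)]
    have h1 : Real.exp (-s) = Real.exp (-s / 2) * Real.exp (-s / 2) := by
      rw [← Real.exp_add]
      congr 1
      ring
    have h2 := Real.exp_pos (-s / 2)
    have h3 : Real.exp (-s / 2) ≤ 1 / 2 := by
      have h4 := Real.add_one_le_exp (s / 2)
      rw [neg_div, Real.exp_neg, ← one_div]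
      exact one_div_le_one_div_of_le two_pos (by linarith)
    rw [h1]
    set y := Real.exp (-s / 2)
    have h5 : y * y ≤ 1 / 4 := by nlinarith
    nlinarith [mul_pos h2 h2, mul_nonneg h2.le (sub_nonneg.mpr h3)]
  right s hs := by
    have h1 : Real.exp s * Real.exp (-s / 2) = Real.exp (s / 2) := by
      rw [← Real.exp_add]
      congr 1
      ring
    have h2 := Real.exp_pos (-s / 2)
    have h3 := Real.add_one_le_exp (s / 2)
    have h4 := Real.add_one_le_exp s
    rw [tanh_softplus, sub_le_iff_le_add, ← sub_le_iff_le_add', le_div_iff₀ (by positivity)]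
    nlinarith [mul_pos h2 (Real.exp_pos s), mul_pos (Real.exp_pos s) (Real.exp_pos (s / 2))]

theorem gate_mish_zero (c : ℝ) (hc : 0 < c) (hc' : c ≤ 1 / 8) :
    |Real.tanh (softplus c) - 3 / 5| ≤ c / 2 := by
  rw [tanh_softplus]
  have h1 : 1 < Real.exp c := Real.one_lt_exp_iff.mpr hc
  have h2 : Real.exp c * (1 - c) ≤ 1 := by
    have h3 := Real.add_one_le_exp (-c)
    have h4 : Real.exp c * Real.exp (-c) = 1 := by
      rw [← Real.exp_add, add_neg_cancel, Real.exp_zero]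
    nlinarith [Real.exp_pos c]
  set E := Real.exp c
  have h5 : ((1 + E) ^ 2 - 1) / ((1 + E) ^ 2 + 1) - 3 / 5 =
      2 * (E - 1) * (E + 3) / (5 * ((1 + E) ^ 2 + 1)) := by
    field_simp
    ring
  have h6 : E ≤ 8 / 7 := by nlinarith
  have h7 : E - 1 ≤ 8 / 7 * c := by nlinarith
  rw [h5, abs_of_pos (div_pos (by nlinarith) (by positivity)), div_le_iff₀ (by positivity)]
  have h8 : 2 * (E - 1) * (E + 3) ≤ 2 * (8 / 7 * c) * (29 / 7) := by nlinarith
  nlinarith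

/-! ### The Gaussian gate -/

/-- The unnormalized error function. -/
noncomputable def gaussInt (y : ℝ) : ℝ := ∫ t in (0 : ℝ)..y, Real.exp (-t ^ 2)

theorem gaussInt_neg (y : ℝ) : gaussInt (-y) = -gaussInt y := by
  have h := intervalIntegral.integral_comp_neg (a := 0) (b := y) (fun t : ℝ => Real.exp (-t ^ 2))
  simp only [neg_sq, neg_zero] at h
  rw [gaussInt, gaussInt, h, intervalIntegral.integral_symm]

theorem gaussInt_pos {y : ℝ} (hy : 0 < y) : 0 < gaussInt y :=
  intervalIntegral.intervalIntegral_pos_of_pos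
    (Continuous.intervalIntegrable (by fun_prop) _ _) (fun _ => Real.exp_pos _) hy

theorem gaussInt_le {y : ℝ} (hy : 0 ≤ y) : gaussInt y ≤ y := by
  have h := intervalIntegral.integral_mono_on (a := 0) (b := y) (μ := MeasureTheory.volume)
    (f := fun t : ℝ => Real.exp (-t ^ 2)) (g := fun _ => (1 : ℝ)) hy
    (Continuous.intervalIntegrable (by fun_prop) _ _)
    (Continuous.intervalIntegrable (by fun_prop) _ _)
    (fun t _ => Real.exp_le_one_iff.mpr (by nlinarith))
  simpa [gaussInt] using h

theorem integrable_exp_neg_sq : MeasureTheory.Integrable (fun t : ℝ => Real.exp (-t ^ 2)) := by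
  simpa using integrable_exp_neg_mul_sq (b := 1) one_pos

theorem gaussInt_add_tail (y : ℝ) :
    gaussInt y + ∫ t in Set.Ioi y, Real.exp (-t ^ 2) = √Real.pi / 2 := by
  have h := integral_gaussian_Ioi 1
  simp only [neg_mul, one_mul, div_one] at h
  rw [gaussInt, ← h]
  exact intervalIntegral.integral_interval_add_Ioi integrable_exp_neg_sq.integrableOn
    integrable_exp_neg_sq.integrableOn

theorem tail_nonneg (y : ℝ) : 0 ≤ ∫ t in Set.Ioi y, Real.exp (-t ^ 2) :=
  MeasureTheory.integral_nonneg fun _ => (Real.exp_pos _).le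

theorem tail_le {y : ℝ} (hy : 1 ≤ y) : ∫ t in Set.Ioi y, Real.exp (-t ^ 2) ≤ Real.exp (-y) := by
  rw [← integral_exp_neg_Ioi y]
  refine MeasureTheory.setIntegral_mono_on integrable_exp_neg_sq.integrableOn
    (exp_neg_integrableOn_Ioi y one_pos |>.congr_fun (fun t _ => by simp) measurableSet_Ioi)
    measurableSet_Ioi fun t ht => ?_
  have : y < t := ht
  exact Real.exp_le_exp.mpr (by nlinarith)

/-- The gate of `gelu`: the distribution function of the standard normal law. -/
noncomputable def gaussGate (t : ℝ) : ℝ := 1 / 2 * (1 + 2 / √Real.pi * gaussInt (t / √2))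

theorem one_le_sqrt_two : 1 ≤ √(2 : ℝ) := Real.one_le_sqrt.mpr one_le_two

theorem sqrt_two_le_sqrt_pi : √(2 : ℝ) ≤ √Real.pi :=
  Real.sqrt_le_sqrt (by linarith [Real.pi_gt_three])

theorem gaussGate_neg (t : ℝ) : gaussGate (-t) = 1 - gaussGate t := by
  rw [gaussGate, gaussGate, neg_div, gaussInt_neg]
  ring

theorem one_sub_gaussGate (t : ℝ) :
    1 - gaussGate t = (∫ u in Set.Ioi (t / √2), Real.exp (-u ^ 2)) / √Real.pi := by
  have h := gaussInt_add_tail (t / √2)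
  have hp : 0 < √Real.pi := Real.sqrt_pos.mpr Real.pi_pos
  rw [gaussGate, eq_div_iff hp.ne']
  field_simp
  linarith

theorem gaussGate_right (s : ℝ) (hs : 2 ≤ s) : 1 - gaussGate s ≤ Real.exp (-s / 2) := by
  have h2 := one_le_sqrt_two
  have h3 := sqrt_two_le_sqrt_pi
  have h4 : √(2 : ℝ) ≤ 2 := by
    nlinarith [Real.mul_self_sqrt (zero_le_two : (0 : ℝ) ≤ 2)]
  have h5 : s / 2 ≤ s / √2 := div_le_div_of_nonneg_left (by linarith) (by linarith) h4
  rw [one_sub_gaussGate]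
  calc _ ≤ ∫ u in Set.Ioi (s / √2), Real.exp (-u ^ 2) := div_le_self (tail_nonneg _) (by linarith)
    _ ≤ Real.exp (-(s / √2)) := tail_le (by linarith)
    _ ≤ Real.exp (-s / 2) := Real.exp_le_exp.mpr (by linarith)

theorem gaussGate_le_one (t : ℝ) : gaussGate t ≤ 1 := by
  have h := one_sub_gaussGate t
  have := div_nonneg (tail_nonneg (t / √2)) (Real.sqrt_nonneg Real.pi)
  linarith

theorem gate_gelu : Gate gaussGate where
  nonneg t := by
    have h := gaussGate_neg t
    have := gaussGate_le_one (-t)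
    linarith
  le_one := gaussGate_le_one
  half_lt t ht := by
    have h2 := one_le_sqrt_two
    have := gaussInt_pos (y := t / √2) (by positivity)
    have hp : 0 < √Real.pi := Real.sqrt_pos.mpr Real.pi_pos
    have : 0 < 2 / √Real.pi * gaussInt (t / √2) := by positivity
    rw [gaussGate]
    linarith
  left s hs := by
    rw [gaussGate_neg]
    exact gaussGate_right s hs
  right := gaussGate_right

theorem gate_gelu_zero (c : ℝ) (hc : 0 < c) : |gaussGate c - 1 / 2| ≤ c / 2 := by
  have h2 := one_le_sqrt_two
  have h3 := sqrt_two_le_sqrt_pi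
  have hp : 0 < √Real.pi := by linarith
  have hy : 0 < c / √2 := by positivity
  have h4 : gaussGate c - 1 / 2 = gaussInt (c / √2) / √Real.pi := by
    rw [gaussGate]
    ring
  rw [h4, abs_of_pos (div_pos (gaussInt_pos hy) hp), div_le_iff₀ hp]
  refine (gaussInt_le hy.le).trans ?_
  rw [div_le_iff₀ (by linarith)]
  nlinarith [Real.mul_self_sqrt (zero_le_two : (0 : ℝ) ≤ 2),
    mul_le_mul_of_nonneg_right h3 (by linarith : 0 ≤ √(2 : ℝ))]

/-! ### Gated units as products -/

theorem gelu_eq : gelu = fun t => t * gaussGate t := by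
  funext t
  rw [gelu, gaussGate, gaussInt]
  ring

theorem swish_eq : swish = fun t => t * (1 / (1 + Real.exp (-t))) := by
  funext t
  rw [swish]
  ring

/-! ### The identity and the sine -/

namespace Admissible

variable (H : Admissible p q)
include H

theorem tiny_le : tiny p q ≤ 1 / 4 := by
  have hem := emin_eq q
  have hM := H.add_two_le_emax
  have hM7 := H.seven_le_emax
  have h : tiny p q ≤ 2 ^ (-2 : ℤ) := two_zpow_mono (by omega)
  norm_num at h ⊢
  exact h

theorem sineLike_id : SineLike p q (fun t => t) where
  odd _ := rfl
  abs_le _ := le_rfl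
  tiny_lt t ht _ := by
    have := tiny_pos p q
    linarith
  two_tiny := by
    have := tiny_pos p q
    rw [sub_self, abs_zero]
    linarith
  zpow := by
    have hem := emin_eq q
    have hM := H.add_two_le_emax
    exact ⟨H.zpow_mem (by omega) (by omega), H.roundReal_of_mem _⟩
  one := by
    have one : (1 : ℝ) ∈ FinFloat p q := by simpa using H.small_mem 1 (by norm_num)
    refine ⟨2 ^ p, one, ?_, ?_⟩
    · rw [abs_of_pos (by positivity), pow_succ]
      have : (0 : ℤ) < 2 ^ p := by positivity
      linarith
    · have h : ((2 ^ p : ℤ) : ℝ) * 2 ^ (-(p : ℤ)) = 1 := by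
        push_cast
        rw [← zpow_natCast, two_zpow_mul, add_neg_cancel, zpow_zero]
      rw [h]
      exact H.roundReal_of_mem one

theorem sineLike_sin : SineLike p q Real.sin where
  odd := Real.sin_neg
  abs_le t := Real.abs_sin_le_abs
  tiny_lt t ht ht2 := by
    have h0 := tiny_pos p q
    have h1 := H.tiny_le
    rcases le_total t 1 with h | h
    · have h2 := Real.sin_gt_sub_cube (by linarith : 0 < t)
      have h3 : t ^ 3 ≤ t := by
        have : t ^ 2 ≤ 1 := pow_le_one₀ (by linarith) h
        nlinarith
      linarith
    · have h2 := Real.one_sub_sq_div_two_le_cos (x := Real.pi / 2 - t)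
      rw [Real.cos_pi_div_two_sub] at h2
      have h3 := Real.pi_gt_three
      have h4 := Real.pi_lt_four
      have h5 : (Real.pi / 2 - t) ^ 2 < 1 := by
        rw [sq_lt_one_iff_abs_lt_one, abs_lt]
        constructor <;> linarith
      linarith
  two_tiny := by
    have h0 := tiny_pos p q
    have h1 := H.tiny_le
    have h2 := Real.sin_gt_sub_cube (by linarith : 0 < 2 * tiny p q)
    have h3 := Real.sin_lt (by linarith : 0 < 2 * tiny p q)
    have h4 : tiny p q * tiny p q ≤ 1 / 16 := by nlinarith
    rw [abs_lt]
    constructor <;> nlinarith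
  zpow := by
    have hem := emin_eq q
    have hM := H.add_two_le_emax
    have hp := H.two_le
    have hm := H.zpow_mem (k := 1 - (p : ℤ)) (by omega) (by omega)
    set t : ℝ := 2 ^ (1 - (p : ℤ)) with ht
    have h0 : 0 < t := two_zpow_pos _
    have h2 := Real.sin_gt_sub_cube h0
    have h3 := Real.sin_lt h0
    refine ⟨hm, H.roundReal_eq_zpow (by omega) hm ?_
      (h3.trans (lt_add_of_pos_right _ (two_zpow_pos _)))⟩
    have e1 : t * t = 2 ^ (1 - (p : ℤ) - p - 2) * 8 := by
      rw [ht, show (8 : ℝ) = 2 ^ (3 : ℤ) by norm_num, two_zpow_mul, two_zpow_mul]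
      congr 1
      ring
    have e2 : t ≤ 1 / 2 := by
      refine (two_zpow_mono (k := -1) (by omega)).trans_eq ?_
      norm_num
    have h4 := two_zpow_pos (1 - (p : ℤ) - p - 2)
    have h5 : t ^ 3 = 2 ^ (1 - (p : ℤ) - p - 2) * 8 * t := by rw [← e1]; ring
    rw [h5] at h2
    nlinarith
  one := by
    have hem := emin_eq q
    have hM := H.add_two_le_emax
    have hp := H.two_le
    have one : (2 : ℝ) ^ (0 : ℤ) ∈ FinFloat p q := by simpa using H.small_mem 1 (by norm_num)
    have hu := two_zpow_pos (-(p : ℤ))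
    have hP : (2 : ℝ) ^ p * 2 ^ (-(p : ℤ)) = 1 := by
      rw [← zpow_natCast, two_zpow_mul, add_neg_cancel, zpow_zero]
    have hpi := Real.pi_gt_three
    have hpi' := Real.pi_lt_four
    have hP0 : (0 : ℝ) < 2 ^ p := by positivity
    -- at the largest multiple of `2 ^ (-p)` below `π / 2`, the sine is `1` up to a quadratic error
    set n : ℤ := ⌊Real.pi / 2 * 2 ^ p⌋ with hn
    have n1 : (n : ℝ) ≤ Real.pi / 2 * 2 ^ p := Int.floor_le _
    have n2 : Real.pi / 2 * 2 ^ p < n + 1 := Int.lt_floor_add_one _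
    have n3 : 0 ≤ n := Int.floor_nonneg.mpr (by positivity)
    refine ⟨n, by simpa using one, ?_, ?_⟩
    · rw [abs_of_nonneg n3]
      have : (n : ℝ) < 2 ^ (p + 1) := by
        rw [pow_succ]
        nlinarith
      exact_mod_cast this
    · set u : ℝ := 2 ^ (-(p : ℤ)) with hu'
      have d1 : 0 ≤ Real.pi / 2 - n * u := by nlinarith
      have d2 : Real.pi / 2 - n * u ≤ u := by nlinarith
      have h2 := Real.one_sub_sq_div_two_le_cos (x := Real.pi / 2 - n * u)
      rw [Real.cos_pi_div_two_sub] at h2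
      have u1 : u ≤ 1 / 4 := by
        refine (two_zpow_mono (k := -2) (by omega)).trans_eq ?_
        norm_num
      have h := H.roundReal_eq_zpow (r := Real.sin (n * u)) (by omega) one ?_ ?_
      · simpa using h
      · have e : (2 : ℝ) ^ ((0 : ℤ) - p - 2) = u / 4 := by
          rw [hu', zpow_sub₀ two_ne_zero, zero_sub]
          norm_num
        rw [e, zpow_zero]
        nlinarith
      · rw [zpow_zero]
        exact (Real.sin_le_one _).trans_lt (lt_add_of_pos_right _ (two_zpow_pos _))

end Admissible

/-! ### Boxes of floats -/

theorem box_finite (d : ℕ) : Finite (Box p q d) := by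
  have := (finite_finFloat p q).to_subtype
  infer_instance

theorem Admissible.box_nontrivial (H : Admissible p q) {d : ℕ} (hd : 0 < d) :
    Nontrivial (Box p q d) := by
  have hM := H.add_two_le_emax
  have hM7 := H.seven_le_emax
  have one : (1 : ℝ) ∈ FinFloat p q := by simpa using H.small_mem 1 (by norm_num)
  have h1 : (1 : ℝ) < 2 ^ (emax q - 1) := by
    have := two_zpow_strictMono (j := 0) (k := emax q - 1) (by omega)
    simpa using this
  refine ⟨⟨fun _ => zeroFloat p q, fun _ => ?_⟩, ⟨fun _ => ⟨1, one⟩, fun _ => ?_⟩, fun h => ?_⟩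
  · simpa [zeroFloat] using zero_lt_one.trans h1
  · simpa using h1
  · have h2 := congrArg (fun x : Box p q d => (x.1 ⟨0, hd⟩ : ℝ)) h
    simp [zeroFloat] at h2

end FPNN

theorem mainTheorem3 (p q : ℕ) (hp : 2 ≤ p) (hpq : p + 3 ≤ 2 ^ (q - 1))
    (S : FPNN.ReductionOrder)
    (α lam : ℝ) (hα : |α - 1.6732| ≤ 0.0001) (hlam : |lam - 1.0507| ≤ 0.0001)
    (ρ : ℝ → ℝ)
    (hρ : ρ ∈ ({(fun x => x), FPNN.relu, FPNN.elu, FPNN.selu α lam, FPNN.gelu, FPNN.swish,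
      FPNN.mish, Real.sin} : Set (ℝ → ℝ)))
    (d : ℕ) (hd : 0 < d)
    (f : FPNN.Box p q d → {y : FPNN.ExtFloat p q // y ≠ FPNN.ExtFloat.nan}) :
    ∃ N : FPNN.Network p q d 1, ∀ x : FPNN.Box p q d,
      N.eval S (FPNN.correctlyRounded p q ρ) (fun i => .finite (x.1 i)) 0 = (f x).1 := by
  have H : FPNN.Admissible p q := ⟨hp, hpq⟩
  have hM7 := H.seven_le_emax
  have := FPNN.box_finite (p := p) (q := q) d
  have := H.box_nontrivial hd
  have hX : ∀ (x : FPNN.Box p q d) i, |(x.1 i : ℝ)| ≤ 2 ^ (FPNN.emax q - 1) :=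
    fun x i => (x.2 i).le
  have hinj : Function.Injective (Subtype.val : FPNN.Box p q d → _) := Subtype.val_injective
  have selu : ∀ {a l : ℝ}, 1 ≤ l → l < 5 / 4 → 0 ≤ a → l * a ≤ 2 → ρ = FPNN.selu a l →
      ∃ N : FPNN.Network p q d 1, ∀ x : FPNN.Box p q d,
        N.eval S (FPNN.correctlyRounded p q ρ) (fun i => .finite (x.1 i)) 0 = (f x).1 := by
    rintro a l h1 h2 h3 h4 rfl
    have u := H.hitsPow_zero_of_linear (ρ := FPNN.selu a l) h1 h2
      fun t ht => by rw [FPNN.selu, if_pos ht]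
    exact H.exists_network_of_reluLike (FPNN.reluLike_selu h1 h2 h3 h4) S hd hX hinj
      (by omega) le_rfl le_rfl (by omega) u u f
  have gated : ∀ {g : ℝ → ℝ} {g₀ : ℝ} (n : ℤ), FPNN.Gate g →
      (∀ c, 0 < c → c ≤ 1 / 8 → |g c - g₀| ≤ c / 2) → 0 < n → n ≤ 2 ^ p →
      |g₀ * n - 2 ^ (p - 1)| ≤ 1 / 5 → ρ = (fun t => t * g t) →
      ∃ N : FPNN.Network p q d 1, ∀ x : FPNN.Box p q d,
        N.eval S (FPNN.correctlyRounded p q ρ) (fun i => .finite (x.1 i)) 0 = (f x).1 := by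
    rintro g g₀ n hg h0 hn1 hn2 hn3 rfl
    exact H.exists_network_of_reluLike hg.reluLike S hd hX hinj
      le_rfl (by omega) (by omega) le_rfl
      (H.hitsPow_neg_emax_of_gate h0 n hn1 hn2 hn3) (H.hitsPow_emax_of_gate hg) f
  have half : |(1 / 2 : ℝ) * ((2 ^ p : ℤ) : ℝ) - 2 ^ (p - 1)| ≤ 1 / 5 := by
    have : (2 : ℝ) ^ p = 2 ^ (p - 1) * 2 := by
      rw [← pow_succ]
      congr 1
      omega
    push_cast
    rw [this, show (1 / 2 : ℝ) * (2 ^ (p - 1) * 2) - 2 ^ (p - 1) = 0 by ring, abs_zero]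
    norm_num
  simp only [Set.mem_insert_iff, Set.mem_singleton_iff] at hρ
  rcases hρ with rfl | rfl | h | h | h | h | h | rfl
  · exact H.exists_network_of_sineLike H.sineLike_id S hd hX hinj f
  · have u := H.hitsPow_zero_of_linear (ρ := FPNN.relu) le_rfl (by norm_num)
      fun t ht => by rw [FPNN.relu, max_eq_right ht.le, one_mul]
    exact H.exists_network_of_reluLike FPNN.reluLike_relu S hd hX hinj
      (by omega) le_rfl le_rfl (by omega) u u f
  · exact selu le_rfl (by norm_num) zero_le_one (by norm_num) (h.trans FPNN.elu_eq_selu)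
  · have h1 := abs_le.mp hα
    have h2 := abs_le.mp hlam
    exact selu (by linarith) (by linarith) (by linarith) (by nlinarith) h
  · exact gated (2 ^ p) FPNN.gate_gelu (fun c hc _ => FPNN.gate_gelu_zero c hc) (by positivity)
      le_rfl half (h.trans FPNN.gelu_eq)
  · exact gated (2 ^ p) FPNN.gate_swish (fun c hc _ => FPNN.gate_swish_zero c hc) (by positivity)
      le_rfl half (h.trans FPNN.swish_eq)
  · -- the integer closest to `5 / 3 * 2 ^ (p - 1)`
    have hP : (2 : ℤ) ^ p = 2 ^ (p - 1) * 2 := by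
      rw [← pow_succ]
      congr 1
      omega
    have hP1 : (0 : ℤ) < 2 ^ (p - 1) := by positivity
    obtain ⟨n, n1, n2⟩ : ∃ n : ℤ, 3 * n ≤ 5 * 2 ^ (p - 1) + 1 ∧ 5 * 2 ^ (p - 1) - 1 ≤ 3 * n :=
      ⟨(5 * 2 ^ (p - 1) + 1) / 3, by omega, by omega⟩
    refine gated n FPNN.gate_mish FPNN.gate_mish_zero (by omega) (by omega) ?_ h
    have n1' : (3 : ℝ) * n ≤ 5 * 2 ^ (p - 1) + 1 := by exact_mod_cast n1
    have n2' : (5 : ℝ) * 2 ^ (p - 1) - 1 ≤ 3 * n := by exact_mod_cast n2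
    rw [abs_le]
    constructor <;> linarith
  · exact H.exists_network_of_sineLike H.sineLike_sin S hd hX hinj f
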